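/- **Conventions.** $L$ is a countable language with a fixed numbering of its symbols, and $\mathcal B$ is a countable $L$-structure. $\mathcal A$ is a structure for a countable (numbered) relational language with basic relations $R_i$ of arity $k_i$. $\mathcal B^{<\omega}$ is the set of finite tuples from $\mathcal B$. A *generalized $L_{\omega_1\omega}$ formula* (for an $r$-ary relation on $\mathcal B^{<\omega}$) is a family of $L_{\omega_1\omega}$ formulas, one for each choice $(n_1,\dots,n_r)$ of lengths of the $r$ tuples; it defines $S\subseteq(\mathcal B^{<\omega})^r$ if for all $n_1,\dots,n_r$ the corresponding formula defines $S\cap(\mathcal B^{n_1}\times\dots\times\mathcal B^{n_r})$. It is $\Sigma_\alpha$ if each member of the family is; it is $X$-computable if the members (as labelled trees) are computable from $X$ uniformly in the lengths. Here $\Sigma_0=\Pi_0$ are the finitary quantifier-free formulas, and for $\alpha>0$ a $\Sigma_\alpha$ formula is a countable disjunction of formulas $\exists\bar u\,\psi$ with $\psi\in\Pi_\beta$, $\beta<\alpha$; dually for $\Pi_\alpha$. An *interpretation* of $\mathcal A$ in $\mathcal B$ (with parameters $\bar b$) by generalized formulas consists of $D\subseteq\mathcal B^{<\omega}$, an equivalence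 relation $\equiv$ on $D$, and relations $R_i^*\subseteq D^{k_i}$ respecting $\equiv$, all defined by generalized $L_{\omega_1\omega}$ formulas (with parameters $\bar b$), such that $(D,(R_i^*)_i)/{\equiv}\;\cong\mathcal A$. We write $\pm\!\equiv$, $\pm R_i^*$ for these relations together with their complements in $D^2$, $D^{k_i}$. **Theorem.** Suppose there is an interpretation of $\mathcal A$ in $\mathcal B$ by generalized $L_{\omega_1\omega}$ formulas with parameters $\bar b\in\mathcal B^m$. For $\bar c$ in the orbit of $\bar b$ under $\mathrm{Aut}(\mathcal B)$, let $D_{\bar c},\equiv_{\bar c},R_{i,\bar c}$ be what the same formulas define with parameters $\bar c$, and let $\mathcal A_{\bar c}=(D_{\bar c},(R_{i,\bar c})_i)/{\equiv_{\bar c}}$. Assume that there are a relation $F\subseteq(\mathcal B^{<\omega})^4$ defined without parameters by a generalized $L_{\omega_1\omega}$ formula, and isomorphisms $f_{\bar c,\bar d}:\mathcal A_{\bar c}\to\mathcal A_{\bar d}$ for all $\bar c,\bar d$ in the orbit of $\bar b$, such that for $\bar x\in D_{\bar c}$, $\bar y\in D_{\bar d}$ $$f_{\bar c,\bar d}([\bar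 x])=[\bar y]\iff(\bar c,\bar d,\bar x,\bar y)\in F,$$ and such that $f_{\bar c,\bar c}=\mathrm{id}$ and $f_{\bar d,\bar e}\circ f_{\bar c,\bar d}=f_{\bar c,\bar e}$ for all $\bar c,\bar d,\bar e$ in the orbit. Then there is an interpretation of $\mathcal A$ in $\mathcal B$ by generalized $L_{\omega_1\omega}$ formulas without parameters, given by some $D',\sim,R_i'$, which satisfies all of the following. 1. For each countable ordinal $\alpha\ge1$: if $D_{\bar b}$, $\equiv_{\bar b}$ and each $R_{i,\bar b}$ are defined by (generalized) $\Sigma_\alpha$ formulas with parameters $\bar b$, and $F$ and the orbit of $\bar b$ are defined by parameter-free $\Sigma_\alpha$ formulas (generalized in the case of $F$), then $D'$, $\sim$ and each $R_i'$ are defined by parameter-free generalized $\Sigma_\alpha$ formulas. 2. The same holds with $D_{\bar b},\pm\!\equiv_{\bar b},\pm R_{i,\bar b}$ in the hypothesis and $D',\pm\!\sim,\pm R_i'$ in the conclusion. 3. Let $X\subseteq\omega$. If $D_{\bar b}$, $\equiv_{\bar b}$ and each $R_{i,\bar b}$ are defined by $X$-computable generalized formulas with parameters $\bar b$, and $F$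 and the orbit of $\bar b$ are defined by $X$-computable parameter-free formulas (generalized in the case of $F$), then $D'$, $\sim$ and each $R_i'$ are defined by $X$-computable parameter-free generalized formulas. If the formulas for the $R_{i,\bar b}$ are $X$-computable uniformly in $i$, then so are those for the $R_i'$. Both statements also hold with $\pm\!\equiv_{\bar b},\pm R_{i,\bar b}$ and $\pm\!\sim,\pm R_i'$, and, for each countable $\alpha\ge1$, with "$X$-computable and $\Sigma_\alpha$" in place of "$X$-computable" throughout. (For every countable set of $L_{\omega_1\omega}$ formulas there is an $X$ such that all of them are $X$-computable.) 4. If $D_{\bar b}\subseteq\mathcal B^n$ for a single $n$, then $D'\subseteq\mathcal B^{n+m}$, and $D',\sim,R_i'$ are defined by (non-generalized) $L_{\omega_1\omega}$ formulas without parameters. 5. If $D_{\bar b}\subseteq\mathcal B^n$ for a single $n$, the set $D_{\bar b}$, $\equiv_{\bar b}$ and each $R_{i,\bar b}$ are defined by finitary first-order formulas with parameters $\bar b$, and $F\cap(\mathcal B^m\times\mathcal B^m\times\mathcal B^n\times\mathcal B^n)$ and the orbit of $\bar b$ are defined by finitary first-order formulas without parameters, then $D',\sim,R_i'$ are defined by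 finitary first-order formulas without parameters. -/

import Mathlib

open FirstOrder

universe u v u' v' w w'

/-! ## Formulas of `L_{ω₁ω}` -/

/-- Formulas of `L_{ω₁ω}` whose free variables are among `x_0, …, x_{n-1}`.
`ex` and `all` bind the last variable of their body. -/
inductive InfForm (L : FirstOrder.Language.{u, v}) : ℕ → Type (max u v)
  | falsum {n : ℕ} : InfForm L n
  | equal {n : ℕ} (t₁ t₂ : L.Term (Fin n)) : InfForm L n
  | rel {n k : ℕ} (R : L.Relations k) (ts : Fin k → L.Term (Fin n)) : InfForm L n
  | neg {n : ℕ} (φ : InfForm L n) : InfForm L n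
  | and {n : ℕ} (φ ψ : InfForm L n) : InfForm L n
  | or {n : ℕ} (φ ψ : InfForm L n) : InfForm L n
  | iDisj {n : ℕ} (φ : ℕ → InfForm L n) : InfForm L n
  | iConj {n : ℕ} (φ : ℕ → InfForm L n) : InfForm L n
  | ex {n : ℕ} (φ : InfForm L (n + 1)) : InfForm L n
  | all {n : ℕ} (φ : InfForm L (n + 1)) : InfForm L n

namespace InfForm

variable {L : FirstOrder.Language.{u, v}}

/-- Satisfaction of a formula by an assignment. -/
def Realize {B : Type w} [L.Structure B] : ∀ {n : ℕ}, InfForm L n → (Fin n → B) → Prop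
  | _, falsum, _ => False
  | _, equal t₁ t₂, a => t₁.realize a = t₂.realize a
  | _, rel R ts, a => FirstOrder.Language.Structure.RelMap R (fun j => (ts j).realize a)
  | _, neg φ, a => ¬ φ.Realize a
  | _, and φ ψ, a => φ.Realize a ∧ ψ.Realize a
  | _, or φ ψ, a => φ.Realize a ∨ ψ.Realize a
  | _, iDisj φ, a => ∃ i, (φ i).Realize a
  | _, iConj φ, a => ∀ i, (φ i).Realize a
  | n, ex φ, a => ∃ z : B, φ.Realize (Fin.snoc a z : Fin (n + 1) → B)
  | n, all φ, a => ∀ z : B, φ.Realize (Fin.snoc a z : Fin (n + 1) → B)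

/-- Finitary (first-order) formulas. -/
def IsFinitary : ∀ {n : ℕ}, InfForm L n → Prop
  | _, falsum => True
  | _, equal _ _ => True
  | _, rel _ _ => True
  | _, neg φ => φ.IsFinitary
  | _, and φ ψ => φ.IsFinitary ∧ ψ.IsFinitary
  | _, or φ ψ => φ.IsFinitary ∧ ψ.IsFinitary
  | _, iDisj _ => False
  | _, iConj _ => False
  | _, ex φ => φ.IsFinitary
  | _, all φ => φ.IsFinitary

/-- Finitary quantifier-free formulas. -/
def IsFinQF : ∀ {n : ℕ}, InfForm L n → Prop
  | _, falsum => True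
  | _, equal _ _ => True
  | _, rel _ _ => True
  | _, neg φ => φ.IsFinQF
  | _, and φ ψ => φ.IsFinQF ∧ ψ.IsFinQF
  | _, or φ ψ => φ.IsFinQF ∧ ψ.IsFinQF
  | _, iDisj _ => False
  | _, iConj _ => False
  | _, ex _ => False
  | _, all _ => False

/-- The block of existential quantifiers `∃ x_n … x_{n+k-1}`. -/
def exs {n : ℕ} : ∀ k : ℕ, InfForm L (n + k) → InfForm L n
  | 0, φ => φ
  | k + 1, φ => exs k (ex φ)

/-- The block of universal quantifiers `∀ x_n … x_{n+k-1}`. -/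
def alls {n : ℕ} : ∀ k : ℕ, InfForm L (n + k) → InfForm L n
  | 0, φ => φ
  | k + 1, φ => alls k (all φ)

/-- The two sides of the hierarchy of infinitary formulas. -/
inductive Side
  | sigma
  | pi

/-- The hierarchy of infinitary formulas: `Σ₀ = Π₀` are the finitary quantifier-free formulas;
for `α > 0`, a `Σ_α` formula is a countable disjunction of formulas `∃ ū ψ` with `ψ` in `Π_β`
for some `β < α`, and a `Π_α` formula is a countable conjunction of formulas `∀ ū ψ` with `ψ`
in `Σ_β` for some `β < α`. -/
inductive InHierarchy : Side → Ordinal.{0} → ∀ {n : ℕ}, InfForm L n → Prop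
  | qf (s : Side) {n : ℕ} (φ : InfForm L n) (h : φ.IsFinQF) : InHierarchy s 0 φ
  | sigma {n : ℕ} (α : Ordinal.{0}) (β : ℕ → Ordinal.{0}) (k : ℕ → ℕ)
      (ψ : ∀ i, InfForm L (n + k i)) (hβ : ∀ i, β i < α)
      (h : ∀ i, InHierarchy Side.pi (β i) (ψ i)) :
      InHierarchy Side.sigma α (iDisj fun i => exs (k i) (ψ i))
  | pi {n : ℕ} (α : Ordinal.{0}) (β : ℕ → Ordinal.{0}) (k : ℕ → ℕ)
      (ψ : ∀ i, InfForm L (n + k i)) (hβ : ∀ i, β i < α)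
      (h : ∀ i, InHierarchy Side.sigma (β i) (ψ i)) :
      InHierarchy Side.pi α (iConj fun i => alls (k i) (ψ i))

/-- The formula as a labelled well-founded tree. A position in the tree is the list of branches
taken from the root; `φ.label p` is the Gödel number of the symbol (or atomic formula) at
position `p`. Positions outside the tree get the label `⟨10, 0⟩`. -/
def label [Encodable (Σ k, L.Functions k)] [Encodable (Σ k, L.Relations k)] :
    ∀ {n : ℕ}, InfForm L n → List ℕ → ℕ
  | _, falsum, [] => Nat.pair 0 0
  | _, equal t₁ t₂, [] => Nat.pair 1 (Nat.pair (Encodable.encode t₁) (Encodable.encode t₂))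
  | _, @rel _ _ k R ts, [] =>
      Nat.pair 2 (Nat.pair (Encodable.encode (⟨k, R⟩ : Σ k, L.Relations k))
        (Encodable.encode (List.ofFn fun j => Encodable.encode (ts j))))
  | _, neg _, [] => Nat.pair 3 0
  | _, and _ _, [] => Nat.pair 4 0
  | _, or _ _, [] => Nat.pair 5 0
  | _, iDisj _, [] => Nat.pair 6 0
  | _, iConj _, [] => Nat.pair 7 0
  | _, ex _, [] => Nat.pair 8 0
  | _, all _, [] => Nat.pair 9 0
  | _, neg φ, 0 :: p => φ.label p
  | _, and φ _, 0 :: p => φ.label p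
  | _, and _ ψ, 1 :: p => ψ.label p
  | _, or φ _, 0 :: p => φ.label p
  | _, or _ ψ, 1 :: p => ψ.label p
  | _, iDisj φ, i :: p => (φ i).label p
  | _, iConj φ, i :: p => (φ i).label p
  | _, ex φ, 0 :: p => φ.label p
  | _, all φ, 0 :: p => φ.label p
  | _, _, _ => Nat.pair 10 0

end InfForm

/-! ## Computability relative to a set -/

open Classical in
/-- The characteristic function of `X`, as an oracle. -/
noncomputable def charOracle (X : Set ℕ) : ℕ →. ℕ :=
  fun n => Part.some (if n ∈ X then 1 else 0)

/-- The total function `g` is computable with oracle `X`. -/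
def XComputable {α β : Type*} [Primcodable α] [Primcodable β] (X : Set ℕ) (g : α → β) : Prop :=
  ComputableIn {charOracle X} g

/-- An `X`-computable formula of `L_{ω₁ω}`: its labelled tree is computable in `X`. -/
def InfForm.IsXComputable {L : FirstOrder.Language.{u, v}} [Encodable (Σ k, L.Functions k)]
    [Encodable (Σ k, L.Relations k)] (X : Set ℕ) {n : ℕ} (φ : InfForm L n) : Prop :=
  XComputable X φ.label

/-! ## Relations on tuples of arbitrary length, and generalized formulas -/

/-- `B^{<ω}`: finite tuples from `B`. -/
abbrev Tup (B : Type w) : Type w := Σ k : ℕ, (Fin k → B)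

/-- Concatenation of `r` tuples. -/
def concat {B : Type w} {r : ℕ} {s : Fin r → ℕ} (y : ∀ j, Fin (s j) → B) :
    Fin (∑ j, s j) → B :=
  fun i => y (finSigmaFinEquiv.symm i).1 (finSigmaFinEquiv.symm i).2

/-- A generalized `L_{ω₁ω}` formula with `m` parameter variables, for an `r`-ary relation
on `B^{<ω}`: one `L_{ω₁ω}` formula for each choice of the lengths of the `r` tuples. -/
abbrev GenForm (L : FirstOrder.Language.{u, v}) (m r : ℕ) : Type (max u v) :=
  ∀ s : Fin r → ℕ, InfForm L (m + ∑ j, s j)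

/-- Satisfaction of a generalized formula, with parameters `p`, by `r` tuples. -/
def GenForm.Realize {L : FirstOrder.Language.{u, v}} {B : Type w} [L.Structure B] {m r : ℕ}
    (Φ : GenForm L m r) (p : Fin m → B) (x : Fin r → Tup B) : Prop :=
  (Φ fun j => (x j).1).Realize (Fin.append p (concat fun j => (x j).2))

/-- A class of `L_{ω₁ω}` formulas. -/
abbrev FormClass (L : FirstOrder.Language.{u, v}) : Type (max u v) := ∀ n : ℕ, InfForm L n → Prop

/-- All `L_{ω₁ω}` formulas. -/
def allForms (L : FirstOrder.Language.{u, v}) : FormClass L := fun _ _ => True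

/-- The `Σ_α` formulas. -/
def sigmaForms (L : FirstOrder.Language.{u, v}) (α : Ordinal.{0}) : FormClass L :=
  fun _ φ => φ.InHierarchy InfForm.Side.sigma α

/-- The finitary formulas. -/
def finitaryForms (L : FirstOrder.Language.{u, v}) : FormClass L := fun _ φ => φ.IsFinitary

section Definability

variable {L : FirstOrder.Language.{u, v}} {B : Type w} [L.Structure B] {m : ℕ}

/-- `S` is defined, with parameters `p`, by a generalized formula
all of whose components are in `Γ`. -/
def GenDefinable (Γ : FormClass L) (p : Fin m → B) (r : ℕ) (S : Set (Fin r → Tup B)) : Prop :=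
  ∃ Φ : GenForm L m r, (∀ s, Γ _ (Φ s)) ∧ ∀ x, x ∈ S ↔ Φ.Realize p x

/-- The part of `S` that consists of tuples of lengths `s` is defined, with parameters `p`,
by a single (non-generalized) formula in `Γ`. -/
def DefinableAt (Γ : FormClass L) (p : Fin m → B) {r : ℕ} (s : Fin r → ℕ)
    (S : Set (Fin r → Tup B)) : Prop :=
  ∃ φ : InfForm L (m + ∑ j, s j), Γ _ φ ∧
    ∀ y : ∀ j, Fin (s j) → B,
      (fun j => (⟨s j, y j⟩ : Tup B)) ∈ S ↔ φ.Realize (Fin.append p (concat y))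

/-- A subset of `B^m` is defined, without parameters, by a formula in `Γ`. -/
def SetDefinable (Γ : FormClass L) (O : Set (Fin m → B)) : Prop :=
  ∃ φ : InfForm L m, Γ _ φ ∧ ∀ c, c ∈ O ↔ φ.Realize c

variable [Encodable (Σ k, L.Functions k)] [Encodable (Σ k, L.Relations k)]

/-- The relations `S i` are defined, with parameters `p`, by generalized formulas with components
in `Γ` that are `X`-computable, uniformly in `i` and in the lengths of the tuples. -/
def XGenDefinableFamily {ι : Type*} [Encodable ι] (X : Set ℕ) (Γ : FormClass L) (p : Fin m → B)
    (r : ι → ℕ) (S : ∀ i, Set (Fin (r i) → Tup B)) : Prop :=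
  ∃ Φ : ∀ i, GenForm L m (r i),
    (∀ i s, Γ _ (Φ i s)) ∧ (∀ i x, x ∈ S i ↔ (Φ i).Realize p x) ∧
    ∃ g : ℕ × List ℕ × List ℕ → ℕ, XComputable X g ∧
      ∀ i s pos, g (Encodable.encode i, List.ofFn s, pos) = (Φ i s).label pos

/-- `S` is defined, with parameters `p`, by a generalized formula that is `X`-computable (as a
sequence of formulas) and has its components in `Γ`. -/
def XGenDefinable (X : Set ℕ) (Γ : FormClass L) (p : Fin m → B) (r : ℕ)
    (S : Set (Fin r → Tup B)) : Prop :=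
  XGenDefinableFamily X Γ p (fun _ : Unit => r) (fun _ => S)

/-- A subset of `B^m` is defined, without parameters, by an `X`-computable formula in `Γ`. -/
def XSetDefinable (X : Set ℕ) (Γ : FormClass L) (O : Set (Fin m → B)) : Prop :=
  ∃ φ : InfForm L m, Γ _ φ ∧ φ.IsXComputable X ∧ ∀ c, c ∈ O ↔ φ.Realize c

end Definability

/-- The orbit of a tuple under the automorphism group. -/
def tupOrbit (L : FirstOrder.Language.{u, v}) {B : Type w} [L.Structure B] {m : ℕ} (b : Fin m → B) :
    Set (Fin m → B) :=
  {c | ∃ σ : B ≃[L] B, ∀ i, σ (b i) = c i}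

/-! ## Interpretations -/

/-- The data `D ⊆ B^{<ω}`, `≡` and `R*` of an interpretation in `B` of a structure for the
relational language `LA`. -/
structure TupPresentation (LA : FirstOrder.Language.{u', v'}) (B : Type w) where
  dom : Set (Tup B)
  eqv : Tup B → Tup B → Prop
  rel : ∀ {k : ℕ}, LA.Relations k → Set (Fin k → Tup B)

namespace TupPresentation

variable {LA : FirstOrder.Language.{u', v'}} {B : Type w} (P : TupPresentation LA B)

/-- The quotient `D/≡`. -/
def Carrier : Type w := Quot fun x y : P.dom => P.eqv x y

/-- The class of `x`. -/
def cls (x : P.dom) : P.Carrier := Quot.mk _ x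

/-- The quotient structure `(D, (R*))/≡`. -/
instance [LA.IsRelational] : LA.Structure P.Carrier where
  funMap g := isEmptyElim g
  RelMap R q := ∃ x : Fin _ → P.dom, (∀ j, P.cls (x j) = q j) ∧ (fun j => (x j : Tup B)) ∈ P.rel R

/-- `≡` is an equivalence relation on `D`, the `R*` are relations on `D` that respect `≡`,
and the quotient structure is isomorphic to `A`. -/
structure Interprets [LA.IsRelational] (A : Type w') [LA.Structure A] : Prop where
  eqv_dom : ∀ x y, P.eqv x y → x ∈ P.dom ∧ y ∈ P.dom
  eqv_refl : ∀ x ∈ P.dom, P.eqv x x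
  eqv_symm : ∀ x y, P.eqv x y → P.eqv y x
  eqv_trans : ∀ x y z, P.eqv x y → P.eqv y z → P.eqv x z
  rel_dom : ∀ (k : ℕ) (R : LA.Relations k), ∀ x ∈ P.rel R, ∀ j, x j ∈ P.dom
  rel_congr : ∀ (k : ℕ) (R : LA.Relations k) (x y : Fin k → Tup B),
    (∀ j, P.eqv (x j) (y j)) → x ∈ P.rel R → y ∈ P.rel R
  iso : Nonempty (P.Carrier ≃[LA] A)

/-- `D`, as a unary relation on tuples. -/
def domRel : Set (Fin 1 → Tup B) := {x | x 0 ∈ P.dom}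

/-- `≡`, as a binary relation on tuples. -/
def eqvRel : Set (Fin 2 → Tup B) := {x | P.eqv (x 0) (x 1)}

/-- The complement of `≡` in `D²`. -/
def neqvRel : Set (Fin 2 → Tup B) := {x | x 0 ∈ P.dom ∧ x 1 ∈ P.dom ∧ ¬ P.eqv (x 0) (x 1)}

/-- The complement of `R*` in `D^k`. -/
def nrel {k : ℕ} (R : LA.Relations k) : Set (Fin k → Tup B) :=
  {x | (∀ j, x j ∈ P.dom) ∧ x ∉ P.rel R}

/-- `D`, `≡` and each `R*` have the property `Q`. -/
def Each (Q : ∀ r : ℕ, Set (Fin r → Tup B) → Prop) : Prop :=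
  Q 1 P.domRel ∧ Q 2 P.eqvRel ∧ ∀ (k : ℕ) (R : LA.Relations k), Q k (P.rel R)

/-- `D`, `±≡` and each `±R*` have the property `Q`. -/
def EachPM (Q : ∀ r : ℕ, Set (Fin r → Tup B) → Prop) : Prop :=
  P.Each Q ∧ Q 2 P.neqvRel ∧ ∀ (k : ℕ) (R : LA.Relations k), Q k (P.nrel R)

/-- All tuples in `D` have length `n`. -/
def DomIn (n : ℕ) : Prop := ∀ x ∈ P.dom, x.1 = n

section Uniform

variable {L : FirstOrder.Language.{u, v}} [L.Structure B] {m : ℕ} [Encodable (Σ k, L.Functions k)]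
  [Encodable (Σ k, L.Relations k)] [Encodable (Σ k, LA.Relations k)]

/-- `D`, `≡` and the `R*` are defined by generalized formulas with components in `Γ`
that are computable uniformly in `X`. -/
def UniformlyX (X : Set ℕ) (Γ : FormClass L) (p : Fin m → B) : Prop :=
  XGenDefinable X Γ p 1 P.domRel ∧ XGenDefinable X Γ p 2 P.eqvRel ∧
    XGenDefinableFamily X Γ p (fun R : Σ k, LA.Relations k => R.1) (fun R => P.rel R.2)

/-- `D`, `±≡` and the `±R*` are defined by generalized formulas with components in `Γ`
that are computable uniformly in `X`. -/
def UniformlyXPM (X : Set ℕ) (Γ : FormClass L) (p : Fin m → B) : Prop :=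
  P.UniformlyX X Γ p ∧ XGenDefinable X Γ p 2 P.neqvRel ∧
    XGenDefinableFamily X Γ p (fun R : Σ k, LA.Relations k => R.1) (fun R => P.nrel R.2)

end Uniform

end TupPresentation

/-- The formulas, with `m` parameter variables, that are used in an interpretation by generalized
`L_{ω₁ω}` formulas. -/
structure InterpForms (LA : FirstOrder.Language.{u', v'}) (L : FirstOrder.Language.{u, v}) (m : ℕ) where
  dom : GenForm L m 1
  eqv : GenForm L m 2
  rel : ∀ {k : ℕ}, LA.Relations k → GenForm L m k

/-- What the formulas define in `B` with parameters `c`. -/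
def InterpForms.at {LA : FirstOrder.Language.{u', v'}} {L : FirstOrder.Language.{u, v}} {m : ℕ}
    (I : InterpForms LA L m) {B : Type w} [L.Structure B] (c : Fin m → B) :
    TupPresentation LA B where
  dom := {x | I.dom.Realize c ![x]}
  eqv x y := I.eqv.Realize c ![x, y]
  rel R := {x | (I.rel R).Realize c x}

/-! The parameter is absorbed into the tuples. The new domain consists of the concatenations `(c,
x)` with `c` in the orbit of `b` and `x` in `D_c`, and `(c, x)` stands for the element
`f_{c,b}([x])` of the structure with parameters `b`. By coherence, `f_{c,b}([x]) = f_{d,b}([y])`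
holds exactly when `F(c, d, x, y)`, and each `f_{c,b}` is an isomorphism. So every relation on the
quotient at `b` pulls back to a relation on the new domain, and the quotient of the new domain is
isomorphic to the old one.

For definability, all pullbacks have one shape (`parameterFree`): the tuples `(c_j, x_j)` are
related iff there are one `e` in the orbit and some `y ∈ S_e` with `x_j ∈ D_{c_j}` and `F(c_j, e,
x_j, y_j)` for all `j`. This is positive existential in the orbit, `D`, `F` and `S`, so the negation
of `F` never enters and `Σ_α` is preserved. A complement is handled by taking the complement itself
as `S`. By automorphism invariance (`Equivariant.mem_iff_realize`) the formula for `S_b` defines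
`S_e` for every `e` in the orbit. The semantic core is `CoherentIso.mem_parameterFree_iff`.

The syntactic core is `exists_positive`. The unknown lengths of the `y_j` give a countable
disjunction. A conjunction of `Σ_α` formulas becomes `Σ_α` in the strict sense by choosing a
disjunct of each conjunct (`exists_matrix`), merging the quantifier blocks (`blockRenaming`) and
merging the matrices into one formula (`exists_conj`). All of this is carried out on labelled trees,
uniformly in an oracle. The statements without computability follow, since any countably many
formulas are computable in some oracle.

Where definability of the orbit is not assumed, it comes from Scott's back-and-forth argument in the
countable structure (`setDefinable_tupOrbit`). In the finitary case all lengths are fixed, so a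
single finite existential block suffices. -/

/-! ### Closure properties of relative computability -/

namespace ComputableIn

variable {α β γ σ : Type*} [Primcodable α] [Primcodable β] [Primcodable γ] [Primcodable σ]
  {O : Set (ℕ →. ℕ)}

theorem comp {f : β → σ} {g : α → β} (hf : ComputableIn O f) (hg : ComputableIn O g) :
    ComputableIn O fun a => f (g a) :=
  (Nat.RecursiveIn.comp hf hg).of_eq fun n => by
    rcases e : Encodable.decode (α := α) n with - | a <;> simp [Encodable.encodek]

theorem pair {f : α → β} {g : α → γ} (hf : ComputableIn O f) (hg : ComputableIn O g) :
    ComputableIn O fun a => (f a, g a) :=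
  (Nat.RecursiveIn.pair hf hg).of_eq fun n => by
    rcases e : Encodable.decode (α := α) n with - | a <;> simp [Seq.seq]

theorem of_eq {f g : α → σ} (hf : ComputableIn O f) (H : ∀ x, f x = g x) : ComputableIn O g :=
  (funext H : f = g) ▸ hf

theorem comp_primrec {f : β → σ} {g : α → β} (hf : ComputableIn O f) (hg : Primrec g) :
    ComputableIn O fun a => f (g a) :=
  hf.comp hg.computableIn

theorem comp₂ {f : β → γ → σ} {g : α → β} {h : α → γ} (hf : Primrec₂ f)
    (hg : ComputableIn O g) (hh : ComputableIn O h) : ComputableIn O fun a => f (g a) (h a) :=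
  (hf.computableIn₂ (O := O)).comp (hg.pair hh)

theorem cond {c : α → Bool} {f g : α → σ} (hc : ComputableIn O c) (hf : ComputableIn O f)
    (hg : ComputableIn O g) : ComputableIn O fun a => _root_.cond (c a) (f a) (g a) := by
  have h : Primrec fun p : Bool × σ × σ => _root_.cond p.1 p.2.1 p.2.2 :=
    Primrec.cond .fst (Primrec.fst.comp .snd) (Primrec.snd.comp .snd)
  exact h.computableIn.comp (hc.pair (hf.pair hg))

theorem ite {c : α → Prop} [DecidablePred c] {f g : α → σ} (hc : PrimrecPred c)
    (hf : ComputableIn O f) (hg : ComputableIn O g) :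
    ComputableIn O fun a => if c a then f a else g a :=
  (cond hc.decide.computableIn hf hg).of_eq fun a => by by_cases h : c a <;> simp [h]

theorem nat_rec {f : α → σ} {h : α × ℕ × σ → σ} (hf : ComputableIn O f) (hh : ComputableIn O h) :
    ComputableIn O fun p : α × ℕ => p.2.rec (motive := fun _ => σ) (f p.1)
      fun y IH => h (p.1, y, IH) :=
  (Nat.RecursiveIn.prec hf hh).of_eq fun n => by
    simp only [Encodable.decode_prod_val, Encodable.decode_nat]
    rcases e : Encodable.decode (α := α) n.unpair.1 with - | a
    · induction n.unpair.2 <;> simp_all [Part.bind_none]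
    · suffices H : ∀ k, Nat.rec (motive := fun _ => Part ℕ) (Part.some (Encodable.encode (f a)))
          (fun y IH => IH.bind fun i =>
            (↑(Option.map (Prod.mk a ∘ Prod.mk y) (Encodable.decode (α := σ) i)) :
              Part (α × ℕ × σ)).bind fun a => Part.some (Encodable.encode (h a))) k =
          Part.some (Encodable.encode (Nat.rec (motive := fun _ => σ) (f a)
            (fun y IH => h (a, y, IH)) k)) by
        simpa [e] using H _
      intro k
      induction k with
      | zero => simp
      | succ k ih => simp [ih, Encodable.encodek]

/-- The list is built by recursion on its length, because `g` may use the oracle and is then out of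
reach of the closure of `Primrec` under list maps. -/
theorem range_map {g : α × ℕ → σ} (hg : ComputableIn O g) :
    ComputableIn O fun p : α × ℕ => (List.range p.2).map fun i => g (p.1, i) := by
  refine (nat_rec (f := fun _ : α => ([] : List σ)) (h := fun p => p.2.2 ++ [g (p.1, p.2.1)])
    (ComputableIn.const _) ?_).of_eq fun p => ?_
  · exact comp₂ (f := fun (l : List σ) a => l ++ [a]) Primrec.list_concat
      (Primrec.snd.comp .snd).computableIn
      (hg.comp_primrec (Primrec.fst.pair (Primrec.fst.comp .snd)))
  · obtain ⟨a, n⟩ := p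
    induction n with
    | zero => rfl
    | succ k ih => simp only [List.range_succ, List.map_append] at ih ⊢; rw [← ih]; rfl

/-- Unbounded search for the least witness; the search is total because `k a` is a witness. -/
theorem find {p : α × ℕ → Bool} (hp : ComputableIn O p) (k : α → ℕ)
    (hk : ∀ a, p (a, k a) = true) (hmin : ∀ a, ∀ j < k a, p (a, j) = false) :
    ComputableIn O k := by
  -- Minimization looks for the value `0`, so `true` is sent to `0`.
  have hq : ComputableIn O fun x => _root_.cond (p x) 0 1 :=
    cond hp (ComputableIn.const 0) (ComputableIn.const 1)
  refine (Nat.RecursiveIn.rfind hq).of_eq fun n => ?_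
  rcases e : Encodable.decode (α := α) n with - | a
  -- At a number that codes no argument the test is undefined, so the search diverges, as it must.
  · exact (Nat.rfind_zero_none _ (by simp [e])).trans (by simp)
  · simp only [Part.coe_some, Part.bind_some, Part.map_some]
    refine Part.eq_some_iff.2 (Nat.mem_rfind.2 ⟨?_, fun {j} hj => ?_⟩)
    · simp [e, hk a]
    · simp [e, hmin a j hj]

end ComputableIn

/-! ### Oracles for arbitrary functions -/

theorem exists_indicator (X : Set ℕ) :
    ∃ χ : ℕ → Bool, XComputable X χ ∧ ∀ n, χ n = true ↔ n ∈ X := by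
  classical
  have h : XComputable X fun n => if n ∈ X then 1 else 0 :=
    RecursiveIn.iff_nat.2 (.oracle _ (by
      rfl))
  refine ⟨fun n => (if n ∈ X then 1 else 0) == 1,
    ComputableIn.comp₂ Primrec.beq h (ComputableIn.const 1), fun n => ?_⟩
  by_cases hn : n ∈ X <;> simp [hn]

/-- Every function on `ℕ` is computable in its graph. -/
theorem exists_xComputable (h : ℕ → ℕ) : ∃ X : Set ℕ, XComputable X h := by
  -- The oracle is the set of codes of pairs in the graph of `h`; a value of `h` is found by search.
  obtain ⟨χ, hχ, hX⟩ := exists_indicator {x | x.unpair.2 = h x.unpair.1}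
  refine ⟨_, ComputableIn.find (p := fun p : ℕ × ℕ => χ (Nat.pair p.1 p.2))
    (ComputableIn.comp hχ (Primrec₂.natPair.computableIn₂)) h (fun a => ?_) fun a j hj => ?_⟩
  · simp [hX]
  · rw [← Bool.not_eq_true, hX]; simp [hj.ne]

/-- A sequence of functions is computable in a common oracle. -/
theorem exists_xComputable_seq {κ : Type*} [Primcodable κ] (h : ℕ → κ → ℕ) :
    ∃ X : Set ℕ, ∀ i, XComputable X (h i) := by
  -- The whole sequence is packed into one function of the code of an index and an argument.
  obtain ⟨X, hX⟩ := exists_xComputable fun n =>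
    ((Encodable.decode (α := κ) n.unpair.2).map (h n.unpair.1)).getD 0
  refine ⟨X, fun i => ComputableIn.of_eq (ComputableIn.comp_primrec
    (g := fun a : κ => Nat.pair i (Encodable.encode a)) hX ?_) fun a => ?_⟩
  · exact Primrec₂.natPair.comp (Primrec.const i) Primrec.encode
  · simp [Encodable.encodek]

/-! ### Renaming of variables and automorphism invariance -/

namespace InfForm

variable {L : FirstOrder.Language.{u, v}}

/-- The extension of a renaming of variables to the scope of a quantifier. -/
def liftMap {n n' : ℕ} (ρ : Fin n → Fin n') : Fin (n + 1) → Fin (n' + 1) :=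
  Fin.snoc (α := fun _ => Fin (n' + 1)) (fun i => (ρ i).castSucc) (Fin.last n')

/-- The extension of a renaming of variables to the scope of a block of `k` quantifiers. -/
def liftMaps {n n' : ℕ} (ρ : Fin n → Fin n') : ∀ k : ℕ, Fin (n + k) → Fin (n' + k)
  | 0 => ρ
  | k + 1 => liftMap (liftMaps ρ k)

/-- Renaming of the free variables. -/
def rename : ∀ {n n' : ℕ}, (Fin n → Fin n') → InfForm L n → InfForm L n'
  | _, _, _, falsum => falsum
  | _, _, ρ, equal t₁ t₂ => equal (t₁.relabel ρ) (t₂.relabel ρ)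
  | _, _, ρ, rel R ts => rel R fun j => (ts j).relabel ρ
  | _, _, ρ, neg φ => neg (φ.rename ρ)
  | _, _, ρ, and φ ψ => and (φ.rename ρ) (ψ.rename ρ)
  | _, _, ρ, or φ ψ => or (φ.rename ρ) (ψ.rename ρ)
  | _, _, ρ, iDisj φ => iDisj fun i => (φ i).rename ρ
  | _, _, ρ, iConj φ => iConj fun i => (φ i).rename ρ
  | _, _, ρ, ex φ => ex (φ.rename (liftMap ρ))
  | _, _, ρ, all φ => all (φ.rename (liftMap ρ))

theorem snoc_comp_liftMap {B : Type w} {n n' : ℕ} (ρ : Fin n → Fin n') (v : Fin n' → B) (z : B) :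
    (Fin.snoc v z : Fin (n' + 1) → B) ∘ liftMap ρ = (Fin.snoc (v ∘ ρ) z : Fin (n + 1) → B) := by
  funext i
  refine Fin.lastCases ?_ (fun j => ?_) i <;> simp [liftMap]

theorem realize_rename {B : Type w} [L.Structure B] : ∀ {n n' : ℕ} (ρ : Fin n → Fin n')
    (φ : InfForm L n) (v : Fin n' → B), (φ.rename ρ).Realize v ↔ φ.Realize (v ∘ ρ)
  | _, _, _, falsum, _ => Iff.rfl
  | _, _, ρ, equal t₁ t₂, v => by simp [rename, Realize]
  | _, _, ρ, rel R ts, v => by simp [rename, Realize]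
  | _, _, ρ, neg φ, v => not_congr (realize_rename ρ φ v)
  | _, _, ρ, and φ ψ, v => and_congr (realize_rename ρ φ v) (realize_rename ρ ψ v)
  | _, _, ρ, or φ ψ, v => or_congr (realize_rename ρ φ v) (realize_rename ρ ψ v)
  | _, _, ρ, iDisj φ, v => exists_congr fun i => realize_rename ρ (φ i) v
  | _, _, ρ, iConj φ, v => forall_congr' fun i => realize_rename ρ (φ i) v
  | _, _, ρ, ex φ, v => exists_congr fun z => by
      rw [realize_rename (liftMap ρ) φ, snoc_comp_liftMap]
  | _, _, ρ, all φ, v => forall_congr' fun z => by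
      rw [realize_rename (liftMap ρ) φ, snoc_comp_liftMap]

/-- Induction on the formula. At a quantifier, witnesses are moved along the bijection `σ`. -/
theorem realize_equiv {B : Type w} [L.Structure B] (σ : B ≃[L] B) : ∀ {n : ℕ}
    (φ : InfForm L n) (v : Fin n → B), φ.Realize (σ ∘ v) ↔ φ.Realize v
  | _, falsum, _ => Iff.rfl
  | _, equal t₁ t₂, v => by simp [Realize, FirstOrder.Language.HomClass.realize_term]
  | _, rel R ts, v => by
      simp only [Realize, FirstOrder.Language.HomClass.realize_term]
      exact FirstOrder.Language.StrongHomClass.map_rel σ R _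
  | _, neg φ, v => not_congr (realize_equiv σ φ v)
  | _, and φ ψ, v => and_congr (realize_equiv σ φ v) (realize_equiv σ ψ v)
  | _, or φ ψ, v => or_congr (realize_equiv σ φ v) (realize_equiv σ ψ v)
  | _, iDisj φ, v => exists_congr fun i => realize_equiv σ (φ i) v
  | _, iConj φ, v => forall_congr' fun i => realize_equiv σ (φ i) v
  | n, ex φ, v => by
      refine (σ.toEquiv.exists_congr fun z => ?_).symm
      rw [← realize_equiv σ φ, Fin.comp_snoc]; rfl
  | n, all φ, v => by
      refine (σ.toEquiv.forall_congr fun z => ?_).symm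
      rw [← realize_equiv σ φ, Fin.comp_snoc]; rfl

theorem realize_exs {B : Type w} [L.Structure B] {n : ℕ} : ∀ (k : ℕ) (φ : InfForm L (n + k))
    (v : Fin n → B), (exs k φ).Realize v ↔ ∃ z : Fin k → B, φ.Realize (Fin.append v z)
  | 0, φ, v => by
      constructor
      · intro h; exact ⟨Fin.elim0, by simpa [exs] using h⟩
      · rintro ⟨z, h⟩
        have hz : z = Fin.elim0 := Subsingleton.elim _ _
        subst hz; simpa [exs] using h
  | k + 1, φ, v => by
      rw [exs, realize_exs k]
      constructor
      · rintro ⟨z, y, h⟩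
        exact ⟨Fin.snoc z y, by rwa [Fin.append_snoc]⟩
      · rintro ⟨z, h⟩
        refine ⟨Fin.init z, z (Fin.last k), ?_⟩
        rwa [← Fin.append_snoc, Fin.snoc_init_self]

theorem rename_exs {n n' : ℕ} (ρ : Fin n → Fin n') : ∀ (k : ℕ) (φ : InfForm L (n + k)),
    (exs k φ).rename ρ = exs k (φ.rename (liftMaps ρ k))
  | 0, _ => rfl
  | k + 1, φ => by rw [exs, rename_exs ρ k]; rfl

theorem rename_alls {n n' : ℕ} (ρ : Fin n → Fin n') : ∀ (k : ℕ) (φ : InfForm L (n + k)),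
    (alls k φ).rename ρ = alls k (φ.rename (liftMaps ρ k))
  | 0, _ => rfl
  | k + 1, φ => by rw [alls, rename_alls ρ k]; rfl

theorem IsFinQF.rename : ∀ {n n' : ℕ} (ρ : Fin n → Fin n') {φ : InfForm L n}, φ.IsFinQF →
    (φ.rename ρ).IsFinQF
  | _, _, _, falsum, _ => trivial
  | _, _, _, equal _ _, _ => trivial
  | _, _, _, rel _ _, _ => trivial
  | _, _, ρ, neg φ, h => IsFinQF.rename ρ (φ := φ) h
  | _, _, ρ, and _ _, h => ⟨h.1.rename ρ, h.2.rename ρ⟩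
  | _, _, ρ, or _ _, h => ⟨h.1.rename ρ, h.2.rename ρ⟩

theorem IsFinitary.rename : ∀ {n n' : ℕ} (ρ : Fin n → Fin n') {φ : InfForm L n}, φ.IsFinitary →
    (φ.rename ρ).IsFinitary
  | _, _, _, falsum, _ => trivial
  | _, _, _, equal _ _, _ => trivial
  | _, _, _, rel _ _, _ => trivial
  | _, _, ρ, neg φ, h => IsFinitary.rename ρ (φ := φ) h
  | _, _, ρ, and _ _, h => ⟨h.1.rename ρ, h.2.rename ρ⟩
  | _, _, ρ, or _ _, h => ⟨h.1.rename ρ, h.2.rename ρ⟩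
  | _, _, ρ, ex φ, h => IsFinitary.rename (liftMap ρ) (φ := φ) h
  | _, _, ρ, all φ, h => IsFinitary.rename (liftMap ρ) (φ := φ) h

theorem IsFinitary.exs {n : ℕ} : ∀ (k : ℕ) {φ : InfForm L (n + k)}, φ.IsFinitary →
    (InfForm.exs k φ).IsFinitary
  | 0, _, h => h
  | k + 1, φ, h => IsFinitary.exs k (φ := ex φ) h

/-- Renaming passes through quantifier blocks without changing their lengths, so the same ordinals
and the same block lengths serve again. -/
theorem InHierarchy.rename {s : Side} {α : Ordinal.{0}} {n : ℕ} {φ : InfForm L n}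
    (h : InHierarchy s α φ) : ∀ {n' : ℕ} (ρ : Fin n → Fin n'), InHierarchy s α (φ.rename ρ) := by
  induction h with
  | qf s φ h => exact fun ρ => .qf s _ (h.rename ρ)
  | sigma α β k ψ hβ _ ih =>
    intro n' ρ
    have := InHierarchy.sigma α β k (fun i => (ψ i).rename (liftMaps ρ (k i))) hβ
      fun i => ih i _
    simpa only [InfForm.rename, rename_exs] using this
  | pi α β k ψ hβ _ ih =>
    intro n' ρ
    have := InHierarchy.pi α β k (fun i => (ψ i).rename (liftMaps ρ (k i))) hβ
      fun i => ih i _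
    simpa only [InfForm.rename, rename_alls] using this

/-! ### Labels -/

/-- The label at `p` of `k` existential quantifiers in front of a formula with labels `f`. -/
def exsLabel : ℕ → (List ℕ → ℕ) → List ℕ → ℕ
  | 0, f, p => f p
  | _ + 1, _, [] => Nat.pair 8 0
  | k + 1, f, 0 :: p => exsLabel k f p
  | _ + 1, _, (_ + 1) :: _ => Nat.pair 10 0

theorem exsLabel_exsLabel_one (f : List ℕ → ℕ) : ∀ (k : ℕ) (p : List ℕ),
    exsLabel k (exsLabel 1 f) p = exsLabel (k + 1) f p
  | 0, _ => rfl
  | _ + 1, [] => rfl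
  | k + 1, 0 :: p => exsLabel_exsLabel_one f k p
  | _ + 1, (_ + 1) :: _ => rfl

/-- A form without recursion on the position, from which computability can be read off when `k` and
`f` vary. -/
theorem exsLabel_eq_ite (f : List ℕ → ℕ) : ∀ (k : ℕ) (p : List ℕ),
    exsLabel k f p = if p.take k = List.replicate k 0 then f (p.drop k)
      else if p = List.replicate p.length 0 then Nat.pair 8 0 else Nat.pair 10 0
  | 0, _ => by simp [exsLabel]
  | _ + 1, [] => by simp [exsLabel, List.replicate_succ]
  | k + 1, 0 :: p => by simp [exsLabel, List.replicate_succ, exsLabel_eq_ite f k p]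
  | _ + 1, (_ + 1) :: _ => by simp [exsLabel, List.replicate_succ]

theorem exsLabel_replicate_append (f : List ℕ → ℕ) (p : List ℕ) : ∀ k : ℕ,
    exsLabel k f (List.replicate k 0 ++ p) = f p
  | 0 => rfl
  | k + 1 => exsLabel_replicate_append f p k

theorem exsLabel_replicate_of_lt (f : List ℕ → ℕ) : ∀ {k j : ℕ}, j < k →
    exsLabel k f (List.replicate j 0) = Nat.pair 8 0
  | _ + 1, 0, _ => rfl
  | k + 1, j + 1, h => exsLabel_replicate_of_lt f (k := k) (j := j) (by omega)

/-! ### Renaming on Gödel numbers -/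

section Code

open Encodable

/-- The code of the term that is obtained from the term with code `e` by the renaming `σ`. -/
def renameTermCode (σ : ℕ → ℕ) (e : ℕ) : ℕ :=
  -- A term is coded as a list over a sum type: variables get the even codes `2 * i`, function
  -- symbols the odd ones.
  encode ((Denumerable.ofNat (List ℕ) e).map fun c => if c % 2 = 0 then 2 * σ (c / 2) else c)

/-- The label that is obtained from the label `a` by the renaming `σ`. -/
def renameLabel (σ : ℕ → ℕ) (a : ℕ) : ℕ :=
  if a.unpair.1 = 1 then
    Nat.pair 1 (Nat.pair (renameTermCode σ a.unpair.2.unpair.1)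
      (renameTermCode σ a.unpair.2.unpair.2))
  else if a.unpair.1 = 2 then
    Nat.pair 2 (Nat.pair a.unpair.2.unpair.1
      (encode ((Denumerable.ofNat (List ℕ) a.unpair.2.unpair.2).map (renameTermCode σ))))
  else a

/-- The renaming that sends `i` to the `i`-th entry of `ρ`, and the variables after those in `ρ`
to the variables from `x_{n'}` on. -/
def listRenaming (ρ : List ℕ) (n' : ℕ) (x : ℕ) : ℕ := ρ.getD x (x - ρ.length + n')

theorem listRenaming_primrec :
    Primrec fun q : (List ℕ × ℕ) × ℕ => listRenaming q.1.1 q.1.2 q.2 := by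
  have h : Primrec fun q : (List ℕ × ℕ) × ℕ =>
      (q.1.1[q.2]?).getD (q.2 - q.1.1.length + q.1.2) := by
    refine Primrec.option_getD.comp (Primrec.list_getElem?.comp (Primrec.fst.comp .fst) .snd)
      (Primrec.nat_add.comp (Primrec.nat_sub.comp .snd
        (Primrec.list_length.comp (Primrec.fst.comp .fst))) (Primrec.snd.comp .fst))
  exact h.of_eq fun q => by simp [listRenaming]

theorem renameTermCode_primrec :
    Primrec fun q : (List ℕ × ℕ) × ℕ => renameTermCode (listRenaming q.1.1 q.1.2) q.2 := by
  refine Primrec.encode.comp (Primrec.list_map ((Primrec.ofNat (List ℕ)).comp .snd) ?_)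
  refine Primrec.ite (Primrec.eq.comp (Primrec.nat_mod.comp .snd (.const 2)) (.const 0))
    (Primrec.nat_mul.comp (.const 2) ?_) .snd
  exact listRenaming_primrec.comp ((Primrec.fst.comp .fst).pair
    (Primrec.nat_div.comp .snd (.const 2)))

theorem renameLabel_primrec :
    Primrec fun q : (List ℕ × ℕ) × ℕ => renameLabel (listRenaming q.1.1 q.1.2) q.2 := by
  have h1 : Primrec fun q : (List ℕ × ℕ) × ℕ => q.2.unpair.1 :=
    Primrec.fst.comp (Primrec.unpair.comp .snd)
  have h2 : Primrec fun q : (List ℕ × ℕ) × ℕ => q.2.unpair.2 :=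
    Primrec.snd.comp (Primrec.unpair.comp .snd)
  have h21 : Primrec fun q : (List ℕ × ℕ) × ℕ => q.2.unpair.2.unpair.1 :=
    Primrec.fst.comp (Primrec.unpair.comp h2)
  have h22 : Primrec fun q : (List ℕ × ℕ) × ℕ => q.2.unpair.2.unpair.2 :=
    Primrec.snd.comp (Primrec.unpair.comp h2)
  refine Primrec.ite (Primrec.eq.comp h1 (.const 1)) ?_
    (Primrec.ite (Primrec.eq.comp h1 (.const 2)) ?_ .snd)
  · exact Primrec₂.natPair.comp (.const 1) (Primrec₂.natPair.comp
      (renameTermCode_primrec.comp (Primrec.fst.pair h21))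
      (renameTermCode_primrec.comp (Primrec.fst.pair h22)))
  · refine Primrec₂.natPair.comp (.const 2) (Primrec₂.natPair.comp h21 (Primrec.encode.comp
      (Primrec.list_map ((Primrec.ofNat (List ℕ)).comp h22) ?_)))
    exact renameTermCode_primrec.comp ((Primrec.fst.comp .fst).pair .snd)

/-- A list over any encodable type has the same code as the list of the codes of its entries. Hence
lists of symbols can be manipulated as lists of numbers, with no computability structure on the
language. -/
theorem ofNat_encode_list {α : Type*} [Encodable α] (l : List α) :
    Denumerable.ofNat (List ℕ) (encode l) = l.map encode := by
  have h : encode l = encode (l.map encode) := by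
    induction l with
    | nil => rfl
    | cons a l ih => simp [ih]
  rw [h, Denumerable.ofNat_encode]

theorem encode_list_map_encode {α : Type*} [Encodable α] (l : List α) :
    encode (l.map encode) = encode l := by
  induction l with
  | nil => rfl
  | cons a l ih => simp [ih]

theorem listEncode_relabel {α β : Type*} (f : α → β) (t : L.Term α) :
    (t.relabel f).listEncode = t.listEncode.map (Sum.map f id) := by
  induction t with
  | var => rfl
  | func g ts ih => simp [FirstOrder.Language.Term.listEncode, List.map_flatMap, ih]

variable [Encodable (Σ k, L.Functions k)]

theorem encode_relabel {n n' : ℕ} (ρ : Fin n → Fin n') (σ : ℕ → ℕ) (h : ∀ i : Fin n, σ i = ρ i)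
    (t : L.Term (Fin n)) : encode (t.relabel ρ) = renameTermCode σ (encode t) := by
  have key : ∀ {k : ℕ} (t : L.Term (Fin k)), encode t = encode t.listEncode := fun _ => rfl
  rw [key, key, renameTermCode, ofNat_encode_list, listEncode_relabel, List.map_map,
    ← encode_list_map_encode, List.map_map]
  congr 1
  refine List.map_congr_left fun a _ => ?_
  rcases a with a | a
  · simp only [Function.comp_apply, Sum.map_inl, Encodable.encode_inl]
    have he : ∀ {k : ℕ} (a : Fin k), encode a = (a : ℕ) := fun _ => rfl
    simp [he, h]
  · simp

variable [Encodable (Σ k, L.Relations k)]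

theorem label_exs {n : ℕ} : ∀ (k : ℕ) (φ : InfForm L (n + k)) (p : List ℕ),
    (exs k φ).label p = exsLabel k φ.label p
  | 0, φ, p => rfl
  | k + 1, φ, p => by
    rw [exs, label_exs k, ← exsLabel_exsLabel_one]
    congr 1
    funext p
    rcases p with _ | ⟨_ | i, p⟩ <;> rfl

/-- The invariant that lets one number function `σ` act correctly under all quantifiers: a bound
variable is named by its depth, and `σ` shifts the depths beyond `n` to those beyond `n'`. -/
theorem liftMap_val {n n' : ℕ} (ρ : Fin n → Fin n') (σ : ℕ → ℕ) (h : ∀ i : Fin n, σ i = ρ i)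
    (h' : ∀ d, σ (n + d) = n' + d) :
    (∀ i : Fin (n + 1), σ i = liftMap ρ i) ∧ ∀ d, σ (n + 1 + d) = n' + 1 + d := by
  refine ⟨fun i => ?_, fun d => by rw [add_assoc, h', add_assoc]⟩
  refine Fin.lastCases ?_ (fun j => ?_) i
  · simpa [liftMap] using h' 0
  · simp [liftMap, h]

/-- Renaming acts on the tree label by label, with the same `σ` at every position, because bound
variables only have their depths shifted. -/
theorem label_rename : ∀ {n n' : ℕ} (ρ : Fin n → Fin n') (σ : ℕ → ℕ)
    (_ : ∀ i : Fin n, σ i = ρ i) (_ : ∀ d, σ (n + d) = n' + d) (φ : InfForm L n) (p : List ℕ),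
    (φ.rename ρ).label p = renameLabel σ (φ.label p)
  | _, _, ρ, σ, h, h', φ, p => by
    have h0 : ∀ a, a ≠ 1 → a ≠ 2 → ∀ c, renameLabel σ (Nat.pair a c) = Nat.pair a c := by
      intro a h1 h2 c; simp [renameLabel, h1, h2]
    have h10 := h0 10 (by decide) (by decide) 0
    cases φ with
    | falsum =>
      rcases p with _ | ⟨i, p⟩
      · exact (h0 0 (by decide) (by decide) 0).symm
      · exact h10.symm
    | equal t₁ t₂ =>
      rcases p with _ | ⟨i, p⟩
      · simp [rename, label, renameLabel, encode_relabel ρ σ h]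
      · exact h10.symm
    | rel R ts =>
      rcases p with _ | ⟨i, p⟩
      · simp only [rename, label, renameLabel, encode_relabel ρ σ h, Nat.unpair_pair,
          OfNat.ofNat_ne_one, if_false, if_true, Denumerable.ofNat_encode, List.map_ofFn]
        rfl
      · exact h10.symm
    | neg φ =>
      rcases p with _ | ⟨_ | i, p⟩
      · exact (h0 3 (by decide) (by decide) 0).symm
      · exact label_rename ρ σ h h' φ p
      · exact h10.symm
    | and φ ψ =>
      rcases p with _ | ⟨_ | _ | i, p⟩
      · exact (h0 4 (by decide) (by decide) 0).symm
      · exact label_rename ρ σ h h' φ p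
      · exact label_rename ρ σ h h' ψ p
      · exact h10.symm
    | or φ ψ =>
      rcases p with _ | ⟨_ | _ | i, p⟩
      · exact (h0 5 (by decide) (by decide) 0).symm
      · exact label_rename ρ σ h h' φ p
      · exact label_rename ρ σ h h' ψ p
      · exact h10.symm
    | iDisj φ =>
      rcases p with _ | ⟨i, p⟩
      · exact (h0 6 (by decide) (by decide) 0).symm
      · exact label_rename ρ σ h h' (φ i) p
    | iConj φ =>
      rcases p with _ | ⟨i, p⟩
      · exact (h0 7 (by decide) (by decide) 0).symm
      · exact label_rename ρ σ h h' (φ i) p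
    | ex φ =>
      rcases p with _ | ⟨_ | i, p⟩
      · exact (h0 8 (by decide) (by decide) 0).symm
      · exact label_rename (liftMap ρ) σ (liftMap_val ρ σ h h').1 (liftMap_val ρ σ h h').2 φ p
      · exact h10.symm
    | all φ =>
      rcases p with _ | ⟨_ | i, p⟩
      · exact (h0 9 (by decide) (by decide) 0).symm
      · exact label_rename (liftMap ρ) σ (liftMap_val ρ σ h h').1 (liftMap_val ρ σ h h').2 φ p
      · exact h10.symm

theorem label_rename_ofFn {n n' : ℕ} (ρ : Fin n → Fin n') (φ : InfForm L n) (p : List ℕ) :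
    (φ.rename ρ).label p =
      renameLabel (listRenaming (List.ofFn fun i => (ρ i : ℕ)) n') (φ.label p) :=
  label_rename ρ _ (fun i => by simp [listRenaming]) (fun d => by simp [listRenaming, add_comm])
    φ p

end Code

end InfForm

/-! ### Finite conjunctions and the classes `Σ_α` -/

section Classes

variable {L : FirstOrder.Language.{u, v}}

namespace InfForm

/-- The true formula. -/
def top {n : ℕ} : InfForm L n := neg falsum

/-- The labels of `falsum`. -/
def falsumLabel (p : List ℕ) : ℕ := if p = [] then Nat.pair 0 0 else Nat.pair 10 0

/-- The labels of `top`. -/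
def topLabel (p : List ℕ) : ℕ :=
  if p = [] then Nat.pair 3 0 else if p = [0] then Nat.pair 0 0 else Nat.pair 10 0

theorem falsumLabel_primrec : Primrec falsumLabel :=
  Primrec.ite (Primrec.eq.comp .id (.const [])) (.const _) (.const _)

theorem topLabel_primrec : Primrec topLabel :=
  Primrec.ite (Primrec.eq.comp .id (.const [])) (.const _)
    (Primrec.ite (Primrec.eq.comp .id (.const [0])) (.const _) (.const _))

/-- The conjunction of finitely many formulas. -/
def finAnd {n : ℕ} : ∀ {N : ℕ}, (Fin N → InfForm L n) → InfForm L n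
  | 0, _ => top
  | _ + 1, θ => and (θ 0) (finAnd fun a => θ a.succ)

theorem realize_finAnd {B : Type w} [L.Structure B] {n : ℕ} (v : Fin n → B) : ∀ {N : ℕ}
    (θ : Fin N → InfForm L n), (finAnd θ).Realize v ↔ ∀ a, (θ a).Realize v
  | 0, _ => by simp [finAnd, top, Realize]
  | _ + 1, θ => by simp [finAnd, Realize, realize_finAnd v, Fin.forall_fin_succ]

theorem isFinQF_finAnd {n : ℕ} : ∀ {N : ℕ} (θ : Fin N → InfForm L n), (∀ a, (θ a).IsFinQF) →
    (finAnd θ).IsFinQF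
  | 0, _, _ => trivial
  | _ + 1, _, h => ⟨h 0, isFinQF_finAnd _ fun a => h a.succ⟩

theorem isFinitary_finAnd {n : ℕ} : ∀ {N : ℕ} (θ : Fin N → InfForm L n),
    (∀ a, (θ a).IsFinitary) → (finAnd θ).IsFinitary
  | 0, _, _ => trivial
  | _ + 1, _, h => ⟨h 0, isFinitary_finAnd _ fun a => h a.succ⟩

/-- The labels of `finAnd`, in terms of those of the conjuncts. -/
def finAndLabel (N : ℕ) (f : ℕ → List ℕ → ℕ) (p : List ℕ) : ℕ :=
  -- The position `1^a 0 p` with `a < N` is position `p` in conjunct `a`; after `N` ones comes the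
  -- closing `top`.
  if N ≤ (p.takeWhile (· == 1)).length then topLabel (p.drop N)
  else if p.dropWhile (· == 1) = [] then Nat.pair 4 0
  else if (p.dropWhile (· == 1)).headI = 0 then
    f (p.takeWhile (· == 1)).length (p.dropWhile (· == 1)).tail
  else Nat.pair 10 0

/-- The `j`-th component of a formula that is viewed as a countable conjunction. -/
def component : ∀ {n : ℕ}, InfForm L n → ℕ → InfForm L n
  | _, iConj φ, j => φ j
  | _, φ, _ => φ

theorem realize_component {B : Type w} [L.Structure B] {n : ℕ} (φ : InfForm L n) (v : Fin n → B) :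
    φ.Realize v ↔ ∀ j, (φ.component j).Realize v := by
  cases φ <;> simp [component, Realize]

/-- A quantifier-free formula is its own component, with an empty block and level `0`, which is why
`γ` has to be positive; a proper conjunction yields its members. -/
theorem InHierarchy.component {n : ℕ} {β γ : Ordinal.{0}} {φ : InfForm L n}
    (h : InHierarchy Side.pi β φ) (hβ : β ≤ γ) (hγ : 0 < γ) (j : ℕ) :
    ∃ δ < γ, ∃ (k : ℕ) (ψ : InfForm L (n + k)), φ.component j = alls k ψ ∧
      InHierarchy Side.sigma δ ψ := by
  cases h with
  | qf _ _ h =>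
    refine ⟨0, hγ, 0, φ, ?_, .qf _ _ h⟩
    cases φ <;> first | rfl | exact h.elim
  | pi _ β' k ψ hβ' h => exact ⟨β' j, (hβ' j).trans_le hβ, k j, ψ j, rfl, h j⟩

/-- Below `1` there is only level `0`, and a conjunction at level `0` would need members of level
below `0`. -/
theorem InHierarchy.isFinQF {n : ℕ} {β : Ordinal.{0}} {φ : InfForm L n}
    (h : InHierarchy Side.pi β φ) (hβ : β < 1) : φ.IsFinQF := by
  cases h with
  | qf _ _ h => exact h
  | pi _ β' _ _ hβ' => exact absurd (hβ' 0) (by simp [Order.lt_one_iff.1 hβ])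

theorem InHierarchy.exists_eq_iDisj {n : ℕ} {α : Ordinal.{0}} (hα : 1 ≤ α) {φ : InfForm L n}
    (h : InHierarchy Side.sigma α φ) : ∃ (k : ℕ → ℕ) (ψ : ∀ i, InfForm L (n + k i)),
      φ = iDisj (fun i => exs (k i) (ψ i)) ∧ ∀ i, ∃ β < α, InHierarchy Side.pi β (ψ i) := by
  cases h with
  | qf => exact absurd hα (by simp)
  | sigma _ β k ψ hβ h => exact ⟨k, ψ, rfl, fun i => ⟨β i, hβ i, h i⟩⟩

variable [Encodable (Σ k, L.Functions k)] [Encodable (Σ k, L.Relations k)]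

theorem label_falsum {n : ℕ} (p : List ℕ) : (falsum : InfForm L n).label p = falsumLabel p := by
  rcases p with _ | ⟨_, _⟩ <;> rfl

theorem label_top {n : ℕ} (p : List ℕ) : (top : InfForm L n).label p = topLabel p := by
  rcases p with _ | ⟨_ | _, _ | ⟨_, _⟩⟩ <;> rfl

theorem label_finAnd {n : ℕ} : ∀ {N : ℕ} (θ : Fin N → InfForm L n) (f : ℕ → List ℕ → ℕ)
    (_ : ∀ a p, f a.1 p = (θ a).label p) (p : List ℕ), (finAnd θ).label p = finAndLabel N f p
  | 0, _, _, _, p => by simp [finAnd, finAndLabel, label_top]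
  | N + 1, θ, f, h, p => by
    rcases p with _ | ⟨_ | _ | i, p⟩
    · rfl
    · simpa [finAndLabel, finAnd, label] using (h 0 p).symm
    · have := label_finAnd (fun a => θ a.succ) (fun a => f (a + 1)) (fun a p => h a.succ p) p
      simpa [finAndLabel, finAnd, label] using this
    · simp [finAndLabel, finAnd, label]

/-- Whether the formula is a countable conjunction is visible from its root label, so components can
be computed from the tree. -/
theorem label_component {n : ℕ} (φ : InfForm L n) (j : ℕ) (p : List ℕ) :
    (φ.component j).label p =
      if φ.label [] = Nat.pair 7 0 then φ.label (j :: p) else φ.label p := by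
  cases φ <;> simp [component, label, Nat.pair_eq_pair]

/-- A `Π_β` formula never begins with `∃`, so the end of an existential block in front of it can be
recognized from the labels. -/
theorem InHierarchy.label_ne {n : ℕ} {β : Ordinal.{0}} {φ : InfForm L n}
    (h : InHierarchy Side.pi β φ) : φ.label [] ≠ Nat.pair 8 0 := by
  cases h with
  | qf _ _ h => cases φ <;> first | exact h.elim | simp [label, Nat.pair_eq_pair]
  | pi => simp [label, Nat.pair_eq_pair]

end InfForm

open InfForm

/-- All formulas, or the `Σ_α` formulas. -/
def sigmaClass (L : FirstOrder.Language.{u, v}) : Option Ordinal.{0} → FormClass L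
  | none => allForms L
  | some α => sigmaForms L α

/-- The matrices of the formulas in `sigmaClass`. -/
def matrixClass (L : FirstOrder.Language.{u, v}) : Option Ordinal.{0} → FormClass L
  | none => allForms L
  | some α => fun _ φ => ∃ β < α, φ.InHierarchy Side.pi β

variable {o : Option Ordinal.{0}}

theorem matrixClass_falsum (ho : ∀ α ∈ o, 1 ≤ α) {n : ℕ} : matrixClass L o n falsum := by
  cases o with
  | none => trivial
  | some α => exact ⟨0, zero_lt_one.trans_le (ho α rfl), .qf _ _ trivial⟩

theorem matrixClass.rename {n n' : ℕ} {φ : InfForm L n} (h : matrixClass L o n φ)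
    (ρ : Fin n → Fin n') : matrixClass L o n' (φ.rename ρ) := by
  cases o with
  | none => trivial
  | some α => obtain ⟨β, hβ, h⟩ := h; exact ⟨β, hβ, h.rename ρ⟩

theorem sigmaClass_iDisj {n : ℕ} {k : ℕ → ℕ} {ψ : ∀ j, InfForm L (n + k j)}
    (h : ∀ j, matrixClass L o _ (ψ j)) :
    sigmaClass L o n (iDisj fun j => exs (k j) (ψ j)) := by
  cases o with
  | none => trivial
  | some α => choose β hβ h using h; exact .sigma α β k ψ hβ h

end Classes

open InfForm

/-! ### Uniformly computable families of formulas -/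

section Families

variable {L : FirstOrder.Language.{u, v}} {ι κ : Type*} [Primcodable κ]
  [Encodable (Σ k, L.Functions k)] [Encodable (Σ k, L.Relations k)] {X : Set ℕ} {n : ι → ℕ}
  {o : Option Ordinal.{0}} {code : ι → κ}

/-- The labelled trees of the formulas `φ i` are computable in `X`, uniformly in `code i`. -/
def LabelComputable (X : Set ℕ) (code : ι → κ) (φ : ∀ i, InfForm L (n i)) : Prop :=
  ∃ g : κ × List ℕ → ℕ, XComputable X g ∧ ∀ i p, g (code i, p) = (φ i).label p

theorem replicate_primrec : Primrec fun k : ℕ => List.replicate k 0 :=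
  (Primrec.list_map Primrec.list_range ((Primrec.const 0).to₂)).of_eq fun k => by simp

theorem exsLabel_computable {α : Type*} [Primcodable α] {O : Set (ℕ →. ℕ)} {k : α → ℕ}
    {p : α → List ℕ} {g : α × List ℕ → ℕ} (hk : ComputableIn O k) (hp : ComputableIn O p)
    (hg : ComputableIn O g) : ComputableIn O fun a => exsLabel (k a) (fun q => g (a, q)) (p a) := by
  have h1 : ComputableIn O fun a => decide ((p a).take (k a) = List.replicate (k a) 0) :=
    .comp₂ Primrec.eq.decide (.comp₂ Primrec.list_take hk hp) (replicate_primrec.computableIn.comp hk)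
  have h2 : ComputableIn O fun a => decide (p a = List.replicate (p a).length 0) :=
    .comp₂ Primrec.eq.decide hp
      ((replicate_primrec.comp Primrec.list_length).computableIn.comp hp)
  refine (h1.cond (hg.comp (ComputableIn.id.pair (.comp₂ Primrec.list_drop hk hp)))
    (h2.cond (.const (Nat.pair 8 0)) (.const (Nat.pair 10 0)))).of_eq fun a => ?_
  rw [exsLabel_eq_ite]
  simp only [Bool.cond_eq_ite, decide_eq_true_eq, id_eq]

/-- Uniform assembly of a countable disjunction of existential formulas. -/
theorem labelComputable_iDisj {k : ι → ℕ → ℕ} (hk : ∃ gk : κ × ℕ → ℕ, XComputable X gk ∧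
      ∀ i j, gk (code i, j) = k i j)
    {ψ : ∀ i j, InfForm L (n i + k i j)}
    (hψ : LabelComputable X (fun q : ι × ℕ => (code q.1, q.2)) fun q => ψ q.1 q.2) :
    LabelComputable X code fun i => iDisj fun j => exs (k i j) (ψ i j) := by
  obtain ⟨gk, hgk, ek⟩ := hk
  obtain ⟨g, hg, e⟩ := hψ
  have hj : Primrec fun a : κ × List ℕ => (a.1, a.2.headI) :=
    Primrec.fst.pair (Primrec.list_headI.comp .snd)
  refine ⟨_, ComputableIn.ite (c := fun a : κ × List ℕ => a.2 = [])
    (Primrec.eq.comp .snd (.const [])) (.const (Nat.pair 6 0))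
    (exsLabel_computable (g := fun b : (κ × List ℕ) × List ℕ => g ((b.1.1, b.1.2.headI), b.2))
      (hgk.comp_primrec hj)
      (Primrec.list_tail.comp Primrec.snd).computableIn
      (hg.comp_primrec ((hj.comp .fst).pair .snd))), fun i p => ?_⟩
  rcases p with _ | ⟨j, p⟩
  · rfl
  · simp only [label, label_exs, reduceCtorEq, if_false, List.headI_cons, List.tail_cons, ek]
    congr 1
    funext q
    exact e (i, j) q

end Families

/-! ### Normal forms and conjunctions of uniformly computable families -/

section Families

variable {L : FirstOrder.Language.{u, v}} {ι κ : Type*} [Primcodable κ]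
  [Encodable (Σ k, L.Functions k)] [Encodable (Σ k, L.Relations k)] {X : Set ℕ} {n : ι → ℕ}
  {o : Option Ordinal.{0}} {code : ι → κ}

/-- The test whether exactly `k` existential quantifiers follow the position `[j]`. -/
def exCountIs (f : List ℕ → ℕ) (j k : ℕ) : Bool :=
  !decide (f (j :: List.replicate k 0) = Nat.pair 8 0) &&
    decide ((List.range k).map (fun i => f (j :: List.replicate i 0)) =
      (List.range k).map fun _ => Nat.pair 8 0)

/-- Since no matrix starts with `∃`, the first position without the label of `∃` marks the end of
the block, and this determines its length. -/
theorem exCountIs_iff {m : ℕ} {k : ℕ → ℕ} {ψ : ∀ i, InfForm L (m + k i)}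
    (h : ∀ i, (ψ i).label [] ≠ Nat.pair 8 0) (j K : ℕ) :
    exCountIs (iDisj fun i => exs (k i) (ψ i)).label j K = true ↔ k j = K := by
  have e : ∀ i, (iDisj fun i => exs (k i) (ψ i)).label (j :: List.replicate i 0) =
      exsLabel (k j) (ψ j).label (List.replicate i 0) := fun i => label_exs _ _ _
  have e' : exsLabel (k j) (ψ j).label (List.replicate (k j) 0) = (ψ j).label [] := by
    simpa using exsLabel_replicate_append (ψ j).label [] (k j)
  simp only [exCountIs, e, Bool.and_eq_true, Bool.not_eq_true', decide_eq_false_iff_not,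
    decide_eq_true_eq, List.map_inj_left, List.mem_range]
  constructor
  · rintro ⟨h1, h2⟩
    rcases lt_trichotomy (k j) K with hlt | heq | hgt
    · exact absurd (e'.symm.trans (h2 _ hlt)) (h j)
    · exact heq
    · exact absurd (exsLabel_replicate_of_lt _ hgt) h1
  · rintro rfl
    exact ⟨e' ▸ h j, fun i hi => exsLabel_replicate_of_lt _ hi⟩

theorem exCountIs_computable {α : Type*} [Primcodable α] {O : Set (ℕ →. ℕ)} {j k : α → ℕ}
    {g : α × List ℕ → ℕ} (hj : ComputableIn O j) (hk : ComputableIn O k)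
    (hg : ComputableIn O g) :
    ComputableIn O fun a => exCountIs (fun q => g (a, q)) (j a) (k a) := by
  have hq : ComputableIn O fun b : α × ℕ => g (b.1, j b.1 :: List.replicate b.2 0) :=
    hg.comp (ComputableIn.fst.pair (.comp₂ Primrec.list_cons (hj.comp .fst)
      (replicate_primrec.computableIn.comp .snd)))
  have h1 : ComputableIn O fun a => decide (g (a, j a :: List.replicate (k a) 0) = Nat.pair 8 0) :=
    .comp₂ Primrec.eq.decide (hq.comp (ComputableIn.id.pair hk)) (.const _)
  have h2 : ComputableIn O fun a =>
      decide ((List.range (k a)).map (fun i => g (a, j a :: List.replicate i 0)) =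
        (List.range (k a)).map fun _ => Nat.pair 8 0) :=
    .comp₂ Primrec.eq.decide ((ComputableIn.range_map hq).comp (ComputableIn.id.pair hk))
      ((Primrec.list_map Primrec.list_range (Primrec.const (Nat.pair 8 0)).to₂).computableIn.comp
        hk)
  exact .comp₂ Primrec.and ((Primrec.not.computableIn).comp h1) h2

/-- Uniform normal form: each formula of a family is equivalent to a countable disjunction of
existential formulas whose numbers of quantifiers do not depend on the formula. -/
theorem exists_matrix (ho : ∀ α ∈ o, 1 ≤ α) {φ : ∀ i, InfForm L (n i)}
    (hΓ : ∀ i, sigmaClass L o _ (φ i)) (hφ : LabelComputable X code φ) :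
    ∃ (k : ℕ → ℕ) (ψ : ∀ i j, InfForm L (n i + k j)), Primrec k ∧
      (∀ i j, matrixClass L o _ (ψ i j)) ∧
      (∀ (B : Type w) [L.Structure B] (i : ι) (a : Fin (n i) → B),
        (φ i).Realize a ↔ ∃ j z, (ψ i j).Realize (Fin.append a z)) ∧
      LabelComputable X (fun q : ι × ℕ => (code q.1, q.2)) fun q => ψ q.1 q.2 := by
  obtain ⟨g, hg, e⟩ := hφ
  cases o with
  | none =>
    -- For the class of all formulas no normal form is needed: the formula is its own matrix, with
    -- an empty block.
    refine ⟨fun _ => 0, fun i _ => φ i, Primrec.const 0, fun _ _ => trivial, fun B _ i a => ?_,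
      fun q => g (q.1.1, q.2), hg.comp_primrec ((Primrec.fst.comp .fst).pair .snd),
      fun q p => e q.1 p⟩
    have h : ∀ z : Fin 0 → B, Fin.append a z = a := fun z => by
      rw [Subsingleton.elim z Fin.elim0]; simp
    simp [h]
  | some α =>
    choose k' ψ' hφ' hψ' using fun i => (hΓ i).exists_eq_iDisj (ho α rfl)
    have hne : ∀ i j, (ψ' i j).label [] ≠ Nat.pair 8 0 := fun i j => by
      obtain ⟨β, _, h⟩ := hψ' i j; exact h.label_ne
    have hcount : ∀ i j K, exCountIs (φ i).label j K = true ↔ k' i j = K := fun i j K => by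
      rw [hφ' i, exCountIs_iff (hne i)]
    -- The index `j` codes a disjunct together with a guess of its number of quantifiers; a wrong
    -- guess gives `falsum`. Thus the block length depends on `j` only, and the correctness of the
    -- guess can be decided from the labels.
    let ψ : ∀ i j, InfForm L (n i + (Nat.unpair j).2) := fun i j =>
      if h : k' i j.unpair.1 = j.unpair.2 then h ▸ ψ' i j.unpair.1 else falsum
    have hreal : ∀ i j K (h : k' i j = K) (p : List ℕ), InfForm.label (h ▸ ψ' i j :
        InfForm L (n i + K)) p = (φ i).label (j :: (List.replicate K 0 ++ p)) := by
      rintro i j _ rfl p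
      rw [hφ' i]
      simp only [label, label_exs, exsLabel_replicate_append]
    refine ⟨fun j => j.unpair.2, ψ, Primrec.snd.comp Primrec.unpair, fun i j => ?_,
      fun B _ i a => ?_, ?_⟩
    · by_cases h : k' i j.unpair.1 = j.unpair.2
      · have H : ∀ K (h : k' i j.unpair.1 = K),
            matrixClass L (some α) (n i + K) (h ▸ ψ' i j.unpair.1) := by
          rintro _ rfl; exact hψ' _ _
        simp only [ψ, dif_pos h]; exact H _ h
      · simp only [ψ, dif_neg h]; exact matrixClass_falsum ho
    · have H : (φ i).Realize a ↔ ∃ j z, (ψ' i j).Realize (Fin.append a z) := by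
        rw [hφ' i]; simp only [Realize, realize_exs]
      rw [H]
      constructor
      · rintro ⟨j, z, hz⟩
        refine ⟨Nat.pair j (k' i j), ?_⟩
        -- The index and the block length are generalized, since the decoded ones agree with the
        -- given ones only propositionally and the type of `z` depends on them.
        have H : ∀ J K (_ : J = j) (_ : K = k' i j), ∃ z : Fin K → B,
            (if h : k' i J = K then h ▸ ψ' i J else falsum : InfForm L (n i + K)).Realize
              (Fin.append a z) := by
          rintro _ _ rfl rfl; exact ⟨z, by simpa using hz⟩
        exact H _ _ (by simp) (by simp)
      · rintro ⟨j, z, hz⟩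
        by_cases h : k' i j.unpair.1 = j.unpair.2
        · have H : ∀ K (h : k' i j.unpair.1 = K) (z : Fin K → B),
              InfForm.Realize (h ▸ ψ' i j.unpair.1 : InfForm L (n i + K)) (Fin.append a z) →
              ∃ z, (ψ' i j.unpair.1).Realize (Fin.append a z) := by
            rintro _ rfl z hz; exact ⟨z, hz⟩
          simp only [ψ, dif_pos h] at hz
          exact ⟨_, H _ h z hz⟩
        · simp only [ψ, dif_neg h, Realize] at hz
    · have h1 : Primrec fun q : (κ × ℕ) × List ℕ => q.1.2.unpair.1 :=
        Primrec.fst.comp (Primrec.unpair.comp (Primrec.snd.comp .fst))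
      have h2 : Primrec fun q : (κ × ℕ) × List ℕ => q.1.2.unpair.2 :=
        Primrec.snd.comp (Primrec.unpair.comp (Primrec.snd.comp .fst))
      have hc : Primrec fun q : (κ × ℕ) × List ℕ => q.1.1 := Primrec.fst.comp .fst
      refine ⟨_, ComputableIn.cond (exCountIs_computable h1.computableIn h2.computableIn
          (g := fun b : ((κ × ℕ) × List ℕ) × List ℕ => g (b.1.1.1, b.2))
          (hg.comp_primrec ((hc.comp .fst).pair .snd)))
        (hg.comp_primrec (hc.pair (Primrec.list_cons.comp h1
          (Primrec.list_append.comp (replicate_primrec.comp h2) .snd))))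
        (falsumLabel_primrec.comp Primrec.snd).computableIn, ?_⟩
      rintro ⟨i, j⟩ p
      simp only [e]
      by_cases h : k' i j.unpair.1 = j.unpair.2
      · rw [(hcount _ _ _).2 h]
        simp only [ψ, dif_pos h, cond_true]
        exact (hreal i _ _ h p).symm
      · rw [Bool.eq_false_iff.2 (mt (hcount _ _ _).1 h)]
        simp only [ψ, dif_neg h, cond_false, label_falsum]

/-- Uniform finite conjunctions. -/
theorem exists_conj (ho : ∀ α ∈ o, 1 ≤ α) {N : ι → ℕ} {gN : κ → ℕ} (hN : XComputable X gN)
    (eN : ∀ i, gN (code i) = N i) {θ : ∀ i, Fin (N i) → InfForm L (n i)}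
    (hΔ : ∀ i a, matrixClass L o _ (θ i a))
    (hθ : LabelComputable X (fun q : Σ i, Fin (N i) => (code q.1, (q.2 : ℕ)))
      fun q => θ q.1 q.2) :
    ∃ Θ : ∀ i, InfForm L (n i), (∀ i, matrixClass L o _ (Θ i)) ∧
      (∀ (B : Type w) [L.Structure B] (i : ι) (v : Fin (n i) → B),
        (Θ i).Realize v ↔ ∀ a, (θ i a).Realize v) ∧
      LabelComputable X code Θ := by
  obtain ⟨g, hg, e⟩ := hθ
  have hgd : Primrec fun q : κ × List ℕ => (q.1, q.2.headI.unpair.1) :=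
    Primrec.fst.pair (Primrec.fst.comp (Primrec.unpair.comp (Primrec.list_headI.comp .snd)))
  have hlt : ComputableIn {charOracle X} fun q : κ × List ℕ =>
      decide (q.2.headI.unpair.1 < gN q.1) :=
    .comp₂ Primrec.nat_lt.decide ((Primrec.snd.comp hgd).computableIn) (hN.comp .fst)
  have htop : Primrec fun q : κ × List ℕ => topLabel q.2.tail :=
    topLabel_primrec.comp (Primrec.list_tail.comp .snd)
  have hnil : PrimrecPred fun q : κ × List ℕ => q.2 = [] := Primrec.eq.comp .snd (.const [])
  cases o with
  | none =>
    -- For the class of all formulas: one countable conjunction, padded with `top` beyond `N i`.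
    refine ⟨fun i => iConj fun a => if h : a < N i then θ i ⟨a, h⟩ else top, fun _ => trivial,
      fun B _ i v => ?_, fun q => if q.2 = [] then Nat.pair 7 0 else
        bif decide (q.2.headI < gN q.1) then g ((q.1, q.2.headI), q.2.tail)
          else topLabel q.2.tail, ?_, fun i p => ?_⟩
    · simp only [Realize]
      refine ⟨fun h a => by simpa using h a, fun h a => ?_⟩
      split_ifs with ha
      · exact h _
      · simp [top, Realize]
    · refine ComputableIn.ite hnil (.const _) (.cond (.comp₂ Primrec.nat_lt.decide
        ((Primrec.list_headI.comp .snd).computableIn) (hN.comp .fst)) (hg.comp_primrec ?_)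
        htop.computableIn)
      exact (Primrec.fst.pair (Primrec.list_headI.comp .snd)).pair (Primrec.list_tail.comp .snd)
    · rcases p with _ | ⟨a, p⟩
      · rfl
      · simp only [reduceCtorEq, if_false, label, eN, List.headI_cons, List.tail_cons]
        by_cases ha : a < N i
        · simpa [ha] using e ⟨i, ⟨a, ha⟩⟩ p
        · simp [ha, label_top]
  | some α =>
    rcases (ho α rfl).eq_or_lt with rfl | hα
    -- For `α = 1` the matrices are quantifier-free and must stay so; hence iterated binary
    -- conjunctions.
    · have hqf : ∀ i a, (θ i a).IsFinQF := fun i a => by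
        obtain ⟨β, hβ, h⟩ := hΔ i a
        exact h.isFinQF hβ
      refine ⟨fun i => finAnd (θ i), fun i => ⟨0, zero_lt_one, .qf _ _ (isFinQF_finAnd _ (hqf i))⟩,
        fun B _ i v => realize_finAnd v _, fun q => finAndLabel (gN q.1)
          (fun a p => g ((q.1, a), p)) q.2, ?_, fun i p => ?_⟩
      · have hone : Primrec fun x : ℕ => x == 1 := Primrec.beq.comp .id (.const 1)
        have ht : Primrec fun q : κ × List ℕ => (q.2.takeWhile (· == 1)).length :=
          Primrec.list_length.comp ((Primrec.list_takeWhile hone).comp .snd)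
        have hd : Primrec fun q : κ × List ℕ => q.2.dropWhile (· == 1) :=
          (Primrec.list_dropWhile hone).comp .snd
        refine (ComputableIn.cond (.comp₂ Primrec.nat_le.decide (hN.comp .fst) ht.computableIn)
          (topLabel_primrec.computableIn.comp (.comp₂ Primrec.list_drop (hN.comp .fst) .snd))
          (.ite (Primrec.eq.comp hd (.const [])) (.const (Nat.pair 4 0))
            (.ite (Primrec.eq.comp (Primrec.list_headI.comp hd) (.const 0))
              (hg.comp_primrec ((Primrec.fst.pair ht).pair (Primrec.list_tail.comp hd)))
              (.const (Nat.pair 10 0))))).of_eq fun q => ?_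
        simp only [finAndLabel, Bool.cond_eq_ite, decide_eq_true_eq]
      · simp only [eN]
        exact (label_finAnd (θ i) (fun a p => g ((code i, a), p)) (fun a p => e ⟨i, a⟩ p) p).symm
    -- For `α > 1` the conjuncts, of possibly different levels, are split into their components, and
    -- all components are listed in one countable conjunction indexed by pairs.
    · refine ⟨fun i => iConj fun j : ℕ => if h : j.unpair.1 < N i then
          (θ i ⟨j.unpair.1, h⟩).component j.unpair.2 else top, fun i => ?_,
        fun B _ i v => ?_, fun q => if q.2 = [] then Nat.pair 7 0 else
          bif decide (q.2.headI.unpair.1 < gN q.1) then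
            bif decide (g ((q.1, q.2.headI.unpair.1), []) = Nat.pair 7 0) then
              g ((q.1, q.2.headI.unpair.1), q.2.headI.unpair.2 :: q.2.tail)
            else g ((q.1, q.2.headI.unpair.1), q.2.tail)
          else topLabel q.2.tail, ?_, fun i p => ?_⟩
      · choose β hβ hθ using hΔ i
        -- A level that bounds all the conjuncts; it is at least `1` so that the quantifier-free
        -- conjuncts and the padding lie below it, and it stays below `α` because there are finitely
        -- many conjuncts.
        let γ : Ordinal := max 1 (Finset.univ.sup β)
        have hγ : γ < α := max_lt hα ((Finset.sup_lt_iff (zero_lt_one.trans hα)).2 fun a _ => hβ a)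
        have hγ0 : 0 < γ := zero_lt_one.trans_le (le_max_left _ _)
        have H : ∀ j : ℕ, ∃ δ < γ, ∃ (k : ℕ) (ψ : InfForm L (n i + k)),
            (if h : j.unpair.1 < N i then (θ i ⟨j.unpair.1, h⟩).component j.unpair.2 else top) =
              alls k ψ ∧ InHierarchy Side.sigma δ ψ := by
          intro j
          split_ifs with h
          · exact (hθ _).component ((Finset.le_sup (Finset.mem_univ _)).trans
              (le_max_right _ _)) hγ0 _
          · exact ⟨0, hγ0, 0, top, rfl, .qf _ _ trivial⟩
        choose δ hδ k ψ e hψ using H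
        refine ⟨γ, hγ, ?_⟩
        simp only [e]
        exact .pi γ δ k ψ hδ hψ
      · simp only [Realize]
        refine ⟨fun h a => (realize_component _ v).2 fun j => ?_, fun h j => ?_⟩
        · simpa using h (Nat.pair a j)
        · split_ifs with hj
          · exact (realize_component _ v).1 (h _) _
          · simp [top, Realize]
      · have htl : Primrec fun q : κ × List ℕ => q.2.tail := Primrec.list_tail.comp .snd
        have h2 : Primrec fun q : κ × List ℕ => q.2.headI.unpair.2 :=
          Primrec.snd.comp (Primrec.unpair.comp (Primrec.list_headI.comp .snd))
        exact .ite hnil (.const _) (hlt.cond (.cond (.comp₂ Primrec.eq.decide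
          (hg.comp_primrec (hgd.pair (.const []))) (.const _))
          (hg.comp_primrec (hgd.pair (Primrec.list_cons.comp h2 htl)))
          (hg.comp_primrec (hgd.pair htl))) htop.computableIn)
      · rcases p with _ | ⟨j, p⟩
        · rfl
        · simp only [reduceCtorEq, if_false, label, eN, List.headI_cons, List.tail_cons]
          by_cases ha : j.unpair.1 < N i
          · have e' := e ⟨i, ⟨j.unpair.1, ha⟩⟩
            simp only at e'
            simp only [ha, decide_true, if_true, dif_pos, e', label_component,
              Bool.cond_eq_ite, decide_eq_true_eq]
          · simp [ha, label_top]

end Families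

/-! ### Closure under positive existential definitions -/

section Positive

variable {L : FirstOrder.Language.{u, v}}

theorem ofFn_val_eq_map_range {α : Type*} (f : ℕ → α) (a : ℕ) :
    (List.ofFn fun i : Fin a => f i) = (List.range a).map f := by
  apply List.ext_getElem <;> simp

theorem sum_fin_eq_sum_range (f : ℕ → ℕ) (a : ℕ) :
    ∑ i : Fin a, f i = ((List.range a).map f).sum := by
  rw [← List.sum_ofFn, ofFn_val_eq_map_range]

theorem list_sum_primrec : Primrec (List.sum : List ℕ → ℕ) :=
  (Primrec.list_foldr Primrec.id (Primrec.const 0)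
    (Primrec.nat_add.comp (Primrec.fst.comp .snd) (Primrec.snd.comp .snd)).to₂).of_eq
    fun l => by simp [List.sum]

/-- The renaming for the `a`-th matrix in a conjunction of existential formulas whose blocks of
quantifiers, of lengths `k`, are put one after the other behind `q` further variables. -/
def blockRenaming {m n q N : ℕ} (ρ : Fin m → Fin (n + q)) (k : Fin N → ℕ) (a : Fin N) :
    Fin (m + k a) → Fin (n + (q + ∑ b, k b)) :=
  Fin.append (fun x => Fin.cast (add_assoc _ _ _) (Fin.castAdd (∑ b, k b) (ρ x)))
    fun y => Fin.natAdd n (Fin.natAdd q (finSigmaFinEquiv ⟨a, y⟩))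

theorem concat_finSigmaFinEquiv {B : Type w} {r : ℕ} {s : Fin r → ℕ} (y : ∀ j, Fin (s j) → B)
    (j : Fin r) (x : Fin (s j)) : concat y (finSigmaFinEquiv ⟨j, x⟩) = y j x := by
  unfold concat
  rw [Equiv.symm_apply_apply]

theorem append_comp_blockRenaming {B : Type w} {m n q N : ℕ} (ρ : Fin m → Fin (n + q))
    (k : Fin N → ℕ) (a : Fin N) (v : Fin n → B) (z : Fin (q + ∑ b, k b) → B) :
    Fin.append v z ∘ blockRenaming ρ k a =
      Fin.append (Fin.append v (fun x => z (Fin.castAdd _ x)) ∘ ρ)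
        fun y => z (Fin.natAdd q (finSigmaFinEquiv ⟨a, y⟩)) := by
  funext x
  refine Fin.addCases (fun x => ?_) (fun y => ?_) x
  · simp only [blockRenaming, Function.comp_apply, Fin.append_left]
    refine Fin.addCases (fun x => ?_) (fun y => ?_) (ρ x)
    · rw [Fin.append_left]
      exact Fin.append_left v z x
    · rw [Fin.append_right]
      exact Fin.append_right v z (Fin.castAdd _ y)
  · simp [blockRenaming]

/-- The renaming as a list of numbers, which makes its dependence on the data visibly primitive
recursive. -/
theorem ofFn_blockRenaming {m n q N : ℕ} (ρ : Fin m → Fin (n + q)) (k : ℕ → ℕ) (a : Fin N) :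
    (List.ofFn fun x => (blockRenaming ρ (fun b : Fin N => k b) a x : ℕ)) =
      (List.ofFn fun x => (ρ x : ℕ)) ++
        (List.range (k a)).map fun y => n + q + ((List.range a).map k).sum + y := by
  have : (fun x => (blockRenaming ρ (fun b : Fin N => k b) a x : ℕ)) =
      Fin.append (fun x => (ρ x : ℕ)) fun y : Fin (k a) =>
        n + q + ((List.range a).map k).sum + y := by
    funext x
    refine Fin.addCases (fun x => ?_) (fun y => ?_) x
    · simp [blockRenaming]
    · simp only [blockRenaming, Fin.append_right, Fin.val_natAdd, finSigmaFinEquiv_apply,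
        Fin.val_castLE, sum_fin_eq_sum_range]
      omega
  rw [this, List.ofFn_fin_append, ofFn_val_eq_map_range (fun y => _ + y)]

variable [Encodable (Σ k, L.Functions k)] [Encodable (Σ k, L.Relations k)]
  {ι κ : Type*} [Primcodable κ] {X : Set ℕ} {n : ι → ℕ} {o : Option Ordinal.{0}} {code : ι → κ}

/-- Uniform closure under positive existential definitions: countable disjunctions of
existentially quantified finite conjunctions of formulas from a given family. -/
theorem exists_positive {T κT : Type*} [Primcodable κT] [Inhabited κT] {codeT : T → κT}
    {ar : T → ℕ} {χ : ∀ τ, InfForm L (ar τ)} (ho : ∀ α ∈ o, 1 ≤ α)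
    (hχ : ∀ τ, sigmaClass L o _ (χ τ)) (hχX : LabelComputable X codeT χ)
    {q : ι → ℕ → ℕ} (conj : ∀ i t, List (Σ τ, Fin (ar τ) → Fin (n i + q i t)))
    {desc : κ × ℕ → (ℕ × ℕ) × List (κT × List ℕ)} (hdesc : Primrec desc)
    (edesc : ∀ i t, desc (code i, t) = ((n i, q i t),
      (conj i t).map fun c => (codeT c.1, List.ofFn fun x => (c.2 x : ℕ)))) :
    ∃ Φ : ∀ i, InfForm L (n i), (∀ i, sigmaClass L o _ (Φ i)) ∧
      (∀ (B : Type w) [L.Structure B] (i : ι) (v : Fin (n i) → B),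
        (Φ i).Realize v ↔ ∃ t, ∃ z : Fin (q i t) → B, ∀ c ∈ conj i t,
          (χ c.1).Realize (Fin.append v z ∘ c.2)) ∧
      LabelComputable X code Φ := by
  obtain ⟨k, ψ, hk, hψ, hψr, g, hg, eg⟩ := exists_matrix.{u, v, w} ho hχ hχX
  -- A disjunct of the result is coded by the index `t` of a given disjunct and a list that chooses
  -- a disjunct `J u a` of the normal form of each conjunct `a`.
  let D : ℕ → ℕ × List ℕ := fun u => Denumerable.ofNat (ℕ × List ℕ) u
  have hD : Primrec D := Primrec.ofNat _
  let J : ℕ → ℕ → ℕ := fun u a => (D u).2.getD a 0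
  have hJ : Primrec₂ J :=
    (Primrec.list_getD 0).comp (Primrec.snd.comp (hD.comp .fst)) .snd
  have hkJ : Primrec₂ fun u a => k (J u a) := hk.comp₂ hJ
  have hsum : Primrec₂ fun u a => ((List.range a).map fun b => k (J u b)).sum :=
    list_sum_primrec.comp (Primrec.list_map (Primrec.list_range.comp .snd)
      (hkJ.comp (Primrec.fst.comp .fst) .snd).to₂)
  let l : ∀ i u, List (Σ τ, Fin (ar τ) → Fin (n i + q i (D u).1)) := fun i u => conj i (D u).1
  -- The merged block: the `q` variables of disjunct `t`, followed by the blocks of the chosen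
  -- matrices.
  let K : ι → ℕ → ℕ := fun i u => q i (D u).1 + ∑ a : Fin (l i u).length, k (J u a)
  let θ : ∀ iu : ι × ℕ, Fin (l iu.1 iu.2).length → InfForm L (n iu.1 + K iu.1 iu.2) :=
    fun iu a => (ψ ((l iu.1 iu.2).get a).1 (J iu.2 a)).rename
      (blockRenaming ((l iu.1 iu.2).get a).2 (fun b => k (J iu.2 b)) a)
  have hdesc' : Primrec fun c : κ × ℕ => desc (c.1, (D c.2).1) :=
    hdesc.comp (Primrec.fst.pair (Primrec.fst.comp (hD.comp .snd)))
  obtain ⟨Θ, hΘ, hΘr, hΘX⟩ := exists_conj.{u, v, w} (X := X) (o := o)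
    (code := fun iu : ι × ℕ => (code iu.1, iu.2))
    (n := fun iu => n iu.1 + K iu.1 iu.2) (N := fun iu => (l iu.1 iu.2).length) ho
    (gN := fun c => (desc (c.1, (D c.2).1)).2.length)
    ((Primrec.list_length.comp (Primrec.snd.comp hdesc')).computableIn)
    (fun iu => by simp [edesc, l]) (θ := θ) (fun iu a => (hψ _ _).rename _) (by
      let A : ((κ × ℕ) × ℕ) × List ℕ → κT × List ℕ := fun c =>
        (desc (c.1.1.1, (D c.1.1.2).1)).2.getD c.1.2 default
      have hA0 : Primrec fun c : ((κ × ℕ) × ℕ) × List ℕ => desc (c.1.1.1, (D c.1.1.2).1) :=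
        hdesc'.comp (Primrec.fst.comp .fst)
      have ha : Primrec fun c : ((κ × ℕ) × ℕ) × List ℕ => c.1.2 := Primrec.snd.comp .fst
      have hu : Primrec fun c : ((κ × ℕ) × ℕ) × List ℕ => c.1.1.2 :=
        Primrec.snd.comp (Primrec.fst.comp .fst)
      have hA : Primrec A := (Primrec.list_getD default).comp (Primrec.snd.comp hA0) ha
      let s0 : ((κ × ℕ) × ℕ) × List ℕ → ℕ := fun c =>
        (desc (c.1.1.1, (D c.1.1.2).1)).1.1 + (desc (c.1.1.1, (D c.1.1.2).1)).1.2
      have hs0 : Primrec s0 := Primrec.nat_add.comp (Primrec.fst.comp (Primrec.fst.comp hA0))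
        (Primrec.snd.comp (Primrec.fst.comp hA0))
      -- The renaming of conjunct `a` as a list, paired with the number of variables of the target.
      -- It is primitive recursive because block lengths depend only on the index of the disjunct;
      -- the oracle is needed for the matrix labels alone.
      let R : ((κ × ℕ) × ℕ) × List ℕ → List ℕ × ℕ := fun c =>
        ((A c).2 ++ (List.range (k (J c.1.1.2 c.1.2))).map (fun y =>
          s0 c + ((List.range c.1.2).map fun b => k (J c.1.1.2 b)).sum + y),
        s0 c + ((List.range (desc (c.1.1.1, (D c.1.1.2).1)).2.length).map
          fun b => k (J c.1.1.2 b)).sum)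
      have hR : Primrec R := by
        refine (Primrec.list_append.comp (Primrec.snd.comp hA) (Primrec.list_map
          (Primrec.list_range.comp (hkJ.comp hu ha)) ?_)).pair ?_
        · exact Primrec.nat_add.comp ((Primrec.nat_add.comp hs0 (hsum.comp hu ha)).comp .fst) .snd
        · exact Primrec.nat_add.comp hs0
            (hsum.comp hu (Primrec.list_length.comp (Primrec.snd.comp hA0)))
      refine ⟨fun c => renameLabel (listRenaming (R c).1 (R c).2)
        (g (((A c).1, J c.1.1.2 c.1.2), c.2)), ?_, ?_⟩
      · exact (ComputableIn.comp_primrec (renameLabel_primrec.computableIn) Primrec.id).comp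
          (hR.computableIn.pair (hg.comp_primrec
            (((Primrec.fst.comp hA).pair (hJ.comp hu ha)).pair .snd)))
      · rintro ⟨⟨i, u⟩, a⟩ p
        have hAa : A (((code i, u), (a : ℕ)), p) = (codeT ((l i u).get a).1,
            List.ofFn fun x => (((l i u).get a).2 x : ℕ)) := by
          have ha : (a : ℕ) < (conj i (D u).1).length := a.2
          simp [A, edesc, l, ha]
        simp only [R, hAa, θ, label_rename_ofFn, ofFn_blockRenaming _ (fun b => k (J u b)),
          s0, edesc, List.length_map, K, sum_fin_eq_sum_range (fun b => k (J u b))]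
        have := eg (((l i u).get a).1, J u a) p
        simp only at this
        rw [this, ← add_assoc])
  refine ⟨fun i => iDisj fun u => exs (K i u) (Θ (i, u)), fun i => sigmaClass_iDisj
    fun u => hΘ (i, u),
    fun B _ i v => ?_, labelComputable_iDisj ⟨fun c => (desc (c.1, (D c.2).1)).1.2 +
      ((List.range (desc (c.1, (D c.2).1)).2.length).map fun b => k (J c.2 b)).sum, ?_, ?_⟩ hΘX⟩
  · simp only [Realize, realize_exs, hΘr, θ, realize_rename, hψr]
    have hb : ∀ u (a : Fin (l i u).length) (z : Fin (K i u) → B),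
        Fin.append v z ∘ blockRenaming ((l i u).get a).2 (fun b => k (J u b)) a =
          Fin.append (Fin.append v (fun x => z (Fin.castAdd _ x)) ∘ ((l i u).get a).2)
            fun y => z (Fin.natAdd (q i (D u).1) (finSigmaFinEquiv
              (n := fun a : Fin (l i u).length => k (J u a)) ⟨a, y⟩)) :=
      fun u a z => append_comp_blockRenaming _ _ a v z
    constructor
    · rintro ⟨u, z, h⟩
      refine ⟨(D u).1, fun x => z (Fin.castAdd _ x), fun c hc => ?_⟩
      obtain ⟨a, rfl⟩ := List.get_of_mem hc
      have := h a
      rw [hb] at this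
      exact ⟨J u a, _, this⟩
    · rintro ⟨t, z, h⟩
      choose j y hy using fun a => h _ (List.get_mem (conj i t) a)
      -- Stated for arbitrary `t'` and `J'` equal to the given ones, so that no tuple has to be cast
      -- after decoding.
      have H : ∀ t' (J' : ℕ → ℕ), t' = t → (∀ a : Fin (conj i t).length, J' a = j a) →
          ∃ z : Fin (q i t' + ∑ a : Fin (conj i t').length, k (J' a)) → B,
            ∀ a : Fin (conj i t').length,
            (ψ ((conj i t').get a).1 (J' a)).Realize
              (Fin.append (Fin.append v (fun x => z (Fin.castAdd _ x)) ∘ ((conj i t').get a).2)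
                fun y => z (Fin.natAdd (q i t') (finSigmaFinEquiv
                  (n := fun a : Fin (conj i t').length => k (J' a)) ⟨a, y⟩))) := by
        rintro t' J' rfl hJ'
        have hy' : ∀ a : Fin (conj i t').length, ∃ y : Fin (k (J' a)) → B, (ψ ((conj i t').get a).1 (J' a)).Realize
            (Fin.append (Fin.append v z ∘ ((conj i t').get a).2) y) := fun a => by
          rw [hJ' a]; exact ⟨y a, hy a⟩
        choose y' hy' using hy'
        refine ⟨Fin.append z (concat y'), fun a => ?_⟩
        simpa [concat_finSigmaFinEquiv] using hy' a
      obtain ⟨z', hz'⟩ := H (D (Encodable.encode (t, List.ofFn j))).1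
        (J (Encodable.encode (t, List.ofFn j))) (by simp [D]) (fun a => by simp [J, D])
      exact ⟨Encodable.encode (t, List.ofFn j), z', fun a => by rw [hb]; exact hz' a⟩
  · exact (Primrec.nat_add.comp (Primrec.snd.comp (Primrec.fst.comp hdesc'))
      (hsum.comp .snd (Primrec.list_length.comp (Primrec.snd.comp hdesc')))).computableIn
  · intro i u
    simp [edesc, K, l, sum_fin_eq_sum_range (fun b => k (J u b))]

end Positive

/-! ### Tuples, concatenation and the pullback relation -/

theorem concat_succ {B : Type w} {r : ℕ} {s : Fin (r + 1) → ℕ} (y : ∀ j, Fin (s j) → B) :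
    concat y = Fin.append (concat fun j : Fin r => y j.castSucc) (y (Fin.last r)) ∘
      Fin.cast (Fin.sum_univ_castSucc s) := by
  funext x
  obtain ⟨⟨j, i⟩, rfl⟩ := finSigmaFinEquiv.surjective x
  rw [concat_finSigmaFinEquiv]
  revert i
  refine Fin.lastCases (fun i => ?_) (fun j i => ?_) j
  · have : Fin.cast (Fin.sum_univ_castSucc s) (finSigmaFinEquiv ⟨Fin.last r, i⟩) =
        Fin.natAdd (∑ j : Fin r, s j.castSucc) i := by
      ext
      simp only [Fin.val_cast, finSigmaFinEquiv_apply, Fin.val_natAdd]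
      rfl
    rw [Function.comp_apply, this, Fin.append_right]
  · have : Fin.cast (Fin.sum_univ_castSucc s) (finSigmaFinEquiv ⟨j.castSucc, i⟩) =
        Fin.castAdd (s (Fin.last r)) (finSigmaFinEquiv (n := fun j : Fin r => s j.castSucc)
          ⟨j, i⟩) := by
      ext
      simp only [Fin.val_cast, finSigmaFinEquiv_apply, Fin.val_castAdd]
      rfl
    rw [Function.comp_apply, this, Fin.append_left, concat_finSigmaFinEquiv]

/-- Concatenation of tuples becomes flattening of lists, the form in which variables are coded. -/
theorem ofFn_concat {B : Type w} : ∀ {r : ℕ} {s : Fin r → ℕ} (y : ∀ j, Fin (s j) → B),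
    List.ofFn (concat y) = (List.ofFn fun j => List.ofFn (y j)).flatten
  | 0, _, _ => by simp
  | r + 1, s, y => by
    rw [List.ofFn_succ', List.concat_eq_append, List.flatten_append, ← ofFn_concat,
      List.flatten_singleton, ← List.ofFn_fin_append, concat_succ]
    exact (List.ofFn_congr (Fin.sum_univ_castSucc s) _).trans (by simp)

section Tuples

variable {B C : Type*}

/-- The image of a tuple under a function. -/
def Tup.map (f : B → C) (x : Tup B) : Tup C := ⟨x.1, f ∘ x.2⟩

/-- The tuple of the first `m` entries. -/
def Tup.head (m : ℕ) (z : Tup B) (h : m ≤ z.1) : Fin m → B := fun i => z.2 (Fin.castLE h i)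

/-- What remains of a tuple after its first `m` entries. -/
def Tup.tail (m : ℕ) (z : Tup B) : Tup B := ⟨z.1 - m, fun i => z.2 ⟨m + i, by omega⟩⟩

theorem comp_concat (f : B → C) {r : ℕ} {s : Fin r → ℕ} (y : ∀ j, Fin (s j) → B) :
    f ∘ concat y = concat fun j => f ∘ y j := rfl

theorem comp_append (f : B → C) {k l : ℕ} (a : Fin k → B) (c : Fin l → B) :
    f ∘ Fin.append a c = Fin.append (f ∘ a) (f ∘ c) := by
  funext i
  refine Fin.addCases (fun x => ?_) (fun y => ?_) i <;> simp

theorem GenForm.realize_map {L : FirstOrder.Language.{u, v}} {B : Type w} [L.Structure B]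
    {m r M : ℕ} (Φ : GenForm L m r) (V : Fin M → B) (p : Fin m → Fin M)
    (x : Fin r → Tup (Fin M)) :
    (Φ fun j => (x j).1).Realize (V ∘ Fin.append p (concat fun j => (x j).2)) ↔
      Φ.Realize (V ∘ p) fun j => (x j).map V := by
  rw [comp_append, comp_concat]; rfl

theorem Tup.map_vec_one (f : B → C) (x : Tup B) :
    (fun j : Fin 1 => Tup.map f (![x] j)) = ![Tup.map f x] := by
  funext j; fin_cases j; rfl

theorem Tup.map_vec_two (f : B → C) (x y : Tup B) :
    (fun j : Fin 2 => Tup.map f (![x, y] j)) = ![Tup.map f x, Tup.map f y] := by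
  funext j; fin_cases j <;> rfl

theorem Tup.map_vec_four (f : B → C) (x y z w : Tup B) :
    (fun j : Fin 4 => Tup.map f (![x, y, z, w] j)) =
      ![Tup.map f x, Tup.map f y, Tup.map f z, Tup.map f w] := by
  funext j; fin_cases j <;> rfl

/-- The relation on tuples `(c, x)`, with `c` in `O` and `x` in `D c`, that is induced by the
relations `S e` along the correspondences `F`. -/
def parameterFree {m : ℕ} (O : Set (Fin m → B)) (D : (Fin m → B) → Set (Tup B))
    (F : Set (Fin 4 → Tup B)) {r : ℕ} (S : (Fin m → B) → Set (Fin r → Tup B)) :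
    Set (Fin r → Tup B) :=
  -- One `e` serves all coordinates, while the parameters inside the `z j` may differ; the relation
  -- is positive in `O`, `D`, `F` and `S`.
  {z | ∃ e ∈ O, ∃ y ∈ S e, ∀ j, ∃ h : m ≤ (z j).1, (z j).head m h ∈ O ∧
    (z j).tail m ∈ D ((z j).head m h) ∧
    ![⟨m, (z j).head m h⟩, ⟨m, e⟩, (z j).tail m, y j] ∈ F}

end Tuples

/-! ### The variables of the pullback formula -/

section Variables

variable {r m : ℕ} (s t : Fin r → ℕ)

/-- The variables of the `j`-th tuple. -/
def tupVars (m : ℕ) (j : Fin r) : Tup (Fin (0 + ∑ j, s j + (m + ∑ j, t j))) :=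
  ⟨s j, fun x => Fin.castAdd _ (Fin.natAdd 0 (finSigmaFinEquiv ⟨j, x⟩))⟩

/-- The quantified variables for the parameters. -/
def paramVars (m : ℕ) : Fin m → Fin (0 + ∑ j, s j + (m + ∑ j, t j)) :=
  fun x => Fin.natAdd _ (Fin.castAdd _ x)

/-- The quantified variables of the `j`-th auxiliary tuple. -/
def auxVars (m : ℕ) (j : Fin r) : Tup (Fin (0 + ∑ j, s j + (m + ∑ j, t j))) :=
  ⟨t j, fun x => Fin.natAdd _ (Fin.natAdd m (finSigmaFinEquiv ⟨j, x⟩))⟩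

variable {B : Type w} {s t}

theorem map_tupVars (p : Fin 0 → B) (x : ∀ j, Fin (s j) → B) (z : Fin (m + ∑ j, t j) → B)
    (j : Fin r) :
    (tupVars s t m j).map (Fin.append (Fin.append p (concat x)) z) = ⟨s j, x j⟩ := by
  simp [Tup.map, tupVars, Function.comp_def, concat_finSigmaFinEquiv, -Fin.natAdd_zero]

theorem append_comp_paramVars (a : Fin (0 + ∑ j, s j) → B) (e : Fin m → B)
    (y : ∀ j, Fin (t j) → B) :
    Fin.append a (Fin.append e (concat y)) ∘ paramVars s t m = e := by
  funext i; simp [paramVars]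

theorem map_auxVars (a : Fin (0 + ∑ j, s j) → B) (e : Fin m → B)
    (y : ∀ j, Fin (t j) → B) (j : Fin r) :
    (auxVars s t m j).map (Fin.append a (Fin.append e (concat y))) = ⟨t j, y j⟩ := by
  simp [Tup.map, auxVars, Function.comp_def, concat_finSigmaFinEquiv]

theorem exists_append_concat (z : Fin (m + ∑ j, t j) → B) :
    ∃ (e : Fin m → B) (y : ∀ j, Fin (t j) → B), z = Fin.append e (concat y) := by
  refine ⟨fun i => z (Fin.castAdd _ i), fun j x => z (Fin.natAdd m (finSigmaFinEquiv ⟨j, x⟩)), ?_⟩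
  funext i
  refine Fin.addCases (fun x => ?_) (fun y => ?_) i
  · simp
  · obtain ⟨⟨j, y⟩, rfl⟩ := finSigmaFinEquiv.surjective y
    simp [concat_finSigmaFinEquiv]

end Variables

/-! ### Joining families of formulas -/

section Sum

variable {L : FirstOrder.Language.{u, v}} [Encodable (Σ k, L.Functions k)]
  [Encodable (Σ k, L.Relations k)] {X : Set ℕ} {ι₁ ι₂ κ₁ κ₂ : Type*} [Primcodable κ₁]
  [Primcodable κ₂] [Inhabited κ₁] [Inhabited κ₂]

/-- Two families of formulas, joined to one. -/
def sumFamily {n : ι₁ ⊕ ι₂ → ℕ} (φ₁ : ∀ i, InfForm L (n (.inl i)))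
    (φ₂ : ∀ i, InfForm L (n (.inr i))) : ∀ i, InfForm L (n i)
  | .inl i => φ₁ i
  | .inr i => φ₂ i

theorem LabelComputable.sum {n : ι₁ ⊕ ι₂ → ℕ} {φ₁ : ∀ i, InfForm L (n (.inl i))}
    {φ₂ : ∀ i, InfForm L (n (.inr i))} {code₁ : ι₁ → κ₁} {code₂ : ι₂ → κ₂}
    (h₁ : LabelComputable X code₁ φ₁) (h₂ : LabelComputable X code₂ φ₂) :
    LabelComputable X (Sum.map code₁ code₂) (sumFamily φ₁ φ₂) := by
  obtain ⟨g₁, hg₁, e₁⟩ := h₁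
  obtain ⟨g₂, hg₂, e₂⟩ := h₂
  have hl : Primrec fun c : (κ₁ ⊕ κ₂) × List ℕ => Sum.elim (fun _ => true) (fun _ => false) c.1 :=
    (Primrec.sumCasesOn (f := fun c : (κ₁ ⊕ κ₂) × List ℕ => c.1) .fst (Primrec.const true).to₂
      (Primrec.const false).to₂).of_eq fun c => by cases c.1 <;> rfl
  have h1 : Primrec fun c : (κ₁ ⊕ κ₂) × List ℕ => Sum.elim id (fun _ => default) c.1 :=
    (Primrec.sumCasesOn (f := fun c : (κ₁ ⊕ κ₂) × List ℕ => c.1) .fst Primrec.snd.to₂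
      (Primrec.const (default : κ₁)).to₂).of_eq fun c => by cases c.1 <;> rfl
  have h2 : Primrec fun c : (κ₁ ⊕ κ₂) × List ℕ => Sum.elim (fun _ => default) id c.1 :=
    (Primrec.sumCasesOn (f := fun c : (κ₁ ⊕ κ₂) × List ℕ => c.1) .fst
      (Primrec.const (default : κ₂)).to₂ Primrec.snd.to₂).of_eq fun c => by cases c.1 <;> rfl
  refine ⟨_, ComputableIn.cond hl.computableIn (hg₁.comp_primrec (h1.pair .snd))
    (hg₂.comp_primrec (h2.pair .snd)), ?_⟩
  rintro (i | i) p
  · exact e₁ i p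
  · exact e₂ i p

end Sum

/-! ### The conjuncts of the pullback formula and their codes -/

section Definability

variable {L : FirstOrder.Language.{u, v}} {m : ℕ}

/-- Indices for the formulas out of which the parameter-free formulas are built: a false formula,
those for the orbit, for the domain, for `F`, and for the given relations. -/
abbrev BlockIndex {ι : Type v'} (r : ι → ℕ) : Type v' :=
  (Unit ⊕ Unit) ⊕ ((Fin 1 → ℕ) ⊕ (Fin 4 → ℕ)) ⊕ Σ i, Fin (r i) → ℕ

/-- The number of variables of the formula with a given index. -/
def blockArity (m : ℕ) {ι : Type v'} (r : ι → ℕ) : BlockIndex r → ℕ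
  | .inl (.inl _) => 0
  | .inl (.inr _) => m
  | .inr (.inl (.inl s)) => m + ∑ j, s j
  | .inr (.inl (.inr s)) => 0 + ∑ j, s j
  | .inr (.inr s) => m + ∑ j, s.2 j

/-- The code of an index. -/
def blockCode {ι : Type v'} [Encodable ι] (r : ι → ℕ) :
    BlockIndex r → (Unit ⊕ Unit) ⊕ (List ℕ ⊕ List ℕ) ⊕ (ℕ × List ℕ) :=
  Sum.map (Sum.map id id) (Sum.map (Sum.map (fun s => List.ofFn s) fun s => List.ofFn s)
    fun s => (Encodable.encode s.1, List.ofFn s.2))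

/-- The formulas with the given indices. -/
def blockForm {ι : Type v'} {r : ι → ℕ} (φ : InfForm L m) (Δ : GenForm L m 1) (Φ : GenForm L 0 4)
    (Ψ : ∀ i, GenForm L m (r i)) : ∀ τ, InfForm L (blockArity m r τ) :=
  -- The false formula is written as a countable disjunction because the syntactic `Σ_α` form is
  -- required for `α ≥ 1`.
  sumFamily (sumFamily (fun _ => (iDisj fun _ => falsum : InfForm L 0)) fun _ => φ)
    (sumFamily (sumFamily Δ Φ) fun s => Ψ s.1 s.2)

section Conjuncts

variable {ι : Type v'} {r : ι → ℕ} (m)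

/-- The `j`-th length that is coded by `t`. -/
def codedLength (t j : ℕ) : ℕ := (Denumerable.ofNat (List ℕ) t).getD j 0

/-- A formula and its variables, for a generalized formula with given variables. -/
def relConjunct {M r' : ℕ} (p : Fin m → Fin M) (x : Fin r' → Tup (Fin M)) :
    Fin (m + ∑ j, (x j).1) → Fin M := Fin.append p (concat fun j => (x j).2)

/-- The conjuncts that define the parameter-free relation. -/
def conjuncts (x : Σ i, Fin (r i) → ℕ) (t : ℕ) :
    List (Σ τ : BlockIndex r, Fin (blockArity m r τ) →
      Fin (0 + ∑ j, x.2 j + (m + ∑ j : Fin (r x.1), codedLength t j))) :=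
  let z := tupVars x.2 (fun j => codedLength t j) m
  let e := paramVars x.2 (fun j => codedLength t j) m
  let y := auxVars x.2 (fun j => codedLength t j) m
  if h : ∀ j, m ≤ x.2 j then
    ⟨.inr (.inr ⟨x.1, fun j => (y j).1⟩), relConjunct m e y⟩ :: ⟨.inl (.inr ()), e⟩ ::
      (List.finRange (r x.1)).flatMap fun j =>
        let c := (z j).head m (h j)
        let w : Fin 4 → Tup (Fin (0 + ∑ j, x.2 j + (m + ∑ j : Fin (r x.1), codedLength t j))) :=
          ![⟨m, c⟩, ⟨m, e⟩, (z j).tail m, y j]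
        [⟨.inl (.inr ()), c⟩,
          ⟨.inr (.inl (.inl fun k => (![(z j).tail m] k).1)), relConjunct m c ![(z j).tail m]⟩,
          ⟨.inr (.inl (.inr fun k => (w k).1)), relConjunct 0 ![] w⟩]
  -- A tuple shorter than `m` contains no parameter, so nothing is related at these lengths.
  else [⟨.inl (.inl ()), Fin.elim0⟩]

/-- The list of the `k` variables from `x_a` on. -/
def varBlock (a k : ℕ) : List ℕ := (List.range k).map fun y => a + y

theorem varBlock_primrec : Primrec₂ varBlock :=
  Primrec.list_map (Primrec.list_range.comp .snd)
    (Primrec.nat_add.comp (Primrec.fst.comp .fst) .snd).to₂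

/-- The sum of the first `j` values of `f`. -/
def prefixSum (f : ℕ → ℕ) (j : ℕ) : ℕ := ((List.range j).map f).sum

theorem prefixSum_primrec {α : Type*} [Primcodable α] {f : α → ℕ → ℕ} (hf : Primrec₂ f) :
    Primrec₂ fun a j => prefixSum (f a) j :=
  list_sum_primrec.comp (Primrec.list_map (Primrec.list_range.comp .snd)
    (hf.comp (Primrec.fst.comp .fst) .snd).to₂)

/-- The codes of `conjuncts`. -/
def conjunctCodes (c : (ℕ × List ℕ) × ℕ) :
    (ℕ × ℕ) × List (((Unit ⊕ Unit) ⊕ (List ℕ ⊕ List ℕ) ⊕ (ℕ × List ℕ)) × List ℕ) :=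
  let k := c.1.2.length
  let s := fun j => c.1.2.getD j 0
  let t := codedLength c.2
  ((prefixSum s k, m + prefixSum t k),
    -- With truncated subtraction, the sum vanishes iff every length is at least `m`.
    if (c.1.2.map fun x => m - x).sum = 0 then
      (.inr (.inr (c.1.1, (List.range k).map t)), varBlock (prefixSum s k) m ++
        (List.range k).flatMap fun j => varBlock (prefixSum s k + m + prefixSum t j) (t j)) ::
      (.inl (.inr ()), varBlock (prefixSum s k) m) ::
      (List.range k).flatMap fun j =>
        [(.inl (.inr ()), varBlock (prefixSum s j) m),
          (.inr (.inl (.inl [s j - m])),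
            varBlock (prefixSum s j) m ++ varBlock (prefixSum s j + m) (s j - m)),
          (.inr (.inl (.inr [m, m, s j - m, t j])),
            varBlock (prefixSum s j) m ++ varBlock (prefixSum s k) m ++
              varBlock (prefixSum s j + m) (s j - m) ++
              varBlock (prefixSum s k + m + prefixSum t j) (t j))]
    else [(.inl (.inl ()), [])])

theorem conjunctCodes_primrec : Primrec (conjunctCodes m) := by
  have hs : Primrec₂ fun (c : (ℕ × List ℕ) × ℕ) j => c.1.2.getD j 0 :=
    (Primrec.list_getD 0).comp (Primrec.snd.comp (Primrec.fst.comp .fst)) .snd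
  have ht : Primrec₂ fun (c : (ℕ × List ℕ) × ℕ) j => codedLength c.2 j :=
    (Primrec.list_getD 0).comp ((Primrec.ofNat (List ℕ)).comp (Primrec.snd.comp .fst)) .snd
  have hl : Primrec fun c : (ℕ × List ℕ) × ℕ => c.1.2 := Primrec.snd.comp .fst
  have hk : Primrec fun c : (ℕ × List ℕ) × ℕ => c.1.2.length := Primrec.list_length.comp hl
  have hps := prefixSum_primrec hs
  have hpt := prefixSum_primrec ht
  have hS : Primrec fun c : (ℕ × List ℕ) × ℕ =>
      prefixSum (fun j => c.1.2.getD j 0) c.1.2.length := hps.comp .id hk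
  have hcond : PrimrecPred fun c : (ℕ × List ℕ) × ℕ => (c.1.2.map fun x => m - x).sum = 0 :=
    Primrec.eq.comp (list_sum_primrec.comp
      (Primrec.list_map hl (Primrec.nat_sub.comp (.const m) .snd).to₂)) (.const 0)
  have hy : Primrec₂ fun (c : (ℕ × List ℕ) × ℕ) j =>
      varBlock (prefixSum (fun j => c.1.2.getD j 0) c.1.2.length + m +
        prefixSum (codedLength c.2) j) (codedLength c.2 j) :=
    varBlock_primrec.comp (Primrec.nat_add.comp (Primrec.nat_add.comp (hS.comp .fst) (.const m))
      hpt) ht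
  have he : Primrec fun c : (ℕ × List ℕ) × ℕ =>
      varBlock (prefixSum (fun j => c.1.2.getD j 0) c.1.2.length) m :=
    varBlock_primrec.comp hS (.const m)
  have hc : Primrec₂ fun (c : (ℕ × List ℕ) × ℕ) j =>
      varBlock (prefixSum (fun j => c.1.2.getD j 0) j) m :=
    varBlock_primrec.comp hps (.const m)
  have htl : Primrec₂ fun (c : (ℕ × List ℕ) × ℕ) j =>
      varBlock (prefixSum (fun j => c.1.2.getD j 0) j + m) (c.1.2.getD j 0 - m) :=
    varBlock_primrec.comp (Primrec.nat_add.comp hps (.const m))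
      (Primrec.nat_sub.comp hs (.const m))
  have hsm : Primrec₂ fun (c : (ℕ × List ℕ) × ℕ) j => c.1.2.getD j 0 - m :=
    Primrec.nat_sub.comp hs (.const m)
  refine (hS.pair (Primrec.nat_add.comp (.const m) (hpt.comp .id hk))).pair
    (Primrec.ite hcond (Primrec.list_cons.comp ?_ (Primrec.list_cons.comp
      (Primrec.pair (.const _) he) (Primrec.list_flatMap (Primrec.list_range.comp hk) ?_))) (.const _))
  · refine Primrec.pair (Primrec.sumInr.comp (Primrec.sumInr.comp ((Primrec.fst.comp .fst).pair
      (Primrec.list_map (Primrec.list_range.comp hk) ht)))) ?_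
    exact Primrec.list_append.comp he (Primrec.list_flatMap (Primrec.list_range.comp hk) hy)
  · refine Primrec.list_cons.comp (Primrec.pair (.const _) hc) (Primrec.list_cons.comp
      (Primrec.pair ?_ (Primrec.list_append.comp hc htl))
      (Primrec.list_cons.comp (Primrec.pair ?_ ?_) (.const [])))
    · exact Primrec.sumInr.comp (Primrec.sumInl.comp (Primrec.sumInl.comp
        (Primrec.list_cons.comp hsm (.const []))))
    · exact Primrec.sumInr.comp (Primrec.sumInl.comp (Primrec.sumInr.comp
        (Primrec.list_cons.comp (.const m) (Primrec.list_cons.comp (.const m)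
          (Primrec.list_cons.comp hsm (Primrec.list_cons.comp ht (.const [])))))))
    · exact Primrec.list_append.comp (Primrec.list_append.comp (Primrec.list_append.comp hc
        (he.comp .fst)) htl) hy

theorem ofFn_relConjunct {M r' : ℕ} (p : Fin m → Fin M) (x : Fin r' → Tup (Fin M)) :
    (List.ofFn fun i => (relConjunct m p x i : ℕ)) = (List.ofFn fun i => (p i : ℕ)) ++
      (List.ofFn fun j => List.ofFn fun i => ((x j).2 i : ℕ)).flatten := by
  have h : (fun i => (relConjunct m p x i : ℕ)) = Fin.append (fun i => (p i : ℕ))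
      (concat fun j i => ((x j).2 i : ℕ)) := comp_append Fin.val p _
  rw [h, List.ofFn_fin_append, ofFn_concat]

theorem prefixSum_ofFn {k : ℕ} (s : Fin k → ℕ) (j : ℕ) (hj : j ≤ k) :
    prefixSum (fun i => (List.ofFn s).getD i 0) j = ∑ i : Fin j, s (Fin.castLE hj i) := by
  rw [prefixSum, ← sum_fin_eq_sum_range]
  refine Finset.sum_congr rfl fun i _ => ?_
  have : (i : ℕ) < k := i.2.trans_le hj
  simp [this, Fin.castLE]

theorem ofFn_eq_varBlock {k a : ℕ} {f : Fin k → ℕ} (h : ∀ i, f i = a + i) :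
    List.ofFn f = varBlock a k := by
  rw [varBlock, ← ofFn_val_eq_map_range]
  exact congrArg _ (funext h)

variable {m}

/-- Computing with lists of numbers gives the actual variables: each of the tuples involved occupies
a block of consecutive variables, located by a prefix sum of lengths. -/
theorem conjunctCodes_eq [Encodable ι] (x : Σ i, Fin (r i) → ℕ) (t : ℕ) :
    conjunctCodes m ((Encodable.encode x.1, List.ofFn x.2), t) =
      ((0 + ∑ j, x.2 j, m + ∑ j : Fin (r x.1), codedLength t j),
        (conjuncts m x t).map fun c => (blockCode r c.1, List.ofFn fun i => (c.2 i : ℕ))) := by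
  obtain ⟨i, s⟩ := x
  have hS : prefixSum (fun i => (List.ofFn s).getD i 0) (r i) = ∑ j, s j := by
    rw [prefixSum_ofFn _ _ le_rfl]; rfl
  have hT : ∀ j, prefixSum (codedLength t) j = ∑ i : Fin j, codedLength t i := fun j =>
    (sum_fin_eq_sum_range _ _).symm
  have hcond : ((List.ofFn s).map fun x => m - x).sum = 0 ↔ ∀ j, m ≤ s j := by
    simp [List.sum_eq_zero_iff, Nat.sub_eq_zero_iff_le]
  have hrange : List.range (r i) = (List.finRange (r i)).map Fin.val := by simp
  have hs : ∀ j : Fin (r i), (List.ofFn s).getD j 0 = s j := fun j => by simp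
  have hz : ∀ j (h : m ≤ s j), (List.ofFn fun x => Fin.val ((tupVars s (fun j => codedLength t j)
      m j).head m h x)) = varBlock (prefixSum (fun i => (List.ofFn s).getD i 0) j) m :=
    fun j h => ofFn_eq_varBlock fun x => by
      rw [prefixSum_ofFn _ _ j.2.le]
      simp [tupVars, Tup.head, -Fin.natAdd_zero]
  have htl : ∀ j, (List.ofFn fun x => (((tupVars s (fun j => codedLength t j)
      m j).tail m).2 x : ℕ)) = varBlock (prefixSum (fun i => (List.ofFn s).getD i 0) j + m)
        (s j - m) :=
    fun j => ofFn_eq_varBlock fun x => by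
      rw [prefixSum_ofFn _ _ j.2.le]
      simp [tupVars, Tup.tail, -Fin.natAdd_zero, add_assoc]
  have he : (List.ofFn fun x => (paramVars s (fun j => codedLength t j) m x : ℕ)) =
      varBlock (∑ j, s j) m := ofFn_eq_varBlock fun x => by simp [paramVars]
  have hy : ∀ j, (List.ofFn fun x => ((auxVars s (fun j => codedLength t j) m j).2 x : ℕ)) =
      varBlock (∑ j, s j + m + prefixSum (codedLength t) j) (codedLength t j) :=
    fun j => ofFn_eq_varBlock fun x => by
      simp [auxVars, hT, add_assoc]
  simp only [conjunctCodes, List.length_ofFn, hS, hT, zero_add, conjuncts, hcond]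
  refine congrArg _ ?_
  by_cases h : ∀ j, m ≤ s j
  · rw [if_pos h, dif_pos h, List.map_cons, List.map_cons, List.map_flatMap, hrange]
    refine congrArg₂ _ (Prod.ext ?_ ?_) (congrArg₂ _ (Prod.ext rfl he.symm) ?_)
    · simp only [blockCode, Sum.map_inr, List.map_map]
      rw [List.ofFn_eq_map]
      rfl
    · refine Eq.trans ?_ (ofFn_relConjunct m _ _).symm
      simp only [he, hy, hT, List.flatMap_map, List.ofFn_eq_map (n := r i)]
      rw [List.flatMap_def]
    · simp only [List.flatMap_map]
      refine List.flatMap_congr fun j _ => ?_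
      simp only [List.map_cons, List.map_nil, hs]
      refine congrArg₂ _ (Prod.ext rfl (hz j (h j)).symm)
        (congrArg₂ _ (Prod.ext ?_ ?_) (congrArg₂ _ (Prod.ext ?_ ?_) rfl))
      · simp [blockCode, tupVars, Tup.tail]
      · refine Eq.trans ?_ (ofFn_relConjunct m _ _).symm
        rw [hz j (h j)]
        simp [htl]
      · simp [blockCode, tupVars, auxVars, Tup.tail, List.ofFn_succ]
      · refine Eq.trans ?_ (ofFn_relConjunct 0 _ _).symm
        simp [List.ofFn_succ, htl, hz j (h j), he, hy, hT]
  · rw [if_neg h, dif_neg h]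
    rfl

end Conjuncts

end Definability

/-! ### Equivariance and correctness of the pullback formula -/

section Definability

variable {L : FirstOrder.Language.{u, v}} {B : Type w} [L.Structure B] {m : ℕ}

/-- Invariance of a family of relations under automorphisms. -/
def Equivariant (L : FirstOrder.Language.{u, v}) {B : Type w} [L.Structure B] {m r : ℕ}
    (S : (Fin m → B) → Set (Fin r → Tup B)) : Prop :=
  ∀ (σ : B ≃[L] B) (c : Fin m → B) (x : Fin r → Tup B),
    x ∈ S c ↔ (fun j => (x j).map σ) ∈ S (σ ∘ c)

theorem GenForm.realize_equiv {r : ℕ} (Φ : GenForm L m r) (σ : B ≃[L] B) (p : Fin m → B)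
    (x : Fin r → Tup B) : (Φ.Realize (σ ∘ p) fun j => (x j).map σ) ↔ Φ.Realize p x := by
  refine Iff.trans ?_ (InfForm.realize_equiv σ _ _)
  rw [comp_append, comp_concat]
  rfl

theorem mem_tupOrbit_iff {b c : Fin m → B} : c ∈ tupOrbit L b ↔ ∃ σ : B ≃[L] B, σ ∘ b = c := by
  simp [tupOrbit, funext_iff]

/-- An automorphism that takes `b` to `c` carries both `S b` and the meaning of the formula along,
so the formula that works at `b` works on the whole orbit. -/
theorem Equivariant.mem_iff_realize {r : ℕ} {S : (Fin m → B) → Set (Fin r → Tup B)}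
    (hS : Equivariant L S) {b : Fin m → B} {Φ : GenForm L m r}
    (h : ∀ x, x ∈ S b ↔ Φ.Realize b x) {c : Fin m → B} (hc : c ∈ tupOrbit L b)
    (x : Fin r → Tup B) : x ∈ S c ↔ Φ.Realize c x := by
  obtain ⟨σ, rfl⟩ := mem_tupOrbit_iff.1 hc
  have hx : x = fun j => ((x j).map σ.symm).map σ := by
    funext j
    refine Sigma.ext rfl (heq_of_eq (funext fun i => ?_))
    simp [Tup.map]
  rw [hx, ← hS, Φ.realize_equiv, h]

theorem Tup.exists_eq_mk {r : ℕ} {k : Fin r → ℕ} {y : Fin r → Tup B} (h : ∀ j, k j = (y j).1) :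
    ∃ y' : ∀ j, Fin (k j) → B, y = fun j => ⟨k j, y' j⟩ := by
  obtain rfl : k = fun j => (y j).1 := funext h
  exact ⟨fun j => (y j).2, rfl⟩

/-- The disjunction over `t` runs through all possible lengths of the auxiliary tuples. The formulas
for `D` and `S` need to be correct only at parameters in `O`, because membership of `c_j` and `e` in
`O` is itself among the conjuncts. -/
theorem blockForm_realize {ι : Type v'} {r : ι → ℕ} {φ : InfForm L m} {Δ : GenForm L m 1}
    {Φ : GenForm L 0 4} {Ψ : ∀ i, GenForm L m (r i)} {O : Set (Fin m → B)}
    {D : (Fin m → B) → Set (Tup B)} {F : Set (Fin 4 → Tup B)}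
    {S : ∀ i, (Fin m → B) → Set (Fin (r i) → Tup B)} (hφ : ∀ c, c ∈ O ↔ φ.Realize c)
    (hΔ : ∀ c ∈ O, ∀ x, x ∈ D c ↔ Δ.Realize c ![x]) (hΦ : ∀ x, x ∈ F ↔ Φ.Realize ![] x)
    (hΨ : ∀ i, ∀ c ∈ O, ∀ x, x ∈ S i c ↔ (Ψ i).Realize c x)
    (i : ι) (s : Fin (r i) → ℕ) (x : ∀ j, Fin (s j) → B) :
    (∃ t, ∃ z : Fin (m + ∑ j : Fin (r i), codedLength t j) → B, ∀ c ∈ conjuncts m ⟨i, s⟩ t,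
      (blockForm φ Δ Φ Ψ c.1).Realize (Fin.append (Fin.append ![] (concat x)) z ∘ c.2)) ↔
    (fun j => (⟨s j, x j⟩ : Tup B)) ∈ parameterFree O D F (S i) := by
  by_cases h : ∀ j, m ≤ s j
  · have key : ∀ t (e : Fin m → B) (y : ∀ j : Fin (r i), Fin (codedLength t j) → B),
        (∀ c ∈ conjuncts m ⟨i, s⟩ t, (blockForm φ Δ Φ Ψ c.1).Realize
          (Fin.append (Fin.append ![] (concat x)) (Fin.append e (concat y)) ∘ c.2)) ↔
        (Ψ i).Realize e (fun j => ⟨codedLength t j, y j⟩) ∧ φ.Realize e ∧ ∀ j : Fin (r i),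
          φ.Realize (Tup.head m ⟨s j, x j⟩ (h j)) ∧
          Δ.Realize (Tup.head m ⟨s j, x j⟩ (h j)) ![Tup.tail m ⟨s j, x j⟩] ∧
          Φ.Realize ![] ![⟨m, Tup.head m ⟨s j, x j⟩ (h j)⟩, ⟨m, e⟩, Tup.tail m ⟨s j, x j⟩,
            ⟨codedLength t j, y j⟩] := by
      intro t e y
      set V := Fin.append (Fin.append ![] (concat x)) (Fin.append e (concat y)) with hV
      have he : V ∘ paramVars s (fun j => codedLength t j) m = e := append_comp_paramVars _ _ _
      have hy : ∀ j, (auxVars s (fun j => codedLength t j) m j).map V = ⟨codedLength t j, y j⟩ :=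
        map_auxVars _ _ _
      have hz : ∀ j, (tupVars s (fun j => codedLength t j) m j).map V = ⟨s j, x j⟩ :=
        map_tupVars _ _ _
      have hhd : ∀ j, V ∘ (tupVars s (fun j => codedLength t j) m j).head m (h j) =
          Tup.head m ⟨s j, x j⟩ (h j) := fun j => by
        obtain ⟨_, h2⟩ := Sigma.mk.inj_iff.1 (hz j)
        exact funext fun i => congrFun (eq_of_heq h2) (Fin.castLE (h j) i)
      have htl : ∀ j, ((tupVars s (fun j => codedLength t j) m j).tail m).map V =
          Tup.tail m ⟨s j, x j⟩ := fun j => by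
        rw [← hz]; rfl
      rw [conjuncts, dif_pos h, List.forall_mem_cons, List.forall_mem_cons]
      refine and_congr ?_ (and_congr ?_ ?_)
      · refine ((Ψ i).realize_map V _ _).trans ?_
        simp only [he, hy]
      · rw [← he]; rfl
      · simp only [List.forall_mem_flatMap, List.mem_finRange, true_implies,
          List.forall_mem_cons]
        refine forall_congr' fun j => and_congr ?_ (and_congr ?_ ?_)
        · rw [← hhd]; rfl
        · refine (Δ.realize_map V _ _).trans ?_
          rw [Tup.map_vec_one, hhd, htl]
        · refine Iff.trans (and_iff_left (by simp)) ((Φ.realize_map V _ _).trans ?_)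
          rw [Tup.map_vec_four, htl, hy, ← hhd, ← he, Subsingleton.elim (V ∘ ![]) (![] : Fin 0 → B)]
          rfl
    constructor
    · rintro ⟨t, z, hz⟩
      obtain ⟨e, y, rfl⟩ := exists_append_concat z
      obtain ⟨hS, he, hj⟩ := (key t e y).1 hz
      rw [← hφ] at he
      refine ⟨e, he, _, (hΨ i e he _).2 hS, fun j => ⟨h j, ?_⟩⟩
      have hc := (hφ _).2 (hj j).1
      exact ⟨hc, (hΔ _ hc _).2 (hj j).2.1, (hΦ _).2 (hj j).2.2⟩
    · rintro ⟨e, he, y, hy, hj⟩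
      have ht : ∃ t, ∀ j : Fin (r i), codedLength t j = (y j).1 :=
        ⟨Encodable.encode (List.ofFn fun j => (y j).1), fun j => by simp [codedLength]⟩
      obtain ⟨t, ht⟩ := ht
      obtain ⟨y', rfl⟩ : ∃ y' : ∀ j : Fin (r i), Fin (codedLength t j) → B,
          y = fun j => ⟨codedLength t j, y' j⟩ :=
        Tup.exists_eq_mk ht
      refine ⟨t, Fin.append e (concat y'), (key t e y').2 ⟨(hΨ i e he _).1 hy, (hφ e).1 he,
        fun j => ?_⟩⟩
      obtain ⟨_, hc, hd, hf⟩ := hj j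
      exact ⟨(hφ _).1 hc, (hΔ _ hc _).1 hd, (hΦ _).1 hf⟩
  · constructor
    · rintro ⟨t, z, hz⟩
      rw [conjuncts, dif_neg h] at hz
      exact (hz _ (List.mem_singleton_self _)).elim fun _ h => h.elim
    · rintro ⟨e, he, y, hy, hj⟩
      exact absurd (fun j => (hj j).1) h

variable [Encodable (Σ k, L.Functions k)] [Encodable (Σ k, L.Relations k)] {X : Set ℕ}
  {o : Option Ordinal.{0}}

theorem XGenDefinable.exists_genForm {Γ : FormClass L} {p : Fin m → B} {r : ℕ}
    {S : Set (Fin r → Tup B)} (h : XGenDefinable X Γ p r S) :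
    ∃ Φ : GenForm L m r, (∀ s, Γ _ (Φ s)) ∧ (∀ x, x ∈ S ↔ Φ.Realize p x) ∧
      LabelComputable X (fun s : Fin r → ℕ => List.ofFn s) Φ := by
  obtain ⟨Φ, hΓ, hΦ, g, hg, e⟩ := h
  refine ⟨Φ (), hΓ (), hΦ (), fun q => g (Encodable.encode (), q.1, q.2),
    hg.comp_primrec ((Primrec.const _).pair .id), fun s p => e () s p⟩

theorem labelComputable_const {n : ℕ} {φ : InfForm L n} (h : φ.IsXComputable X) :
    LabelComputable X (n := fun _ => n) (id : Unit → Unit) (fun _ => φ) :=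
  ⟨fun q => φ.label q.2, ComputableIn.comp_primrec h .snd, fun _ _ => rfl⟩

theorem isXComputable_iDisj_falsum {n : ℕ} :
    (iDisj fun _ => falsum : InfForm L n).IsXComputable X := by
  refine ComputableIn.of_eq (Primrec.computableIn (f := fun p : List ℕ =>
    if p = [] then Nat.pair 6 0 else falsumLabel p.tail) ?_) fun p => ?_
  · exact Primrec.ite (Primrec.eq.comp .id (.const [])) (.const _)
      (falsumLabel_primrec.comp Primrec.list_tail)
  · rcases p with _ | ⟨i, p⟩
    · rfl
    · simp [label, label_falsum]

/-- The parameter-free relations are `X`-computably definable, uniformly. -/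
theorem xGenDefinableFamily_parameterFree (ho : ∀ α ∈ o, 1 ≤ α) {b : Fin m → B}
    {D : (Fin m → B) → Set (Tup B)} {F : Set (Fin 4 → Tup B)} {ι : Type v'} [Encodable ι]
    {r : ι → ℕ} {S : ∀ i, (Fin m → B) → Set (Fin (r i) → Tup B)}
    (hD : Equivariant L fun c => {x : Fin 1 → Tup B | x 0 ∈ D c}) (hS : ∀ i, Equivariant L (S i))
    (hOdef : XSetDefinable X (sigmaClass L o) (tupOrbit L b))
    (hFdef : XGenDefinable X (sigmaClass L o) ![] 4 F)
    (hDdef : XGenDefinable X (sigmaClass L o) b 1 {x | x 0 ∈ D b})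
    (hSdef : XGenDefinableFamily X (sigmaClass L o) b r fun i => S i b) :
    XGenDefinableFamily X (sigmaClass L o) ![] r
      fun i => parameterFree (tupOrbit L b) D F (S i) := by
  obtain ⟨φ, hφΓ, hφX, hφ⟩ := hOdef
  obtain ⟨Φ, hΦΓ, hΦ, hΦX⟩ := hFdef.exists_genForm
  obtain ⟨Δ, hΔΓ, hΔ, hΔX⟩ := hDdef.exists_genForm
  obtain ⟨Ψ, hΨΓ, hΨ, g, hg, eg⟩ := hSdef
  have hΨX : LabelComputable X (fun s : Σ i, Fin (r i) → ℕ => (Encodable.encode s.1,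
      List.ofFn s.2)) fun s => Ψ s.1 s.2 :=
    ⟨fun q => g (q.1.1, q.1.2, q.2), hg.comp_primrec ((Primrec.fst.comp .fst).pair
      ((Primrec.snd.comp .fst).pair .snd)), fun s p => eg s.1 s.2 p⟩
  obtain ⟨Θ, hΘΓ, hΘ, gΘ, hgΘ, eΘ⟩ := exists_positive.{u, v, w} (X := X) (o := o)
    (code := fun x : Σ i, Fin (r i) → ℕ => (Encodable.encode x.1, List.ofFn x.2))
    (codeT := blockCode r) (χ := blockForm φ Δ Φ Ψ) ho
    (by
      rintro ((_ | _) | (s | s) | s)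
      · exact sigmaClass_iDisj (k := fun _ => 0) fun _ => matrixClass_falsum ho
      · exact hφΓ
      · exact hΔΓ s
      · exact hΦΓ s
      · exact hΨΓ s.1 s.2)
    (((labelComputable_const isXComputable_iDisj_falsum).sum (labelComputable_const hφX)).sum
      ((hΔX.sum hΦX).sum hΨX))
    (conjuncts m) (conjunctCodes_primrec m) conjunctCodes_eq
  refine ⟨fun i s => Θ ⟨i, s⟩, fun i s => hΘΓ ⟨i, s⟩, fun i x => ?_,
    fun q => gΘ ((q.1, q.2.1), q.2.2), ?_, fun i s p => eΘ ⟨i, s⟩ p⟩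
  · exact ((hΘ B _ _).trans (blockForm_realize hφ (fun c hc x => hD.mem_iff_realize hΔ hc ![x]) hΦ
      (fun i c hc x => (hS i).mem_iff_realize (hΨ i) hc x) i _ fun j => (x j).2)).symm
  · exact hgΘ.comp_primrec ((Primrec.fst.pair (Primrec.fst.comp .snd)).pair
      (Primrec.snd.comp .snd))

end Definability

/-! ### From computable definability to plain definability -/

section Oracle

variable {L : FirstOrder.Language.{u, v}} [Encodable (Σ k, L.Functions k)]
  [Encodable (Σ k, L.Relations k)]

/-- Every countable set of formulas is computed by some oracle. -/
theorem exists_isXComputable (S : Set (Σ n, InfForm L n)) (hS : S.Countable) :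
    ∃ X : Set ℕ, ∀ φ ∈ S, φ.2.IsXComputable X := by
  rcases S.eq_empty_or_nonempty with rfl | hne
  · exact ⟨∅, fun _ h => h.elim⟩
  · obtain ⟨φ, rfl⟩ := hS.exists_eq_range hne
    obtain ⟨X, hX⟩ := exists_xComputable_seq fun i => (φ i).2.label
    exact ⟨X, by rintro _ ⟨i, rfl⟩; exact hX i⟩

/-- The labels of a generalized formula, in terms of the list of the lengths of its arguments. -/
def GenForm.codedLabel {m r : ℕ} (Φ : GenForm L m r) (q : List ℕ × List ℕ) : ℕ :=
  (Φ fun j => q.1.getD j 0).label q.2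

variable {B : Type w} [L.Structure B] {m : ℕ} {X : Set ℕ}

theorem GenForm.xGenDefinable {Γ : FormClass L} {p : Fin m → B} {r : ℕ} {S : Set (Fin r → Tup B)}
    {Φ : GenForm L m r} (hΓ : ∀ s, Γ _ (Φ s)) (hΦ : ∀ x, x ∈ S ↔ Φ.Realize p x)
    (hX : XComputable X Φ.codedLabel) : XGenDefinable X Γ p r S :=
  ⟨fun _ => Φ, fun _ => hΓ, fun _ => hΦ, fun q => Φ.codedLabel q.2, hX.comp_primrec .snd,
    fun _ s pos => by
      have h : ∀ s', s' = s → (Φ s').label pos = (Φ s).label pos := by rintro _ rfl; rfl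
      exact h _ (funext fun j => by simp)⟩

theorem XGenDefinable.genDefinable {Γ : FormClass L} {p : Fin m → B} {r : ℕ}
    {S : Set (Fin r → Tup B)} (h : XGenDefinable X Γ p r S) : GenDefinable Γ p r S := by
  obtain ⟨Φ, hΓ, hΦ, _⟩ := h
  exact ⟨Φ (), hΓ (), hΦ ()⟩

/-- The parameter-free relations are definable. -/
theorem genDefinable_parameterFree {o : Option Ordinal.{0}} (ho : ∀ α ∈ o, 1 ≤ α) {b : Fin m → B}
    {D : (Fin m → B) → Set (Tup B)} {F : Set (Fin 4 → Tup B)}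
    {r : ℕ} {S : (Fin m → B) → Set (Fin r → Tup B)}
    (hD : Equivariant L fun c => {x : Fin 1 → Tup B | x 0 ∈ D c}) (hS : Equivariant L S)
    (hOdef : SetDefinable (sigmaClass L o) (tupOrbit L b))
    (hFdef : GenDefinable (sigmaClass L o) ![] 4 F)
    (hDdef : GenDefinable (sigmaClass L o) b 1 {x | x 0 ∈ D b})
    (hSdef : GenDefinable (sigmaClass L o) b r (S b)) :
    GenDefinable (sigmaClass L o) ![] r (parameterFree (tupOrbit L b) D F S) := by
  obtain ⟨φ, hφΓ, hφ⟩ := hOdef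
  obtain ⟨Φ, hΦΓ, hΦ⟩ := hFdef
  obtain ⟨Δ, hΔΓ, hΔ⟩ := hDdef
  obtain ⟨Ψ, hΨΓ, hΨ⟩ := hSdef
  -- An oracle that computes the four given formulas reduces the claim to its computable version.
  obtain ⟨X, hX⟩ := exists_xComputable_seq fun i =>
    [fun q : List ℕ × List ℕ => φ.label q.2, Φ.codedLabel, Δ.codedLabel,
      Ψ.codedLabel].getD i fun _ => 0
  exact XGenDefinable.genDefinable (X := X)
    (xGenDefinableFamily_parameterFree (X := X) (ι := Unit) (r := fun _ => r)
    (S := fun _ => S) ho hD (fun _ => hS)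
    ⟨φ, hφΓ, ComputableIn.comp_primrec (f := fun q : List ℕ × List ℕ => φ.label q.2) (hX 0)
      ((Primrec.const []).pair .id), hφ⟩
    (GenForm.xGenDefinable hΦΓ hΦ (hX 1)) (GenForm.xGenDefinable hΔΓ hΔ (hX 2))
    (GenForm.xGenDefinable hΨΓ hΨ (hX 3)))

end Oracle

/-! ### Finitary definability at fixed lengths -/

section Finitary

variable {L : FirstOrder.Language.{u, v}} {B : Type w} [L.Structure B] {m : ℕ}

theorem GenDefinable.definableAt {Γ : FormClass L} {p : Fin m → B} {r : ℕ}
    {S : Set (Fin r → Tup B)} (h : GenDefinable Γ p r S) (s : Fin r → ℕ) : DefinableAt Γ p s S := by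
  obtain ⟨Φ, hΓ, hΦ⟩ := h
  exact ⟨Φ s, hΓ s, fun y => hΦ _⟩

theorem Equivariant.mem_iff_realize_at {r : ℕ} {S : (Fin m → B) → Set (Fin r → Tup B)}
    (hS : Equivariant L S) {b : Fin m → B} {s : Fin r → ℕ} {φ : InfForm L (m + ∑ j, s j)}
    (h : ∀ y : ∀ j, Fin (s j) → B, (fun j => (⟨s j, y j⟩ : Tup B)) ∈ S b ↔
      φ.Realize (Fin.append b (concat y))) {c : Fin m → B} (hc : c ∈ tupOrbit L b)
    (y : ∀ j, Fin (s j) → B) : (fun j => (⟨s j, y j⟩ : Tup B)) ∈ S c ↔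
      φ.Realize (Fin.append c (concat y)) := by
  obtain ⟨σ, rfl⟩ := mem_tupOrbit_iff.1 hc
  have hy : y = fun j => σ ∘ (σ.symm ∘ y j) := by
    funext j i; simp
  have h1 := hS σ b fun j => ⟨s j, σ.symm ∘ y j⟩
  have h2 : (fun j => Tup.map σ ⟨s j, σ.symm ∘ y j⟩) = fun j => (⟨s j, y j⟩ : Tup B) := by
    conv_rhs => rw [hy]
    rfl
  rw [h2, h] at h1
  rw [← h1, ← InfForm.realize_equiv σ, comp_append, comp_concat, ← hy]

/-- The lengths are compared by a propositional equality because the tail of a tuple of length `n +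
m` has length `n + m - m`, which is not `n` by definition. -/
theorem exists_finitary_rename {r M : ℕ} {S : (Fin m → B) → Set (Fin r → Tup B)}
    {O : Set (Fin m → B)} {s : Fin r → ℕ} {φ : InfForm L (m + ∑ j, s j)} (hfin : φ.IsFinitary)
    (h : ∀ c ∈ O, ∀ y : ∀ j, Fin (s j) → B, (fun j => (⟨s j, y j⟩ : Tup B)) ∈ S c ↔
      φ.Realize (Fin.append c (concat y))) (p : Fin m → Fin M) (x : Fin r → Tup (Fin M))
    (hx : ∀ j, s j = (x j).1) : ∃ φ' : InfForm L M, φ'.IsFinitary ∧ ∀ V : Fin M → B, V ∘ p ∈ O →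
      ((fun j => (x j).map V) ∈ S (V ∘ p) ↔ φ'.Realize V) := by
  obtain rfl : s = fun j => (x j).1 := funext hx
  refine ⟨φ.rename (Fin.append p (concat fun j => (x j).2)), hfin.rename _, fun V hV => ?_⟩
  rw [realize_rename, comp_append, comp_concat]
  exact h _ hV fun j => V ∘ (x j).2

/-- The parameter-free relations are definable by finitary formulas. -/
theorem definableAt_parameterFree {b : Fin m → B} {D : (Fin m → B) → Set (Tup B)}
    {F : Set (Fin 4 → Tup B)} {r n : ℕ} {S : (Fin m → B) → Set (Fin r → Tup B)}
    (hD : Equivariant L fun c => {x : Fin 1 → Tup B | x 0 ∈ D c}) (hS : Equivariant L S)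
    (hSn : ∀ c ∈ tupOrbit L b, ∀ y ∈ S c, ∀ j, (y j).1 = n)
    (hOdef : SetDefinable (finitaryForms L) (tupOrbit L b))
    (hFdef : DefinableAt (finitaryForms L) ![] ![m, m, n, n] F)
    (hDdef : DefinableAt (finitaryForms L) b (fun _ => n) {x : Fin 1 → Tup B | x 0 ∈ D b})
    (hSdef : DefinableAt (finitaryForms L) b (fun _ => n) (S b)) :
    DefinableAt (finitaryForms L) ![] (fun _ => n + m)
      (parameterFree (tupOrbit L b) D F S) := by
  obtain ⟨φ, hφΓ, hφ⟩ := hOdef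
  obtain ⟨Φ, hΦΓ, hΦ⟩ := hFdef
  obtain ⟨Δ, hΔΓ, hΔ⟩ := hDdef
  obtain ⟨Ψ, hΨΓ, hΨ⟩ := hSdef
  let z := tupVars (r := r) (fun _ => n + m) (fun _ => n) m
  let e := paramVars (r := r) (fun _ => n + m) (fun _ => n) m
  let y := auxVars (r := r) (fun _ => n + m) (fun _ => n) m
  have hm : ∀ j, m ≤ (z j).1 := fun _ => Nat.le_add_left _ _
  obtain ⟨ψ, hψ, eψ⟩ := exists_finitary_rename (O := tupOrbit L b) hΨΓ
    (fun c hc => hS.mem_iff_realize_at hΨ hc) e y fun _ => rfl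
  have h1 := fun j => exists_finitary_rename (O := tupOrbit L b) hΔΓ
    (fun c hc => hD.mem_iff_realize_at hΔ hc) ((z j).head m (hm j)) ![(z j).tail m]
    (by intro k; fin_cases k; exact (Nat.add_sub_cancel n m).symm)
  choose δ hδ eδ using h1
  have h2 := fun j => exists_finitary_rename (O := Set.univ) (S := fun _ => F) hΦΓ
    (fun c _ y => by rw [Subsingleton.elim c (![] : Fin 0 → B)]; exact hΦ y) ![]
    ![⟨m, (z j).head m (hm j)⟩, ⟨m, e⟩, (z j).tail m, y j]
    (by intro k; fin_cases k <;> first | rfl | exact (Nat.add_sub_cancel n m).symm)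
  choose θ hθ eθ using h2
  -- With all auxiliary tuples of length `n`, one finite block of quantifiers and finitely many
  -- conjuncts suffice.
  refine ⟨exs _ (and ψ (and (φ.rename e) (finAnd fun j =>
    and (φ.rename ((z j).head m (hm j))) (and (δ j) (θ j))))), IsFinitary.exs _
    ⟨hψ, hφΓ.rename _, isFinitary_finAnd _ fun j => ⟨hφΓ.rename _, hδ j, hθ j⟩⟩, fun x => ?_⟩
  rw [realize_exs]
  have key : ∀ (c : Fin m → B) (w : Fin r → Fin n → B),
      (and ψ (and (φ.rename e) (finAnd fun j => and (φ.rename ((z j).head m (hm j)))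
        (and (δ j) (θ j))))).Realize (Fin.append (Fin.append ![] (concat x))
          (Fin.append c (concat w))) ↔
      c ∈ tupOrbit L b ∧ (fun j => (⟨n, w j⟩ : Tup B)) ∈ S c ∧ ∀ j,
        ∃ h : m ≤ n + m, Tup.head m ⟨n + m, x j⟩ h ∈ tupOrbit L b ∧
        Tup.tail m ⟨n + m, x j⟩ ∈ D (Tup.head m ⟨n + m, x j⟩ h) ∧
        ![⟨m, Tup.head m ⟨n + m, x j⟩ h⟩, ⟨m, c⟩, Tup.tail m ⟨n + m, x j⟩, ⟨n, w j⟩] ∈ F := by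
    intro c w
    set V := Fin.append (Fin.append ![] (concat x)) (Fin.append c (concat w)) with hV
    have he : V ∘ e = c := append_comp_paramVars _ _ _
    have hy : ∀ j, (y j).map V = ⟨n, w j⟩ := map_auxVars _ _ _
    have hz : ∀ j, (z j).map V = ⟨n + m, x j⟩ := map_tupVars _ _ _
    have hhd : ∀ j, V ∘ (z j).head m (hm j) = Tup.head m ⟨n + m, x j⟩ (hm j) := fun j => by
      obtain ⟨_, h2⟩ := Sigma.mk.inj_iff.1 (hz j)
      exact funext fun i => congrFun (eq_of_heq h2) (Fin.castLE (hm j) i)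
    have htl : ∀ j, ((z j).tail m).map V = Tup.tail m ⟨n + m, x j⟩ := fun j => by
      rw [← hz]; rfl
    simp only [Realize, realize_finAnd, realize_rename, he, hhd, ← hφ]
    rw [and_left_comm]
    refine and_congr_right fun hc => and_congr ?_ (forall_congr' fun j => ?_)
    · rw [← eψ V (he.symm ▸ hc), he]
      simp only [hy]
    · refine Iff.trans ?_ (exists_prop_of_true (p := m ≤ n + m) (hm j)).symm
      refine and_congr_right fun hcj => and_congr ?_ ?_
      · rw [← eδ j V (by rw [hhd]; exact hcj), hhd]
        exact iff_of_eq (congrArg (· ∈ D (Tup.head m ⟨n + m, x j⟩ (hm j))) (htl j))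
      · rw [← eθ j V trivial, Tup.map_vec_four, htl, hy, ← hhd, ← he]
        rfl
  constructor
  · rintro ⟨c, hc, w, hw, hj⟩
    obtain ⟨w', rfl⟩ := Tup.exists_eq_mk (k := fun _ => n) fun j => (hSn c hc w hw j).symm
    exact ⟨_, (key c w').2 ⟨hc, hw, hj⟩⟩
  · rintro ⟨V, hV⟩
    obtain ⟨c, w, rfl⟩ := exists_append_concat V
    obtain ⟨hc, hw, hj⟩ := (key c w).1 hV
    exact ⟨c, hc, _, hw, hj⟩

end Finitary

/-! ### Splitting tuples and transport along automorphisms -/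

section Tup

variable {B : Type w}

theorem Tup.ext_cast {k k' : ℕ} {g : Fin k' → B} {y : Fin k → B} (h : k' = k)
    (hg : ∀ i, g i = y (Fin.cast h i)) : (⟨k', g⟩ : Tup B) = ⟨k, y⟩ := by
  subst h
  exact congrArg _ (funext hg)

theorem Tup.tail_append {m k : ℕ} (c : Fin m → B) (y : Fin k → B) :
    Tup.tail m ⟨m + k, Fin.append c y⟩ = ⟨k, y⟩ := by
  refine Tup.ext_cast (Nat.add_sub_cancel_left m k) fun i => ?_
  exact Fin.append_right c y (Fin.cast (Nat.add_sub_cancel_left m k) i)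

theorem Tup.head_append {m k : ℕ} (c : Fin m → B) (y : Fin k → B) (h : m ≤ m + k) :
    Tup.head m ⟨m + k, Fin.append c y⟩ h = c :=
  funext fun i => Fin.append_left c y i

theorem Tup.exists_map_eq {L : FirstOrder.Language.{u, v}} [L.Structure B] (σ : B ≃[L] B)
    (x : Tup B) : ∃ y : Tup B, y.map σ = x :=
  ⟨x.map σ.symm, Sigma.ext rfl (heq_of_eq (funext fun i => σ.apply_symm_apply (x.2 i)))⟩

end Tup

section Transport

variable {L : FirstOrder.Language.{u, v}} {LA : FirstOrder.Language.{u', v'}}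
  {B : Type w} [L.Structure B] {m : ℕ} (I : InterpForms LA L m) (σ : B ≃[L] B) (c : Fin m → B)

theorem InterpForms.dom_map (x : Tup B) :
    x.map σ ∈ (I.at (σ ∘ c)).dom ↔ x ∈ (I.at c).dom := by
  refine Iff.trans ?_ (I.dom.realize_equiv σ c ![x])
  rw [Tup.map_vec_one]; rfl

theorem InterpForms.eqv_map (x y : Tup B) :
    (I.at (σ ∘ c)).eqv (x.map σ) (y.map σ) ↔ (I.at c).eqv x y := by
  refine Iff.trans ?_ (I.eqv.realize_equiv σ c ![x, y])
  rw [Tup.map_vec_two]; rfl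

theorem InterpForms.rel_map {k : ℕ} (R : LA.Relations k) (x : Fin k → Tup B) :
    (fun j => (x j).map σ) ∈ (I.at (σ ∘ c)).rel R ↔ x ∈ (I.at c).rel R :=
  (I.rel R).realize_equiv σ c x

theorem InterpForms.equivariant_dom (I : InterpForms LA L m) :
    Equivariant L fun c => {x : Fin 1 → Tup B | x 0 ∈ (I.at c).dom} :=
  fun σ c x => (I.dom_map σ c (x 0)).symm

theorem InterpForms.equivariant_eqv (I : InterpForms LA L m) :
    Equivariant L fun c : Fin m → B => (I.at c).eqvRel :=
  fun σ c x => (I.eqv_map σ c (x 0) (x 1)).symm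

theorem InterpForms.equivariant_neqv (I : InterpForms LA L m) :
    Equivariant L fun c : Fin m → B => (I.at c).neqvRel :=
  fun σ c x => (and_congr (I.dom_map σ c (x 0)) (and_congr (I.dom_map σ c (x 1))
    (not_congr (I.eqv_map σ c (x 0) (x 1))))).symm

theorem InterpForms.equivariant_rel (I : InterpForms LA L m) {k : ℕ} (R : LA.Relations k) :
    Equivariant L fun c : Fin m → B => (I.at c).rel R :=
  fun σ c x => (I.rel_map σ c R x).symm

theorem InterpForms.equivariant_nrel (I : InterpForms LA L m) {k : ℕ} (R : LA.Relations k) :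
    Equivariant L fun c : Fin m → B => (I.at c).nrel R :=
  fun σ c x => (and_congr (forall_congr' fun j => I.dom_map σ c (x j))
    (not_congr (I.rel_map σ c R x))).symm

/-- `≡` is an equivalence relation on `D`, and the `R*` are relations on `D` that respect `≡`. -/
structure TupPresentation.IsCongruence (P : TupPresentation LA B) : Prop where
  eqv_dom : ∀ x y, P.eqv x y → x ∈ P.dom ∧ y ∈ P.dom
  eqv_refl : ∀ x ∈ P.dom, P.eqv x x
  eqv_symm : ∀ x y, P.eqv x y → P.eqv y x
  eqv_trans : ∀ x y z, P.eqv x y → P.eqv y z → P.eqv x z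
  rel_dom : ∀ (k : ℕ) (R : LA.Relations k), ∀ x ∈ P.rel R, ∀ j, x j ∈ P.dom
  rel_congr : ∀ (k : ℕ) (R : LA.Relations k) (x y : Fin k → Tup B),
    (∀ j, P.eqv (x j) (y j)) → x ∈ P.rel R → y ∈ P.rel R

theorem TupPresentation.Interprets.isCongruence [LA.IsRelational] {A : Type w'} [LA.Structure A]
    {P : TupPresentation LA B} (h : P.Interprets A) : P.IsCongruence :=
  ⟨h.eqv_dom, h.eqv_refl, h.eqv_symm, h.eqv_trans, h.rel_dom, h.rel_congr⟩

variable {I}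

/-- Every tuple is the image under `σ` of a tuple, and membership at `σ ∘ b` translates back to
membership at `b`. -/
theorem TupPresentation.IsCongruence.of_mem_tupOrbit {b : Fin m → B}
    (h : (I.at b).IsCongruence) {c : Fin m → B} (hc : c ∈ tupOrbit L b) :
    (I.at c).IsCongruence := by
  obtain ⟨σ, rfl⟩ := mem_tupOrbit_iff.1 hc
  have hs : ∀ x : Tup B, ∃ y : Tup B, y.map σ = x := Tup.exists_map_eq σ
  have hs' : ∀ {k : ℕ} (x : Fin k → Tup B), ∃ y : Fin k → Tup B, (fun j => (y j).map σ) = x :=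
    fun x => ⟨fun j => (hs (x j)).choose, funext fun j => (hs (x j)).choose_spec⟩
  constructor
  · intro x y
    obtain ⟨x, rfl⟩ := hs x
    obtain ⟨y, rfl⟩ := hs y
    simpa only [I.eqv_map, I.dom_map] using h.eqv_dom x y
  · intro x
    obtain ⟨x, rfl⟩ := hs x
    simpa only [I.eqv_map, I.dom_map] using h.eqv_refl x
  · intro x y
    obtain ⟨x, rfl⟩ := hs x
    obtain ⟨y, rfl⟩ := hs y
    simpa only [I.eqv_map, I.dom_map] using h.eqv_symm x y
  · intro x y z
    obtain ⟨x, rfl⟩ := hs x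
    obtain ⟨y, rfl⟩ := hs y
    obtain ⟨z, rfl⟩ := hs z
    simpa only [I.eqv_map, I.dom_map] using h.eqv_trans x y z
  · intro k R x
    obtain ⟨x, rfl⟩ := hs' x
    simpa only [I.rel_map, I.dom_map] using h.rel_dom k R x
  · intro k R x y
    obtain ⟨x, rfl⟩ := hs' x
    obtain ⟨y, rfl⟩ := hs' y
    simpa only [I.eqv_map, I.rel_map] using h.rel_congr k R x y

theorem TupPresentation.DomIn.of_mem_tupOrbit {n : ℕ} {b : Fin m → B} (h : (I.at b).DomIn n)
    {c : Fin m → B} (hc : c ∈ tupOrbit L b) : (I.at c).DomIn n := by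
  obtain ⟨σ, rfl⟩ := mem_tupOrbit_iff.1 hc
  intro x hx
  obtain ⟨y, rfl⟩ := Tup.exists_map_eq σ x
  exact h y ((I.dom_map σ b y).1 hx)

/-- The quotient is taken by an arbitrary relation; since this one is already an equivalence on the
domain, the generated equivalence adds nothing. -/
theorem TupPresentation.IsCongruence.cls_eq_iff {P : TupPresentation LA B} (h : P.IsCongruence)
    (x y : P.dom) : P.cls x = P.cls y ↔ P.eqv x y := by
  refine ⟨fun hxy => ?_, fun hxy => Quot.sound hxy⟩
  have he : Equivalence fun x y : P.dom => P.eqv x y :=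
    ⟨fun x => h.eqv_refl _ x.2, fun hxy => h.eqv_symm _ _ hxy,
      fun hxy hyz => h.eqv_trans _ _ _ hxy hyz⟩
  exact he.eqvGen_iff.1 (Quot.eqvGen_exact hxy)

theorem TupPresentation.IsCongruence.relMap_cls_iff [LA.IsRelational] {P : TupPresentation LA B}
    (h : P.IsCongruence) {k : ℕ} (R : LA.Relations k) (y : Fin k → P.dom) :
    FirstOrder.Language.Structure.RelMap R (fun j => P.cls (y j)) ↔
      (fun j => (y j : Tup B)) ∈ P.rel R :=
  ⟨fun ⟨_, hx, hR⟩ => h.rel_congr k R _ _ (fun j => (h.cls_eq_iff _ _).1 (hx j)) hR,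
    fun hR => ⟨y, fun _ => rfl, hR⟩⟩

/-- The parameter-free presentation. -/
def InterpForms.parameterFree (I : InterpForms LA L m) (b : Fin m → B)
    (F : Set (Fin 4 → Tup B)) : TupPresentation LA B where
  dom := {z | ![z] ∈ _root_.parameterFree (tupOrbit L b) (fun c => (I.at c).dom) F
    fun c => (I.at c).domRel}
  eqv z w := ![z, w] ∈ _root_.parameterFree (tupOrbit L b) (fun c => (I.at c).dom) F
    fun c => (I.at c).eqvRel
  rel R := _root_.parameterFree (tupOrbit L b) (fun c => (I.at c).dom) F fun c => (I.at c).rel R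

theorem domRel_parameterFree (I : InterpForms LA L m) (b : Fin m → B) (F : Set (Fin 4 → Tup B)) :
    (I.parameterFree b F).domRel =
      parameterFree (tupOrbit L b) (fun c => (I.at c).dom) F fun c => (I.at c).domRel := by
  ext x
  have : x = ![x 0] := by funext j; fin_cases j; rfl
  conv_rhs => rw [this]
  rfl

theorem eqvRel_parameterFree (I : InterpForms LA L m) (b : Fin m → B) (F : Set (Fin 4 → Tup B)) :
    (I.parameterFree b F).eqvRel =
      parameterFree (tupOrbit L b) (fun c => (I.at c).dom) F fun c => (I.at c).eqvRel := by
  ext x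
  have : x = ![x 0, x 1] := by funext j; fin_cases j <;> rfl
  conv_rhs => rw [this]
  rfl

end Transport

/-! ### The parameter-free presentation and its quotient -/

section Coherent

variable {L : FirstOrder.Language.{u, v}} {LA : FirstOrder.Language.{u', v'}} [LA.IsRelational]
  {B : Type w} [L.Structure B] {m : ℕ}

/-- A coherent family of isomorphisms, defined by `F`, between the structures that are interpreted
with the parameters in the orbit of `b`. -/
structure CoherentIso (I : InterpForms LA L m) (b : Fin m → B) (F : Set (Fin 4 → Tup B)) where
  f : ∀ c d : tupOrbit L b, (I.at c.1).Carrier ≃[LA] (I.at d.1).Carrier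
  isCongruence : (I.at b).IsCongruence
  spec : ∀ (c d : tupOrbit L b) (x : (I.at c.1).dom) (y : (I.at d.1).dom),
    f c d ((I.at c.1).cls x) = (I.at d.1).cls y ↔ ![⟨m, c.1⟩, ⟨m, d.1⟩, x.1, y.1] ∈ F
  id : ∀ (c : tupOrbit L b) (q : (I.at c.1).Carrier), f c c q = q
  comp : ∀ (c d e : tupOrbit L b) (q : (I.at c.1).Carrier), f d e (f c d q) = f c e q

theorem self_mem_tupOrbit (b : Fin m → B) : b ∈ tupOrbit L b :=
  ⟨FirstOrder.Language.Equiv.refl L B, fun _ => rfl⟩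

namespace CoherentIso

variable {I : InterpForms LA L m} {b : Fin m → B} {F : Set (Fin 4 → Tup B)}
  (C : CoherentIso I b F)

/-- The class of `x ∈ D_c`, moved to the structure with parameters `b`. -/
def toBase {c : Fin m → B} (hc : c ∈ tupOrbit L b) {x : Tup B} (hx : x ∈ (I.at c).dom) :
    (I.at b).Carrier :=
  C.f ⟨c, hc⟩ ⟨b, self_mem_tupOrbit b⟩ ((I.at c).cls ⟨x, hx⟩)

/-- By coherence `x` may be moved to `b` by way of `d`; injectivity of the last step leaves the
equality of `f_{c,d}([x])` and `[y]`, which is what `F` expresses. -/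
theorem toBase_eq_iff {c d : Fin m → B} (hc : c ∈ tupOrbit L b) (hd : d ∈ tupOrbit L b)
    {x y : Tup B} (hx : x ∈ (I.at c).dom) (hy : y ∈ (I.at d).dom) :
    C.toBase hc hx = C.toBase hd hy ↔ ![⟨m, c⟩, ⟨m, d⟩, x, y] ∈ F := by
  rw [← C.spec ⟨c, hc⟩ ⟨d, hd⟩ ⟨x, hx⟩ ⟨y, hy⟩, toBase, toBase, ← C.comp ⟨c, hc⟩ ⟨d, hd⟩]
  exact (C.f ⟨d, hd⟩ _).injective.eq_iff

theorem toBase_eq_iff_eqv {c : Fin m → B} (hc : c ∈ tupOrbit L b)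
    {x y : Tup B} (hx : x ∈ (I.at c).dom) (hy : y ∈ (I.at c).dom) :
    C.toBase hc hx = C.toBase hc hy ↔ (I.at c).eqv x y :=
  (C.f ⟨c, hc⟩ _).injective.eq_iff.trans
    ((C.isCongruence.of_mem_tupOrbit hc).cls_eq_iff ⟨x, hx⟩ ⟨y, hy⟩)

theorem toBase_congr {c d : Fin m → B} (hc : c ∈ tupOrbit L b) (hd : d ∈ tupOrbit L b)
    {x y : Tup B} (hx : x ∈ (I.at c).dom) (hy : y ∈ (I.at d).dom) (hcd : c = d) (hxy : x = y) :
    C.toBase hc hx = C.toBase hd hy := by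
  subst hcd hxy; rfl

theorem toBase_self {x : Tup B} (hx : x ∈ (I.at b).dom) :
    C.toBase (self_mem_tupOrbit b) hx = (I.at b).cls ⟨x, hx⟩ :=
  C.id _ _

theorem relMap_toBase_iff {c : Fin m → B} (hc : c ∈ tupOrbit L b) {k : ℕ} (R : LA.Relations k)
    {y : Fin k → Tup B} (hy : ∀ j, y j ∈ (I.at c).dom) :
    FirstOrder.Language.Structure.RelMap R (fun j => C.toBase hc (hy j)) ↔ y ∈ (I.at c).rel R :=
  ((C.f ⟨c, hc⟩ _).map_rel R fun j => (I.at c).cls ⟨y j, hy j⟩).trans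
    ((C.isCongruence.of_mem_tupOrbit hc).relMap_cls_iff R fun j => ⟨y j, hy j⟩)

/-- The tuples `(c, x)` with `c` in the orbit of `b` and `x ∈ D_c`. -/
def IsPoint (I : InterpForms LA L m) (b : Fin m → B) (z : Tup B) : Prop :=
  ∃ h : m ≤ z.1, z.head m h ∈ tupOrbit L b ∧ z.tail m ∈ (I.at (z.head m h)).dom

/-- The element of the structure with parameters `b` that `(c, x)` stands for. -/
def point {z : Tup B} (hz : IsPoint I b z) : (I.at b).Carrier :=
  C.toBase hz.choose_spec.1 hz.choose_spec.2

/-- If the relations `S e` all describe one relation `Q` on the quotient at `b`, the pullback is the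
preimage of `Q` under `point`. The `F` conditions say that the point `z j` and the class of `y j`
agree at `b`. -/
theorem mem_parameterFree_iff {r : ℕ} {S : (Fin m → B) → Set (Fin r → Tup B)}
    {Q : Set (Fin r → (I.at b).Carrier)}
    (hS : ∀ (e : Fin m → B) (he : e ∈ tupOrbit L b) (y : Fin r → Tup B), y ∈ S e ↔
      ∃ h : ∀ j, y j ∈ (I.at e).dom, (fun j => C.toBase he (h j)) ∈ Q) (z : Fin r → Tup B) :
    z ∈ parameterFree (tupOrbit L b) (fun c => (I.at c).dom) F S ↔
      ∃ h : ∀ j, IsPoint I b (z j), (fun j => C.point (h j)) ∈ Q := by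
  constructor
  · rintro ⟨e, he, y, hy, hz⟩
    obtain ⟨hyD, hyQ⟩ := (hS e he y).1 hy
    refine ⟨fun j => (hz j).imp fun _ h => ⟨h.1, h.2.1⟩, ?_⟩
    convert hyQ using 2 with j
    obtain ⟨h, h1, h2, h3⟩ := hz j
    exact (C.toBase_eq_iff h1 he h2 (hyD j)).2 h3
  · rintro ⟨h, hQ⟩
    have hex : ∀ j, ∃ y : (I.at b).dom, (I.at b).cls y = C.point (h j) := fun j =>
      Quot.exists_rep _
    choose y hy using hex
    have hy' : ∀ j, C.toBase (self_mem_tupOrbit b) (y j).2 = C.point (h j) := fun j =>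
      (C.toBase_self _).trans (hy j)
    -- Conversely, `b` itself serves as `e`, and representatives of the points serve as `y`.
    refine ⟨b, self_mem_tupOrbit b, fun j => y j, (hS b (self_mem_tupOrbit b) _).2
      ⟨fun j => (y j).2, by simpa only [hy'] using hQ⟩, fun j => ?_⟩
    obtain ⟨hm, h1, h2⟩ := h j
    exact ⟨hm, h1, h2, (C.toBase_eq_iff h1 (self_mem_tupOrbit b) h2 (y j).2).1 (hy' j).symm⟩

theorem mem_domRel_iff (e : Fin m → B) (he : e ∈ tupOrbit L b) (y : Fin 1 → Tup B) :
    y ∈ {x : Fin 1 → Tup B | x 0 ∈ (I.at e).dom} ↔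
      ∃ h : ∀ j, y j ∈ (I.at e).dom, (fun j => C.toBase he (h j)) ∈ Set.univ := by
  simp [Fin.forall_fin_one]

theorem mem_eqvRel_iff (e : Fin m → B) (he : e ∈ tupOrbit L b) (y : Fin 2 → Tup B) :
    y ∈ (I.at e).eqvRel ↔ ∃ h : ∀ j, y j ∈ (I.at e).dom,
      (fun j => C.toBase he (h j)) ∈ {q : Fin 2 → (I.at b).Carrier | q 0 = q 1} := by
  simp only [Set.mem_ofPred_eq, toBase_eq_iff_eqv, exists_prop, Fin.forall_fin_two]
  exact ⟨fun h => ⟨(C.isCongruence.of_mem_tupOrbit he).eqv_dom _ _ h, h⟩, fun h => h.2⟩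

theorem mem_neqvRel_iff (e : Fin m → B) (he : e ∈ tupOrbit L b) (y : Fin 2 → Tup B) :
    y ∈ (I.at e).neqvRel ↔ ∃ h : ∀ j, y j ∈ (I.at e).dom,
      (fun j => C.toBase he (h j)) ∈ {q : Fin 2 → (I.at b).Carrier | q 0 ≠ q 1} := by
  simp only [Set.mem_ofPred_eq, ne_eq, toBase_eq_iff_eqv, exists_prop, Fin.forall_fin_two,
    and_assoc]
  rfl

theorem mem_rel_iff {k : ℕ} (R : LA.Relations k) (e : Fin m → B) (he : e ∈ tupOrbit L b)
    (y : Fin k → Tup B) : y ∈ (I.at e).rel R ↔ ∃ h : ∀ j, y j ∈ (I.at e).dom,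
      (fun j => C.toBase he (h j)) ∈ {q : Fin k → (I.at b).Carrier |
        FirstOrder.Language.Structure.RelMap R q} := by
  simp only [Set.mem_ofPred_eq, relMap_toBase_iff, exists_prop]
  exact ⟨fun h => ⟨(C.isCongruence.of_mem_tupOrbit he).rel_dom _ _ _ h, h⟩, fun h => h.2⟩

theorem mem_nrel_iff {k : ℕ} (R : LA.Relations k) (e : Fin m → B) (he : e ∈ tupOrbit L b)
    (y : Fin k → Tup B) : y ∈ (I.at e).nrel R ↔ ∃ h : ∀ j, y j ∈ (I.at e).dom,
      (fun j => C.toBase he (h j)) ∈ {q : Fin k → (I.at b).Carrier |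
        ¬ FirstOrder.Language.Structure.RelMap R q} := by
  simp only [Set.mem_ofPred_eq, relMap_toBase_iff, exists_prop]
  rfl

theorem mem_dom_iff (C : CoherentIso I b F) (z : Tup B) :
    z ∈ (I.parameterFree b F).dom ↔ IsPoint I b z := by
  refine (C.mem_parameterFree_iff C.mem_domRel_iff ![z]).trans ?_
  simp

theorem eqv_iff (C : CoherentIso I b F) (z w : Tup B) : (I.parameterFree b F).eqv z w ↔
    ∃ (hz : IsPoint I b z) (hw : IsPoint I b w), C.point hz = C.point hw := by
  refine (C.mem_parameterFree_iff C.mem_eqvRel_iff ![z, w]).trans ?_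
  exact ⟨fun ⟨h, h'⟩ => ⟨h 0, h 1, h'⟩, fun ⟨h, h', e⟩ => ⟨Fin.forall_fin_two.2 ⟨h, h'⟩, e⟩⟩

theorem parameterFree_rel_iff (C : CoherentIso I b F) {k : ℕ} (R : LA.Relations k)
    (z : Fin k → Tup B) :
    z ∈ (I.parameterFree b F).rel R ↔ ∃ h : ∀ j, IsPoint I b (z j),
      FirstOrder.Language.Structure.RelMap R fun j => C.point (h j) :=
  C.mem_parameterFree_iff (C.mem_rel_iff R) z

/-- Taking preimages under `point` commutes with complements, so the complement has a positive
definition in terms of `F` as well. -/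
theorem neqvRel_eq (C : CoherentIso I b F) : (I.parameterFree b F).neqvRel =
    parameterFree (tupOrbit L b) (fun c => (I.at c).dom) F fun c => (I.at c).neqvRel := by
  ext x
  refine Iff.trans ?_ (C.mem_parameterFree_iff C.mem_neqvRel_iff x).symm
  simp only [TupPresentation.neqvRel, Set.mem_ofPred_eq, C.mem_dom_iff, C.eqv_iff]
  exact ⟨fun ⟨h0, h1, h⟩ => ⟨Fin.forall_fin_two.2 ⟨h0, h1⟩, fun e => h ⟨h0, h1, e⟩⟩,
    fun ⟨h, h'⟩ => ⟨h 0, h 1, fun ⟨_, _, e⟩ => h' e⟩⟩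

theorem nrel_eq (C : CoherentIso I b F) {k : ℕ} (R : LA.Relations k) :
    (I.parameterFree b F).nrel R =
      parameterFree (tupOrbit L b) (fun c => (I.at c).dom) F fun c => (I.at c).nrel R := by
  ext x
  refine Iff.trans ?_ (C.mem_parameterFree_iff (C.mem_nrel_iff R) x).symm
  simp only [TupPresentation.nrel, Set.mem_ofPred_eq, C.mem_dom_iff, C.parameterFree_rel_iff]
  exact ⟨fun ⟨h, h'⟩ => ⟨h, fun e => h' ⟨h, e⟩⟩, fun ⟨h, h'⟩ => ⟨h, fun ⟨_, e⟩ => h' e⟩⟩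

/-- The class of `y` at `b` is the point of the tuple `(b, y)`. -/
theorem exists_point_eq (C : CoherentIso I b F) (q : (I.at b).Carrier) :
    ∃ (z : Tup B) (hz : IsPoint I b z), C.point hz = q := by
  obtain ⟨⟨y, hy⟩, rfl⟩ := Quot.exists_rep q
  have h1 : Tup.head m ⟨m + y.1, Fin.append b y.2⟩ (Nat.le_add_right m y.1) = b :=
    Tup.head_append b y.2 _
  have h2 : Tup.tail m ⟨m + y.1, Fin.append b y.2⟩ = y := Tup.tail_append b y.2
  refine ⟨⟨m + y.1, Fin.append b y.2⟩, ⟨Nat.le_add_right m y.1, ?_, ?_⟩, ?_⟩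
  · rw [h1]; exact self_mem_tupOrbit b
  · rw [h1, h2]; exact hy
  · exact (C.toBase_congr _ (self_mem_tupOrbit b) _ hy h1 h2).trans (C.toBase_self hy)

theorem isCongruence_parameterFree (C : CoherentIso I b F) :
    (I.parameterFree b F).IsCongruence where
  eqv_dom x y h := by
    obtain ⟨hx, hy, -⟩ := (C.eqv_iff x y).1 h
    exact ⟨(C.mem_dom_iff x).2 hx, (C.mem_dom_iff y).2 hy⟩
  eqv_refl x hx :=
    have h := (C.mem_dom_iff x).1 hx
    (C.eqv_iff x x).2 ⟨h, h, rfl⟩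
  eqv_symm x y h := by
    obtain ⟨hx, hy, h⟩ := (C.eqv_iff x y).1 h
    exact (C.eqv_iff y x).2 ⟨hy, hx, h.symm⟩
  eqv_trans x y z h h' := by
    obtain ⟨hx, hy, h⟩ := (C.eqv_iff x y).1 h
    obtain ⟨_, hz, h'⟩ := (C.eqv_iff y z).1 h'
    exact (C.eqv_iff x z).2 ⟨hx, hz, h.trans h'⟩
  rel_dom k R x h j := (C.mem_dom_iff _).2 (((C.parameterFree_rel_iff R x).1 h).choose j)
  rel_congr k R x y hxy h := by
    obtain ⟨hx, h⟩ := (C.parameterFree_rel_iff R x).1 h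
    refine (C.parameterFree_rel_iff R y).2
      ⟨fun j => ((C.eqv_iff _ _).1 (hxy j)).choose_spec.choose, ?_⟩
    convert h using 2 with j
    exact ((C.eqv_iff _ _).1 (hxy j)).choose_spec.choose_spec.symm

/-- The map of the parameter-free quotient to the structure with parameters `b`. -/
def fromParameterFree (C : CoherentIso I b F) :
    (I.parameterFree b F).Carrier → (I.at b).Carrier :=
  Quot.lift (fun x => C.point ((C.mem_dom_iff _).1 x.2))
    fun _ _ h => ((C.eqv_iff _ _).1 h).choose_spec.choose_spec

theorem bijective_fromParameterFree (C : CoherentIso I b F) :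
    Function.Bijective C.fromParameterFree := by
  constructor
  · rintro ⟨x⟩ ⟨y⟩ h
    exact Quot.sound ((C.eqv_iff _ _).2 ⟨(C.mem_dom_iff _).1 x.2, (C.mem_dom_iff _).1 y.2, h⟩)
  · intro q
    obtain ⟨z, hz, rfl⟩ := C.exists_point_eq q
    exact ⟨(I.parameterFree b F).cls ⟨z, (C.mem_dom_iff z).2 hz⟩, rfl⟩

theorem nonempty_equiv (C : CoherentIso I b F) :
    Nonempty ((I.parameterFree b F).Carrier ≃[LA] (I.at b).Carrier) := by
  refine ⟨⟨Equiv.ofBijective _ C.bijective_fromParameterFree, fun g => isEmptyElim g,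
    fun {k} R q => ?_⟩⟩
  choose y hy using fun j => Quot.exists_rep (q j)
  obtain rfl : (fun j => (I.parameterFree b F).cls (y j)) = q := funext hy
  rw [C.isCongruence_parameterFree.relMap_cls_iff, C.parameterFree_rel_iff]
  exact ⟨fun h => ⟨fun j => (C.mem_dom_iff _).1 (y j).2, h⟩, fun ⟨_, h⟩ => h⟩

theorem interprets_parameterFree (C : CoherentIso I b F) {A : Type w'} [LA.Structure A]
    (h : Nonempty ((I.at b).Carrier ≃[LA] A)) : (I.parameterFree b F).Interprets A := by
  obtain ⟨e⟩ := C.nonempty_equiv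
  obtain ⟨e'⟩ := h
  have hc := C.isCongruence_parameterFree
  exact ⟨hc.eqv_dom, hc.eqv_refl, hc.eqv_symm, hc.eqv_trans, hc.rel_dom, hc.rel_congr,
    ⟨e'.comp e⟩⟩

theorem domIn_parameterFree (C : CoherentIso I b F) {n : ℕ} (h : (I.at b).DomIn n) :
    (I.parameterFree b F).DomIn (n + m) := by
  intro z hz
  obtain ⟨hm, hc, ht⟩ := (C.mem_dom_iff z).1 hz
  have : z.1 - m = n := h.of_mem_tupOrbit hc _ ht
  omega

end CoherentIso

end Coherent

/-! ### Back-and-forth and definability of orbits -/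

section Scott

variable {L : FirstOrder.Language.{u, v}} {B : Type w} [L.Structure B]

/-- The two tuples of coordinates of `g` satisfy the same formulas of `L_{ω₁ω}`. -/
def SameType (L : FirstOrder.Language.{u, v}) [L.Structure B] {k : ℕ} (g : Fin k → B × B) : Prop :=
  ∀ φ : InfForm L k, φ.Realize (fun i => (g i).1) ↔ φ.Realize fun i => (g i).2

theorem SameType.comp {k k' : ℕ} {g : Fin k → B × B} (h : SameType L g) (ρ : Fin k' → Fin k) :
    SameType L (g ∘ ρ) := fun φ => by
  have := h (φ.rename ρ)
  rwa [realize_rename, realize_rename] at this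

theorem SameType.of_range_subset {k k' : ℕ} {g : Fin k → B × B} (h : SameType L g)
    {g' : Fin k' → B × B} (hg : ∀ i, g' i ∈ Set.range g) : SameType L g' := by
  choose ρ hρ using hg
  obtain rfl : g ∘ ρ = g' := funext hρ
  exact h.comp ρ

theorem SameType.swap {k : ℕ} {g : Fin k → B × B} (h : SameType L g) :
    SameType L (Prod.swap ∘ g) := fun φ => (h φ).symm

/-- If every candidate `y` failed, each would be excluded by a formula true of `x`. The conjunction
of these countably many formulas is again a formula, and quantifying its last variable gives one
that distinguishes the given tuples. -/
theorem SameType.exists_snoc [Countable B] {k : ℕ} {g : Fin k → B × B} (h : SameType L g) (x : B) :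
    ∃ y, SameType L (Fin.snoc g (x, y) : Fin (k + 1) → B × B) := by
  by_contra hne
  have hsnoc : ∀ y, (fun i => ((Fin.snoc g (x, y) : Fin (k + 1) → B × B) i).1) =
      (Fin.snoc (fun i => (g i).1) x : Fin (k + 1) → B) ∧
      (fun i => ((Fin.snoc g (x, y) : Fin (k + 1) → B × B) i).2) =
      (Fin.snoc (fun i => (g i).2) y : Fin (k + 1) → B) := fun y => by
    constructor <;> funext i <;> refine Fin.lastCases ?_ (fun j => ?_) i <;> simp
  have hsep : ∀ y, ∃ φ : InfForm L (k + 1), φ.Realize (Fin.snoc (fun i => (g i).1) x) ∧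
      ¬ φ.Realize (Fin.snoc (fun i => (g i).2) y) := fun y => by
    obtain ⟨φ, hφ⟩ := not_forall.1 (not_exists.1 hne y)
    rw [(hsnoc y).1, (hsnoc y).2] at hφ
    by_cases h1 : φ.Realize (Fin.snoc (fun i => (g i).1) x)
    · exact ⟨φ, h1, fun h2 => hφ (iff_of_true h1 h2)⟩
    · exact ⟨φ.neg, h1, fun h2 => hφ (iff_of_false h1 h2)⟩
  choose φ h1 h2 using hsep
  have : Nonempty B := ⟨x⟩
  obtain ⟨e, he⟩ := exists_surjective_nat B
  obtain ⟨y, hy⟩ := (h (ex (iConj fun i => φ (e i)))).1 ⟨x, fun i => h1 (e i)⟩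
  obtain ⟨i, rfl⟩ := he y
  exact h2 (e i) (hy i)

/-- One step forth and, with the coordinates swapped, one step back. -/
theorem SameType.exists_extend [Countable B] {k : ℕ} {g : Fin k → B × B} (h : SameType L g)
    (x : B) : ∃ (k' : ℕ) (g' : Fin k' → B × B), SameType L g' ∧ Set.range g ⊆ Set.range g' ∧
      (∃ y, (x, y) ∈ Set.range g') ∧ ∃ y, (y, x) ∈ Set.range g' := by
  obtain ⟨y, hy⟩ := h.exists_snoc x
  obtain ⟨z, hz⟩ := hy.swap.exists_snoc x
  refine ⟨_, _, hz.swap, ?_, ⟨y, (Fin.last k).castSucc, ?_⟩, ⟨z, Fin.last _, ?_⟩⟩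
  · rintro _ ⟨i, rfl⟩
    exact ⟨i.castSucc.castSucc, by simp⟩
  · simp
  · simp

theorem exists_extension_chain [Countable B] {k : ℕ} {g : Fin k → B × B} (h : SameType L g) :
    ∃ R : Set (B × B), Set.range g ⊆ R ∧ (∀ x, ∃ y, (x, y) ∈ R) ∧ (∀ y, ∃ x, (x, y) ∈ R) ∧
      ∀ (l : ℕ) (p : Fin l → B × B), (∀ i, p i ∈ R) → SameType L p := by
  rcases isEmpty_or_nonempty B with hB | hB
  · exact ⟨Set.range g, subset_rfl, isEmptyElim, isEmptyElim, fun l p hp => h.of_range_subset hp⟩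
  obtain ⟨e, he⟩ := exists_surjective_nat B
  choose k' g' hg' hsub hl hr using fun (s : {g : Tup (B × B) // SameType L g.2}) (x : B) =>
    s.2.exists_extend x
  -- Stage `i` puts the `i`-th element into both the domain and the range.
  let G : ℕ → {g : Tup (B × B) // SameType L g.2} := fun n =>
    Nat.rec ⟨⟨k, g⟩, h⟩ (fun i s => ⟨⟨k' s (e i), g' s (e i)⟩, hg' s (e i)⟩) n
  have hmono : Monotone fun n => Set.range (G n).1.2 :=
    monotone_nat_of_le_succ fun n => hsub (G n) (e n)
  refine ⟨⋃ n, Set.range (G n).1.2, Set.subset_iUnion (fun n => Set.range (G n).1.2) 0, fun x => ?_,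
    fun y => ?_, fun l p hp => ?_⟩
  · obtain ⟨i, rfl⟩ := he x
    exact (hl (G i) (e i)).imp fun _ h => Set.mem_iUnion.2 ⟨i + 1, h⟩
  · obtain ⟨i, rfl⟩ := he y
    exact (hr (G i) (e i)).imp fun _ h => Set.mem_iUnion.2 ⟨i + 1, h⟩
  -- Finitely many pairs of the union already occur together at one stage.
  · choose n hn using fun i => Set.mem_iUnion.1 (hp i)
    exact (G (Finset.univ.sup n)).2.of_range_subset fun i =>
      hmono (Finset.le_sup (Finset.mem_univ i)) (hn i)

/-- The limit relation is the graph of a bijection because it preserves equality in both directions,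
and it is an isomorphism because it preserves the atomic formulas. -/
theorem exists_equiv_of_sameType [Countable B] {k : ℕ} {g : Fin k → B × B} (h : SameType L g) :
    ∃ σ : B ≃[L] B, ∀ i, σ (g i).1 = (g i).2 := by
  obtain ⟨R, hg, hl, hr, hR⟩ := exists_extension_chain h
  choose f hf using hl
  choose f' hf' using hr
  have key : ∀ {p q : B × B}, p ∈ R → q ∈ R → (p.1 = q.1 ↔ p.2 = q.2) := fun {p q} hp hq => by
    simpa [Realize] using hR 2 ![p, q] (Fin.forall_fin_two.2 ⟨hp, hq⟩)
      (equal (.var 0) (.var 1))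
  refine ⟨⟨⟨f, f', fun x => (key (hf' _) (hf x)).2 rfl, fun y => (key (hf _) (hf' y)).1 rfl⟩,
    fun {n} F x => ?_, fun {n} S x => ?_⟩, fun i => (key (hf _) (hg ⟨i, rfl⟩)).1 rfl⟩
  · have := hR (n + 1) (Fin.snoc (fun i => (x i, f (x i)))
        (Language.Structure.funMap F x, f (Language.Structure.funMap F x)))
      (fun i => by refine Fin.lastCases ?_ (fun j => ?_) i <;> simp [hf])
      (equal (.func F fun i => .var i.castSucc) (.var (Fin.last n)))
    simp only [Realize, Language.Term.realize_func, Language.Term.realize_var, Fin.snoc_castSucc,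
      Fin.snoc_last, true_iff] at this
    exact this.symm
  · exact (hR n (fun i => (x i, f (x i))) (fun i => hf _) (rel S fun i => .var i)).symm

/-- In a countable structure, the orbit of a tuple is definable by a formula of `L_{ω₁ω}`. -/
theorem setDefinable_tupOrbit [Countable B] {m : ℕ} (b : Fin m → B) :
    SetDefinable (allForms L) (tupOrbit L b) := by
  classical
  have hsep : ∀ c : Fin m → B, c ∉ tupOrbit L b →
      ∃ φ : InfForm L m, φ.Realize b ∧ ¬ φ.Realize c := by
    intro c hc
    obtain ⟨φ, hφ⟩ : ∃ φ : InfForm L m, ¬ (φ.Realize b ↔ φ.Realize c) :=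
      not_forall.1 fun h => hc (exists_equiv_of_sameType (g := fun i => (b i, c i)) h)
    by_cases hb : φ.Realize b
    · exact ⟨φ, hb, fun hc => hφ (iff_of_true hb hc)⟩
    · exact ⟨φ.neg, hb, fun hc => hφ (iff_of_false hb hc)⟩
  choose φ hb hc using hsep
  have : Nonempty (Fin m → B) := ⟨b⟩
  obtain ⟨e, he⟩ := exists_surjective_nat (Fin m → B)
  -- The conjunction runs over all tuples: one outside the orbit contributes a formula that is true
  -- of `b` and excludes it, one inside contributes a true formula.
  refine ⟨iConj fun i => if h : e i ∈ tupOrbit L b then falsum.neg else φ (e i) h, trivial,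
    fun c => ⟨fun hcb i => ?_, fun h => ?_⟩⟩
  · obtain ⟨σ, rfl⟩ := mem_tupOrbit_iff.1 hcb
    by_cases hi : e i ∈ tupOrbit L b
    · simp [hi, Realize]
    · simpa only [hi, dite_false, realize_equiv] using hb _ hi
  · obtain ⟨i, rfl⟩ := he c
    by_contra hi
    have := h i
    simp only [hi, dite_false] at this
    exact hc _ hi this

end Scott

/-! ### Assembling the theorem -/

section Main

variable {L : FirstOrder.Language.{u, v}} {LA : FirstOrder.Language.{u', v'}}
  {B : Type w} [L.Structure B] {m : ℕ} {I : InterpForms LA L m} {b : Fin m → B}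
  {F : Set (Fin 4 → Tup B)} {Q Q' : ∀ r : ℕ, Set (Fin r → Tup B) → Prop}

/-- The passage from `Q` at `b` to `Q'` of the pullback is treated abstractly, so one argument
serves the `Σ_α`, computable and finitary cases. Definability of the domain is a premise throughout
because `D` occurs in every pullback. -/
theorem each_parameterFree
    (h : Q 1 (I.at b).domRel → ∀ (r : ℕ) (S : (Fin m → B) → Set (Fin r → Tup B)),
      Equivariant L S → (∀ c ∈ tupOrbit L b, ∀ y ∈ S c, ∀ j, y j ∈ (I.at c).dom) → Q r (S b) →
      Q' r (parameterFree (tupOrbit L b) (fun c => (I.at c).dom) F S))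
    (hI : (I.at b).IsCongruence) (hQ : (I.at b).Each Q) : (I.parameterFree b F).Each Q' := by
  obtain ⟨h1, h2, h3⟩ := hQ
  refine ⟨?_, ?_, fun k R => h h1 k _ (I.equivariant_rel R)
    (fun c hc => (hI.of_mem_tupOrbit hc).rel_dom k R) (h3 k R)⟩
  · rw [domRel_parameterFree]
    exact h h1 1 _ I.equivariant_dom (fun c _ y hy => Fin.forall_fin_one.2 hy) h1
  · rw [eqvRel_parameterFree]
    exact h h1 2 _ I.equivariant_eqv (fun c hc y hy =>
      Fin.forall_fin_two.2 ((hI.of_mem_tupOrbit hc).eqv_dom _ _ hy)) h2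

theorem CoherentIso.eachPM_parameterFree [LA.IsRelational] (C : CoherentIso I b F)
    (h : Q 1 (I.at b).domRel → ∀ (r : ℕ) (S : (Fin m → B) → Set (Fin r → Tup B)),
      Equivariant L S → Q r (S b) →
      Q' r (parameterFree (tupOrbit L b) (fun c => (I.at c).dom) F S))
    (hQ : (I.at b).EachPM Q) : (I.parameterFree b F).EachPM Q' := by
  obtain ⟨h1, h2, h3⟩ := hQ
  refine ⟨each_parameterFree (fun h1 r S hS _ => h h1 r S hS) C.isCongruence h1, ?_,
    fun k R => ?_⟩
  · rw [C.neqvRel_eq]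
    exact h h1.1 2 _ I.equivariant_neqv h2
  · rw [C.nrel_eq]
    exact h h1.1 k _ (I.equivariant_nrel R) (h3 k R)

theorem InterpForms.each_genDefinable (I : InterpForms LA L m) (b : Fin m → B) :
    (I.at b).Each (GenDefinable (allForms L) b) := by
  refine ⟨⟨I.dom, fun _ => trivial, fun x => ?_⟩, ⟨I.eqv, fun _ => trivial, fun x => ?_⟩,
    fun k R => ⟨I.rel R, fun _ => trivial, fun x => Iff.rfl⟩⟩
  · rw [show x = ![x 0] by funext j; fin_cases j; rfl]; rfl
  · rw [show x = ![x 0, x 1] by funext j; fin_cases j <;> rfl]; rfl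

variable [Encodable (Σ k, L.Functions k)] [Encodable (Σ k, L.Relations k)]
  {X : Set ℕ} {o : Option Ordinal.{0}}

theorem xGenDefinable_parameterFree (ho : ∀ α ∈ o, 1 ≤ α)
    (hOdef : XSetDefinable X (sigmaClass L o) (tupOrbit L b))
    (hFdef : XGenDefinable X (sigmaClass L o) ![] 4 F)
    (hDdef : XGenDefinable X (sigmaClass L o) b 1 (I.at b).domRel) (r : ℕ)
    (S : (Fin m → B) → Set (Fin r → Tup B)) (hS : Equivariant L S)
    (hSdef : XGenDefinable X (sigmaClass L o) b r (S b)) :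
    XGenDefinable X (sigmaClass L o) ![] r
      (parameterFree (tupOrbit L b) (fun c => (I.at c).dom) F S) :=
  xGenDefinableFamily_parameterFree (ι := Unit) (r := fun _ => r) (S := fun _ => S) ho
    I.equivariant_dom (fun _ => hS) hOdef hFdef hDdef hSdef

variable [Encodable (Σ k, LA.Relations k)]

theorem uniformlyX_parameterFree (ho : ∀ α ∈ o, 1 ≤ α)
    (hOdef : XSetDefinable X (sigmaClass L o) (tupOrbit L b))
    (hFdef : XGenDefinable X (sigmaClass L o) ![] 4 F)
    (h : (I.at b).UniformlyX X (sigmaClass L o) b) :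
    (I.parameterFree b F).UniformlyX X (sigmaClass L o) ![] := by
  obtain ⟨h1, h2, h3⟩ := h
  refine ⟨?_, ?_, xGenDefinableFamily_parameterFree
    (S := fun (R : Σ k, LA.Relations k) c => (I.at c).rel R.2) ho I.equivariant_dom
    (fun R => I.equivariant_rel R.2) hOdef hFdef h1 h3⟩
  · rw [domRel_parameterFree]
    exact xGenDefinable_parameterFree ho hOdef hFdef h1 1 _ I.equivariant_dom h1
  · rw [eqvRel_parameterFree]
    exact xGenDefinable_parameterFree ho hOdef hFdef h1 2 _ I.equivariant_eqv h2

theorem CoherentIso.uniformlyXPM_parameterFree [LA.IsRelational] (C : CoherentIso I b F)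
    (ho : ∀ α ∈ o, 1 ≤ α) (hOdef : XSetDefinable X (sigmaClass L o) (tupOrbit L b))
    (hFdef : XGenDefinable X (sigmaClass L o) ![] 4 F)
    (h : (I.at b).UniformlyXPM X (sigmaClass L o) b) :
    (I.parameterFree b F).UniformlyXPM X (sigmaClass L o) ![] := by
  obtain ⟨h1, h2, h3⟩ := h
  refine ⟨uniformlyX_parameterFree ho hOdef hFdef h1, ?_, ?_⟩
  · rw [C.neqvRel_eq]
    exact xGenDefinable_parameterFree ho hOdef hFdef h1.1 2 _ I.equivariant_neqv h2
  · simp only [C.nrel_eq]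
    exact xGenDefinableFamily_parameterFree
      (S := fun (R : Σ k, LA.Relations k) c => (I.at c).nrel R.2) ho I.equivariant_dom
      (fun R => I.equivariant_nrel R.2) hOdef hFdef h1.1 h3

end Main

theorem mainTheorem5
    {L : FirstOrder.Language.{u, v}} [Encodable (Σ k, L.Functions k)] [Encodable (Σ k, L.Relations k)]
    {LA : FirstOrder.Language.{u', v'}} [LA.IsRelational] [Encodable (Σ k, LA.Relations k)]
    {A : Type w'} [LA.Structure A] {B : Type w} [L.Structure B] [Countable B]
    {m : ℕ} (b : Fin m → B)
    -- an interpretation of `A` in `(B, b)` by generalized `L_{ω₁ω}` formulas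
    (I : InterpForms LA L m) (hI : (I.at b).Interprets A)
    -- a definable relation `F` that defines the isomorphisms `f c d` from `A_c` onto `A_d`
    (F : Set (Fin 4 → Tup B)) (hF : GenDefinable (allForms L) ![] 4 F)
    (f : ∀ c d : tupOrbit L b, (I.at c.1).Carrier ≃[LA] (I.at d.1).Carrier)
    (hfF : ∀ (c d : tupOrbit L b) (x : (I.at c.1).dom) (y : (I.at d.1).dom),
      f c d ((I.at c.1).cls x) = (I.at d.1).cls y ↔ ![⟨m, c.1⟩, ⟨m, d.1⟩, x.1, y.1] ∈ F)
    (hid : ∀ (c : tupOrbit L b) (q : (I.at c.1).Carrier), f c c q = q)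
    (hcomp : ∀ (c d e : tupOrbit L b) (q : (I.at c.1).Carrier), f d e (f c d q) = f c e q) :
    -- every countable set of formulas is computed by some `X`
    (∀ S : Set (Σ n, InfForm L n), S.Countable → ∃ X : Set ℕ, ∀ φ ∈ S, φ.2.IsXComputable X) ∧
    -- there is an interpretation of `A` in `B` without parameters
    ∃ J : TupPresentation LA B, J.Interprets A ∧
      J.Each (GenDefinable (allForms L) ![]) ∧
      -- `Σ_α` formulas
      (∀ α : Ordinal.{0}, 1 ≤ α → α < Ordinal.omega 1 →
        (I.at b).Each (GenDefinable (sigmaForms L α) b) →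
        GenDefinable (sigmaForms L α) ![] 4 F →
        SetDefinable (sigmaForms L α) (tupOrbit L b) →
        J.Each (GenDefinable (sigmaForms L α) ![])) ∧
      -- `Σ_α` formulas, including complements
      (∀ α : Ordinal.{0}, 1 ≤ α → α < Ordinal.omega 1 →
        (I.at b).EachPM (GenDefinable (sigmaForms L α) b) →
        GenDefinable (sigmaForms L α) ![] 4 F →
        SetDefinable (sigmaForms L α) (tupOrbit L b) →
        J.EachPM (GenDefinable (sigmaForms L α) ![])) ∧
      -- `X`-computable formulas, and `X`-computable `Σ_α` formulas
      (∀ (X : Set ℕ) (Γ : FormClass L),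
        (Γ = allForms L ∨ ∃ α : Ordinal.{0}, 1 ≤ α ∧ α < Ordinal.omega 1 ∧ Γ = sigmaForms L α) →
        XGenDefinable X Γ ![] 4 F →
        XSetDefinable X Γ (tupOrbit L b) →
        ((I.at b).Each (XGenDefinable X Γ b) → J.Each (XGenDefinable X Γ ![])) ∧
        ((I.at b).EachPM (XGenDefinable X Γ b) → J.EachPM (XGenDefinable X Γ ![])) ∧
        ((I.at b).UniformlyX X Γ b → J.UniformlyX X Γ ![]) ∧
        ((I.at b).UniformlyXPM X Γ b → J.UniformlyXPM X Γ ![])) ∧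
      -- non-generalized formulas
      (∀ n : ℕ, (I.at b).DomIn n →
        J.DomIn (n + m) ∧ J.Each fun _ S => DefinableAt (allForms L) ![] (fun _ => n + m) S) ∧
      -- finitary formulas
      (∀ n : ℕ, (I.at b).DomIn n →
        ((I.at b).Each fun _ S => DefinableAt (finitaryForms L) b (fun _ => n) S) →
        DefinableAt (finitaryForms L) ![] ![m, m, n, n] F →
        SetDefinable (finitaryForms L) (tupOrbit L b) →
        J.Each fun _ S => DefinableAt (finitaryForms L) ![] (fun _ => n + m) S) := by
  let C : CoherentIso I b F := ⟨f, hI.isCongruence, hfF, hid, hcomp⟩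
  -- Here definability of the orbit is not assumed; countability of `B` supplies it.
  have hall : (I.parameterFree b F).Each (GenDefinable (allForms L) ![]) :=
    each_parameterFree (fun hD r S hS _ hSdef => genDefinable_parameterFree (o := none)
      (by simp) I.equivariant_dom hS (setDefinable_tupOrbit b) hF hD hSdef)
      C.isCongruence (I.each_genDefinable b)
  refine ⟨exists_isXComputable, I.parameterFree b F, C.interprets_parameterFree hI.iso, hall,
    ?_, ?_, ?_, ?_, ?_⟩
  · intro α hα _ h hFα hOα
    exact each_parameterFree (fun hD r S hS _ hSdef => genDefinable_parameterFree (o := some α)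
      (fun _ h => Option.some_inj.1 h ▸ hα) I.equivariant_dom hS hOα hFα hD hSdef)
      C.isCongruence h
  · intro α hα _ h hFα hOα
    exact C.eachPM_parameterFree (fun hD r S hS hSdef => genDefinable_parameterFree (o := some α)
      (fun _ h => Option.some_inj.1 h ▸ hα) I.equivariant_dom hS hOα hFα hD hSdef) h
  · intro X Γ hΓ hFX hOX
    -- The two admissible kinds of classes are treated together: no ordinal stands for all formulas.
    obtain ⟨o, ho, rfl⟩ : ∃ o : Option Ordinal.{0}, (∀ α ∈ o, 1 ≤ α) ∧ Γ = sigmaClass L o := by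
      obtain rfl | ⟨α, hα, -, rfl⟩ := hΓ
      · exact ⟨none, by simp, rfl⟩
      · exact ⟨some α, fun _ h => Option.some_inj.1 h ▸ hα, rfl⟩
    exact ⟨each_parameterFree (fun hD r S hS _ => xGenDefinable_parameterFree ho hOX hFX hD r S hS)
        C.isCongruence,
      C.eachPM_parameterFree (fun hD r S hS => xGenDefinable_parameterFree ho hOX hFX hD r S hS),
      uniformlyX_parameterFree ho hOX hFX, C.uniformlyXPM_parameterFree ho hOX hFX⟩
  · intro n hn
    exact ⟨C.domIn_parameterFree hn, hall.1.definableAt _, hall.2.1.definableAt _,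
      fun k R => (hall.2.2 k R).definableAt _⟩
  · intro n hn h hFn hO
    exact each_parameterFree (fun hD r S hS hSD hSdef => definableAt_parameterFree
      I.equivariant_dom hS (fun c hc y hy j => hn.of_mem_tupOrbit hc _ (hSD c hc y hy j)) hO hFn
      hD hSdef) C.isCongruence h
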